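/- Let $d\ge 0$ be an integer. The Clifford group $\mathsf{Cliff}(d)$ is generated by $\xi_1,\dots,\xi_d$ and a central element $\epsilon$ subject to $\xi_i^2=1$, $\epsilon^2=1$, $\xi_i\xi_j=\epsilon\,\xi_j\xi_i$ $(i\ne j)$, and $\mathsf C(d)=\mathsf{Cliff}(d)\rtimes \mathsf S(d)$ is the Sergeev group, where the symmetric group $\mathsf S(d)$ permutes the $\xi_i$; it is $\mathbb Z_2$-graded by $\deg\xi_i=1$, $\deg\epsilon=\deg g=0$ for $g\in\mathsf S(d)$. Let $\mathrm{OP}(d)$ be the set of partitions of $d$ with all parts odd, and let $\mathrm{SP}^{+}(d)$ (resp. $\mathrm{SP}^{-}(d)$) be the set of strict partitions of $d$ (no repeated parts) with an even (resp. odd) number of parts. For $\gamma\in\mathrm{OP}(d)$ let $\ell(\gamma)$ be its number of parts, $\gamma(k)$ its number of parts equal to $k$, and $$\vartheta_\gamma=2^{\ell(\gamma)+1}\prod_k k^{\gamma(k)}\,\gamma(k)!\,.$$ Let $C_\gamma\subset\mathsf C(d)$ be the conjugacy class of a permutation of cycle type $\gamma$, $\overline C_\gamma=\sum_{x\in C_\gamma}x\in\mathbb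 C[\mathsf C(d)]$ its class sum, and $u_\gamma=\tfrac12(\overline C_\gamma-\epsilon\,\overline C_\gamma)$. A spin $\mathsf C(d)$-supermodule is a finite-dimensional complex $\mathbb Z_2$-graded representation of $\mathsf C(d)$, compatible with the grading of $\mathsf C(d)$, on which $\epsilon$ acts as $-1$. For a strict partition $\lambda$ of $d$ let $V^\lambda$ be the irreducible spin $\mathsf C(d)$-supermodule indexed by $\lambda$, i.e. the one such that $\lambda$ is the lexicographically largest partition $\mu$ of $d$ for which $V^\lambda$ contains a nonzero vector fixed by a Young subgroup of $\mathsf S(d)$ of type $\mu$; it is unique up to isomorphism and parity shift. Let $\zeta^\lambda$ be its character, and put $$c_\lambda=\frac{\dim V^\lambda}{|\mathsf C(d)|},\qquad \mathbf f_\gamma(\lambda)=\frac{|C_\gamma|}{\dim V^\lambda}\,\zeta^\lambda(C_\gamma),$$ the latter being the central character, i.e. the constant by which $\overline C_\gamma$ acts on $V^\lambda$. Then for all $\alpha,\beta\in\mathrm{OP}(d)$ the product $u_\alpha u_\beta$ can be written in one and only one way as $u_\alpha u_\beta=\sum_{\gamma\in\mathrm{OP}(d)}a^\gamma_{\alpha\beta}\,u_\gamma$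 with $a^\gamma_{\alpha\beta}\in\mathbb C$, and $$a^\gamma_{\alpha\beta}=\vartheta_\gamma\Big(\sum_{\lambda\in\mathrm{SP}^+(d)}2c_\lambda^2\,\mathbf f_\alpha(\lambda)\mathbf f_\beta(\lambda)\mathbf f_\gamma(\lambda)+\sum_{\lambda\in\mathrm{SP}^-(d)}c_\lambda^2\,\mathbf f_\alpha(\lambda)\mathbf f_\beta(\lambda)\mathbf f_\gamma(\lambda)\Big).$$ -/

import Mathlib

/-- Generators of the Clifford group: the central element `ε` and `ξ_1, …, ξ_d`. -/
inductive CliffGen (d : ℕ) : Type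
  | eps : CliffGen d
  | xi (i : Fin d) : CliffGen d

/-- Defining relations `ξ_i² = 1`, `ε² = 1`, `ε` central, `ξ_i ξ_j = ε ξ_j ξ_i` for `i ≠ j`. -/
def cliffRels (d : ℕ) : Set (FreeGroup (CliffGen d)) :=
  {r | r = FreeGroup.of CliffGen.eps ^ 2
    ∨ (∃ i : Fin d, r = FreeGroup.of (CliffGen.xi i) ^ 2)
    ∨ (∃ i : Fin d, r = (FreeGroup.of CliffGen.eps * FreeGroup.of (CliffGen.xi i)) *
        (FreeGroup.of (CliffGen.xi i) * FreeGroup.of CliffGen.eps)⁻¹)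
    ∨ (∃ i j : Fin d, i ≠ j ∧ r = (FreeGroup.of (CliffGen.xi i) * FreeGroup.of (CliffGen.xi j)) *
        (FreeGroup.of CliffGen.eps * FreeGroup.of (CliffGen.xi j) *
          FreeGroup.of (CliffGen.xi i))⁻¹)}

/-- The Clifford group `Cliff(d)`. -/
abbrev Cliff (d : ℕ) : Type := PresentedGroup (cliffRels d)

namespace Cliff

/-- The central element `ε`. -/
def eps (d : ℕ) : Cliff d := PresentedGroup.of CliffGen.eps

/-- The generator `ξ_i`. -/
def xi {d : ℕ} (i : Fin d) : Cliff d := PresentedGroup.of (CliffGen.xi i)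

theorem eps_sq (d : ℕ) : eps d * eps d = 1 := by
  have h := PresentedGroup.one_of_mem (rels := cliffRels d) (Or.inl rfl)
  simpa [pow_two, eps, PresentedGroup.of] using h

theorem xi_sq {d : ℕ} (i : Fin d) : xi i * xi i = 1 := by
  have h := PresentedGroup.one_of_mem (rels := cliffRels d) (Or.inr (Or.inl ⟨i, rfl⟩))
  simpa [pow_two, xi, PresentedGroup.of] using h

theorem eps_xi {d : ℕ} (i : Fin d) : eps d * xi i = xi i * eps d := by
  have h := PresentedGroup.one_of_mem (rels := cliffRels d) (Or.inr (Or.inr (Or.inl ⟨i, rfl⟩)))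
  rw [map_mul, map_inv, mul_inv_eq_one, map_mul, map_mul] at h
  exact h

theorem xi_xi {d : ℕ} {i j : Fin d} (hij : i ≠ j) : xi i * xi j = eps d * xi j * xi i := by
  have h := PresentedGroup.one_of_mem (rels := cliffRels d)
    (Or.inr (Or.inr (Or.inr ⟨i, j, hij, rfl⟩)))
  rw [map_mul, map_inv, mul_inv_eq_one, map_mul, map_mul, map_mul] at h
  exact h

/-- A homomorphism out of `Cliff(d)` from images of the generators that satisfy the relations. -/
def lift {d : ℕ} {G : Type*} [Group G] (e : G) (x : Fin d → G)
    (he : e * e = 1) (hx : ∀ i, x i * x i = 1) (hex : ∀ i, e * x i = x i * e)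
    (hxx : ∀ i j, i ≠ j → x i * x j = e * x j * x i) : Cliff d →* G :=
  PresentedGroup.toGroup (f := fun g => match g with
    | CliffGen.eps => e
    | CliffGen.xi i => x i) (by
      rintro r (rfl | ⟨i, rfl⟩ | ⟨i, rfl⟩ | ⟨i, j, hij, rfl⟩)
      · simpa [pow_two] using he
      · simpa [pow_two] using hx i
      · rw [map_mul, map_inv, mul_inv_eq_one]
        simpa using hex i
      · rw [map_mul, map_inv, mul_inv_eq_one]
        simpa using hxx i j hij)

section
variable {d : ℕ} {G : Type*} [Group G] (e : G) (x : Fin d → G)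
    (he : e * e = 1) (hx : ∀ i, x i * x i = 1) (hex : ∀ i, e * x i = x i * e)
    (hxx : ∀ i j, i ≠ j → x i * x j = e * x j * x i)

@[simp] theorem lift_eps : lift e x he hx hex hxx (eps d) = e := PresentedGroup.toGroup.of _

@[simp] theorem lift_xi (i : Fin d) : lift e x he hx hex hxx (xi i) = x i :=
  PresentedGroup.toGroup.of _

end

theorem hom_ext {d : ℕ} {G : Type*} [Monoid G] {f g : Cliff d →* G}
    (he : f (eps d) = g (eps d)) (hx : ∀ i, f (xi i) = g (xi i)) : f = g := by
  have key : ∀ y : Cliff d, f y = g y := by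
    intro y
    have hy : y ∈ Subgroup.closure (Set.range (PresentedGroup.of (rels := cliffRels d))) := by
      rw [PresentedGroup.closure_range_of]; trivial
    have h : Subgroup.closure (Set.range (PresentedGroup.of (rels := cliffRels d)))
        ≤ f.eqLocus g := by
      rw [Subgroup.closure_le]
      rintro _ ⟨a, rfl⟩
      cases a with
      | eps => exact he
      | xi i => exact hx i
    exact h hy
  exact MonoidHom.ext key

/-- The endomorphism `ε ↦ ε`, `ξ_i ↦ ξ_{σ(i)}`. -/
def permHom {d : ℕ} (σ : Equiv.Perm (Fin d)) : Cliff d →* Cliff d :=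
  lift (eps d) (fun i => xi (σ i)) (eps_sq d) (fun _ => xi_sq _) (fun _ => eps_xi _)
    (fun _ _ hij => xi_xi (fun h => hij (σ.injective h)))

theorem permHom_comp {d : ℕ} (σ τ : Equiv.Perm (Fin d)) :
    (permHom σ).comp (permHom τ) = permHom (σ * τ) :=
  hom_ext (by simp [permHom]) (fun i => by simp [permHom])

theorem permHom_one (d : ℕ) : permHom (1 : Equiv.Perm (Fin d)) = MonoidHom.id _ :=
  hom_ext (by simp [permHom]) (fun i => by simp [permHom])

/-- The action of the symmetric group on `Cliff(d)` that permutes the `ξ_i`. -/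
def permAction (d : ℕ) : Equiv.Perm (Fin d) →* MulAut (Cliff d) where
  toFun σ := (permHom σ).toMulEquiv (permHom σ⁻¹)
    (by rw [permHom_comp, inv_mul_cancel, permHom_one])
    (by rw [permHom_comp, mul_inv_cancel, permHom_one])
  map_one' := by
    ext y
    exact DFunLike.congr_fun (permHom_one d) y
  map_mul' σ τ := by
    ext y
    exact (DFunLike.congr_fun (permHom_comp σ τ) y).symm

/-- The `ℤ/2`-degree on `Cliff(d)`: `deg ε = 0`, `deg ξ_i = 1`. -/
def degree (d : ℕ) : Cliff d →* Multiplicative (ZMod 2) :=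
  lift 1 (fun _ => Multiplicative.ofAdd 1) (by decide) (fun _ => by decide) (fun _ => by decide)
    (fun _ _ _ => by decide)

/-- The normally ordered words in `ε` and the `ξ_i` with `i` in a given list. -/
def words {d : ℕ} : List (Fin d) → Set (Cliff d)
  | [] => {1, eps d}
  | i :: l => words l ∪ (fun y => xi i * y) '' words l

theorem words_finite {d : ℕ} (l : List (Fin d)) : (words l).Finite := by
  induction l with
  | nil => exact (Set.finite_singleton _).insert _
  | cons i l ih => exact ih.union (ih.image _)

theorem one_mem_words {d : ℕ} (l : List (Fin d)) : (1 : Cliff d) ∈ words l := by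
  induction l with
  | nil => exact Or.inl rfl
  | cons i l ih => exact Or.inl ih

theorem eps_mul_mem_words {d : ℕ} (l : List (Fin d)) :
    ∀ y ∈ words l, eps d * y ∈ words l := by
  induction l with
  | nil =>
    rintro y (rfl | rfl)
    · exact Or.inr (mul_one _)
    · exact Or.inl (eps_sq d)
  | cons i l ih =>
    rintro y (hy | ⟨z, hz, rfl⟩)
    · exact Or.inl (ih y hy)
    · refine Or.inr ⟨eps d * z, ih z hz, ?_⟩
      simp only [← mul_assoc, eps_xi]

theorem xi_mul_mem_words {d : ℕ} (j : Fin d) (l : List (Fin d)) (hj : j ∈ l) :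
    ∀ y ∈ words l, xi j * y ∈ words l := by
  induction l with
  | nil => simp at hj
  | cons i l ih =>
    rintro y hy
    by_cases hij : j = i
    · subst hij
      rcases hy with hy | ⟨z, hz, rfl⟩
      · exact Or.inr ⟨y, hy, rfl⟩
      · refine Or.inl ?_
        simpa only [← mul_assoc, xi_sq, one_mul] using hz
    · have hjl : j ∈ l := by simpa [hij] using hj
      rcases hy with hy | ⟨z, hz, rfl⟩
      · exact Or.inl (ih hjl y hy)
      · refine Or.inr ⟨eps d * (xi j * z), eps_mul_mem_words l _ (ih hjl z hz), ?_⟩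
        simp only [← mul_assoc]
        rw [xi_xi hij, eps_xi i]

instance instFinite (d : ℕ) : Finite (Cliff d) := by
  refine Set.finite_univ_iff.mp ((words_finite (List.finRange d)).subset ?_)
  intro y _
  have hsq : ∀ a : CliffGen d, (PresentedGroup.of a : Cliff d)⁻¹ = PresentedGroup.of a := by
    intro a
    cases a with
    | eps => exact inv_eq_of_mul_eq_one_left (eps_sq d)
    | xi i => exact inv_eq_of_mul_eq_one_left (xi_sq i)
  have hmul : ∀ a : CliffGen d, ∀ z ∈ words (List.finRange d),
      (PresentedGroup.of a : Cliff d) * z ∈ words (List.finRange d) := by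
    intro a z hz
    cases a with
    | eps => exact eps_mul_mem_words _ z hz
    | xi i => exact xi_mul_mem_words i _ (List.mem_finRange i) z hz
  have hy : y ∈ Subgroup.closure (Set.range (PresentedGroup.of (rels := cliffRels d))) := by
    rw [PresentedGroup.closure_range_of]; trivial
  induction hy using Subgroup.closure_induction_left with
  | one => exact one_mem_words _
  | mul_left a ha z _ ih =>
    obtain ⟨b, rfl⟩ := ha
    exact hmul b z (ih trivial)
  | inv_mul_cancel a ha z _ ih =>
    obtain ⟨b, rfl⟩ := ha
    rw [hsq b]
    exact hmul b z (ih trivial)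

end Cliff

/-- The Sergeev group `C(d) = Cliff(d) ⋊ S(d)`. -/
abbrev SergeevGroup (d : ℕ) : Type := Cliff d ⋊[Cliff.permAction d] Equiv.Perm (Fin d)

instance SergeevGroup.instFinite (d : ℕ) : Finite (SergeevGroup d) :=
  Finite.of_equiv _ SemidirectProduct.equivProd.symm

namespace SergeevGroup

/-- The central element `ε` of `C(d)`. -/
def eps (d : ℕ) : SergeevGroup d := SemidirectProduct.inl (Cliff.eps d)

/-- A pure permutation, as an element of `C(d)`. -/
def perm {d : ℕ} (σ : Equiv.Perm (Fin d)) : SergeevGroup d := SemidirectProduct.inr σ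

/-- The `ℤ/2`-degree on `C(d)`: `deg ξ_i = 1`, `deg ε = 0`, `deg g = 0` for `g ∈ S(d)`.
(The degree of `y g` with `y ∈ Cliff(d)` and `g ∈ S(d)` is that of `y`.) -/
def degree {d : ℕ} (x : SergeevGroup d) : ZMod 2 := Multiplicative.toAdd (Cliff.degree d x.left)

/-- `C_γ`: the conjugacy class in `C(d)` of a pure permutation of cycle type `γ`. -/
def conjClass {d : ℕ} (γ : Nat.Partition d) : Set (SergeevGroup d) :=
  {x | ∃ σ : Equiv.Perm (Fin d), σ.partition.parts = γ.parts ∧ IsConj (perm σ) x}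

/-- The class sum `C̄_γ` in the group algebra `ℂ[C(d)]`. -/
noncomputable def classSum {d : ℕ} (γ : Nat.Partition d) : MonoidAlgebra ℂ (SergeevGroup d) :=
  ∑ x ∈ (Set.toFinite (conjClass γ)).toFinset, MonoidAlgebra.of ℂ (SergeevGroup d) x

/-- `u_γ = ½ (C̄_γ - ε C̄_γ)`. -/
noncomputable def u {d : ℕ} (γ : Nat.Partition d) : MonoidAlgebra ℂ (SergeevGroup d) :=
  (1 / 2 : ℂ) • (classSum γ - MonoidAlgebra.of ℂ (SergeevGroup d) (eps d) * classSum γ)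

end SergeevGroup

/-- `z_γ = ∏_k k^{γ(k)} γ(k)!`, where `γ(k)` is the number of parts of size `k` in `γ`. -/
def Nat.Partition.zNumber {d : ℕ} (γ : Nat.Partition d) : ℕ :=
  ∏ k ∈ γ.parts.toFinset, k ^ γ.parts.count k * (γ.parts.count k).factorial

/-- `ϑ_γ = 2^{ℓ(γ)+1} z_γ`. -/
def Nat.Partition.theta {d : ℕ} (γ : Nat.Partition d) : ℕ :=
  2 ^ (γ.parts.card + 1) * γ.zNumber

/-- The parts of a partition in weakly decreasing order. -/
def Nat.Partition.rows {d : ℕ} (μ : Nat.Partition d) : List ℕ := μ.parts.sort (· ≥ ·)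

/-- `SP⁺(d)`: strict partitions (no repeated parts) with an even number of parts. -/
def strictEven (d : ℕ) : Finset (Nat.Partition d) :=
  (Nat.Partition.distincts d).filter fun lam => Even lam.parts.card

/-- `SP⁻(d)`: strict partitions with an odd number of parts. -/
def strictOdd (d : ℕ) : Finset (Nat.Partition d) :=
  (Nat.Partition.distincts d).filter fun lam => Odd lam.parts.card

/-- A (finite-dimensional, complex) spin `C(d)`-supermodule: a representation of `C(d)` on a
`ℤ/2`-graded space `V = V_0 ⊕ V_1` such that an element of degree `j` maps `V_i` into `V_{i+j}`
and `ε` acts as `-1`. -/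
structure SpinSupermodule (d : ℕ) where
  carrier : Type
  [addCommGroup : AddCommGroup carrier]
  [module : Module ℂ carrier]
  [finite : FiniteDimensional ℂ carrier]
  ρ : Representation ℂ (SergeevGroup d) carrier
  grade : ZMod 2 → Submodule ℂ carrier
  isCompl : IsCompl (grade 0) (grade 1)
  map_grade : ∀ (x : SergeevGroup d) (i : ZMod 2), ∀ v ∈ grade i, ρ x v ∈ grade (i + x.degree)
  spin : ∀ v, ρ (SergeevGroup.eps d) v = -v

namespace SpinSupermodule

attribute [instance] addCommGroup module finite

variable {d : ℕ}

/-- Irreducible (simple) as a supermodule: nonzero, and the only graded invariant subspaces are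
`0` and the whole space. -/
def IsIrreducible (M : SpinSupermodule d) : Prop :=
  Nontrivial M.carrier ∧ ∀ W : Submodule ℂ M.carrier,
    (∀ x, ∀ v ∈ W, M.ρ x v ∈ W) → W ⊓ M.grade 0 ⊔ W ⊓ M.grade 1 = W → W = ⊥ ∨ W = ⊤

/-- `M` has a nonzero vector fixed by a Young subgroup of `S(d)` of type `μ`, that is, by the
stabilizer of a map `c` whose fibres (the blocks) have sizes `μ_1 ≥ μ_2 ≥ ⋯`.  Equivalently
(Frobenius reciprocity), there is a nonzero homomorphism to `M` from the spin supermodule that is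
induced from the trivial representation of that Young subgroup. -/
def HasWeight (M : SpinSupermodule d) (μ : Nat.Partition d) : Prop :=
  ∃ c : Fin d → ℕ, (∀ i, (Finset.univ.filter fun x => c x = i).card = μ.rows.getD i 0) ∧
    ∃ v : M.carrier, v ≠ 0 ∧
      ∀ σ : Equiv.Perm (Fin d), c ∘ σ = c → M.ρ (SergeevGroup.perm σ) v = v

/-- `M` has highest weight `lam`: among the partitions `μ` of `d` for which `M` has a nonzero
vector fixed by a Young subgroup of type `μ`, `lam` is the largest in lexicographic order. -/
def HasHighestWeight (M : SpinSupermodule d) (lam : Nat.Partition d) : Prop :=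
  M.HasWeight lam ∧ ∀ μ : Nat.Partition d, M.HasWeight μ → μ.rows ≤ lam.rows

/-- The zero supermodule; it only serves to show that the type is inhabited. -/
instance : Nonempty (SpinSupermodule d) :=
  ⟨{ carrier := PUnit
     ρ := 1
     grade := fun _ => ⊥
     isCompl := by
       exact ⟨disjoint_bot_left, codisjoint_iff.mpr (Subsingleton.elim _ _)⟩
     map_grade := fun _ _ _ _ => Subsingleton.elim _ _
     spin := fun _ => Subsingleton.elim _ _ }⟩

end SpinSupermodule

/-- `V^λ`: the irreducible spin `C(d)`-supermodule indexed by the strict partition `λ`, that is,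
the one of highest weight `λ` (it is unique up to isomorphism and parity shift; its characteristic
is the multiple `2^{-⌊ℓ(λ)/2⌋} Q_λ` of the Schur `Q`-function). -/
noncomputable def spinIrrep {d : ℕ} (lam : Nat.Partition d) : SpinSupermodule d :=
  Classical.epsilon fun M => M.IsIrreducible ∧ M.HasHighestWeight lam

/-- `c_λ = dim V^λ / |C(d)|`. -/
noncomputable def cNumber {d : ℕ} (lam : Nat.Partition d) : ℂ :=
  (Module.finrank ℂ (spinIrrep lam).carrier : ℂ) / (Nat.card (SergeevGroup d) : ℂ)

/-- The character `ζ^λ` of `V^λ`. -/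
noncomputable def zeta {d : ℕ} (lam : Nat.Partition d) (x : SergeevGroup d) : ℂ :=
  LinearMap.trace ℂ (spinIrrep lam).carrier ((spinIrrep lam).ρ x)

/-- The central character `f_γ(λ) = (|C_γ| / dim V^λ) ζ^λ(C_γ)`, the constant by which the class
sum `C̄_γ` acts on `V^λ`.  Since `ζ^λ` is constant on `C_γ`, the number `|C_γ| ζ^λ(C_γ)` is the sum
of `ζ^λ` over `C_γ`. -/
noncomputable def centralChar {d : ℕ} (γ lam : Nat.Partition d) : ℂ :=
  (∑ x ∈ (Set.toFinite (SergeevGroup.conjClass γ)).toFinset, zeta lam x) /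
    (Module.finrank ℂ (spinIrrep lam).carrier : ℂ)

open SergeevGroup

/-! ### Generators of the Sergeev group -/

namespace SergeevGroup

/-- The generator `ξ_i`, as an element of `C(d)`. -/
def xi {d : ℕ} (i : Fin d) : SergeevGroup d := SemidirectProduct.inl (Cliff.xi i)

theorem xi_mul_self {d : ℕ} (i : Fin d) : xi i * xi i = 1 := by
  rw [xi, ← map_mul, Cliff.xi_sq, map_one]

theorem xi_mul_xi {d : ℕ} {i j : Fin d} (h : i ≠ j) : xi i * xi j = eps d * (xi j * xi i) := by
  rw [xi, xi, eps, ← map_mul, ← map_mul, ← map_mul, Cliff.xi_xi h, mul_assoc]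

theorem permAction_xi {d : ℕ} (σ : Equiv.Perm (Fin d)) (i : Fin d) :
    Cliff.permAction d σ (Cliff.xi i) = Cliff.xi (σ i) := by
  change Cliff.permHom σ (Cliff.xi i) = _
  simp [Cliff.permHom]

theorem permAction_eps {d : ℕ} (σ : Equiv.Perm (Fin d)) :
    Cliff.permAction d σ (Cliff.eps d) = Cliff.eps d := by
  change Cliff.permHom σ (Cliff.eps d) = _
  simp [Cliff.permHom]

theorem perm_mul_xi {d : ℕ} (σ : Equiv.Perm (Fin d)) (i : Fin d) :
    perm σ * xi i = xi (σ i) * perm σ := by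
  have h := SemidirectProduct.inl_aut (φ := Cliff.permAction d) σ (Cliff.xi i)
  rw [permAction_xi] at h
  rw [xi, xi, perm, h, map_inv, inv_mul_cancel_right]

theorem perm_mul {d : ℕ} (σ τ : Equiv.Perm (Fin d)) : perm (σ * τ) = perm σ * perm τ :=
  map_mul _ _ _

theorem perm_one {d : ℕ} : perm (1 : Equiv.Perm (Fin d)) = 1 := map_one _

theorem closure_gens (d : ℕ) : Subgroup.closure
    ({eps d} ∪ Set.range (xi (d := d)) ∪ Set.range (perm (d := d))) = ⊤ := by
  set H := Subgroup.closure
    ({eps d} ∪ Set.range (xi (d := d)) ∪ Set.range (perm (d := d)))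
  rw [eq_top_iff]
  intro x _
  have hl : ∀ y : Cliff d, SemidirectProduct.inl (φ := Cliff.permAction d) y ∈ H := by
    intro y
    have hy : y ∈ Subgroup.closure (Set.range (PresentedGroup.of (rels := cliffRels d))) := by
      rw [PresentedGroup.closure_range_of]; trivial
    have h : Subgroup.closure (Set.range (PresentedGroup.of (rels := cliffRels d)))
        ≤ H.comap (SemidirectProduct.inl (φ := Cliff.permAction d)) := by
      rw [Subgroup.closure_le]
      rintro _ ⟨a, rfl⟩
      cases a with
      | eps => exact Subgroup.subset_closure (Or.inl (Or.inl rfl))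
      | xi i => exact Subgroup.subset_closure (Or.inl (Or.inr ⟨i, rfl⟩))
    exact h hy
  rw [← SemidirectProduct.inl_left_mul_inr_right x]
  exact H.mul_mem (hl _) (Subgroup.subset_closure (Or.inr ⟨x.right, rfl⟩))

end SergeevGroup


section StableSubspaces

variable {d : ℕ} {V : Type*} [AddCommGroup V] [Module ℂ V]

/-- A finite-dimensional subspace stable under the generators is stable under the group. -/
theorem stable_of_gens (ρ : Representation ℂ (SergeevGroup d) V) (hε : ρ (eps d) = -1)
    (W : Submodule ℂ V) (hxi : ∀ i, ∀ v ∈ W, ρ (xi i) v ∈ W)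
    (hperm : ∀ σ, ∀ v ∈ W, ρ (perm σ) v ∈ W) (x : SergeevGroup d) : ∀ v ∈ W, ρ x v ∈ W := by
  have hx : x ∈ Subgroup.closure
    ({eps d} ∪ Set.range (xi (d := d)) ∪ Set.range (perm (d := d))) := by
    rw [closure_gens]; trivial
  induction hx using Subgroup.closure_induction'' with
  | one => intro v hv; simpa using hv
  | mem y hy =>
    intro v hv
    rcases hy with (hy | ⟨i, rfl⟩) | ⟨σ, rfl⟩
    · rw [hy, hε]; simpa using hv
    · exact hxi i v hv
    · exact hperm σ v hv
  | inv_mem y hy =>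
    intro v hv
    rcases hy with (hy | ⟨i, rfl⟩) | ⟨σ, rfl⟩
    · have : (eps d)⁻¹ = eps d := by
        rw [inv_eq_iff_mul_eq_one, eps, ← map_mul, Cliff.eps_sq, map_one]
      rw [hy, this, hε]; simpa using hv
    · rw [inv_eq_of_mul_eq_one_left (xi_mul_self i)]; exact hxi i v hv
    · have : (perm σ)⁻¹ = perm σ⁻¹ := (map_inv _ _).symm
      rw [this]; exact hperm _ v hv
  | mul y z _ _ hy hz => intro v hv; rw [map_mul]; exact hy _ (hz _ hv)

end StableSubspaces

/-! ### The queer Lie superalgebra acting on functions of colourings -/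

section Recolor

variable {d : ℕ} {V : Type*} [AddCommGroup V] [Module ℂ V]
  (ρ : Representation ℂ (SergeevGroup d) V)

/-- `ξ_x` or the identity. -/
def xiPow (a : Bool) (x : Fin d) : Module.End ℂ V := bif a then ρ (xi x) else 1

/-- The even (`a = false`) and odd (`a = true`) matrix units of the queer Lie superalgebra, acting
on `V`-valued functions of colourings. -/
def recolor (a : Bool) (i j : ℕ) : Module.End ℂ ((Fin d → ℕ) → V) where
  toFun F c := ∑ x, if c x = i then xiPow ρ a x (F (Function.update c x j)) else 0
  map_add' F F' := by
    ext c
    simp only [Pi.add_apply, map_add, ← Finset.sum_add_distrib]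
    exact Finset.sum_congr rfl fun x _ => by split_ifs <;> simp
  map_smul' r F := by
    ext c
    simp only [Pi.smul_apply, map_smul, Finset.smul_sum, RingHom.id_apply]
    exact Finset.sum_congr rfl fun x _ => by split_ifs <;> simp

theorem recolor_apply (a : Bool) (i j : ℕ) (F : (Fin d → ℕ) → V) (c : Fin d → ℕ) :
    recolor ρ a i j F c = ∑ x, if c x = i then xiPow ρ a x (F (Function.update c x j)) else 0 :=
  rfl

theorem xiPow_self (a b : Bool) (x : Fin d) (v : V) :
    xiPow ρ a x (xiPow ρ b x v) = xiPow ρ (xor a b) x v := by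
  have h : ρ (xi x) (ρ (xi x) v) = v := by
    rw [← Module.End.mul_apply, ← map_mul, xi_mul_self]; simp
  cases a <;> cases b <;> simp [xiPow, h]

/-- The sign of exchanging two homogeneous operators. -/
def koszul (a b : Bool) : ℂ := bif (a && b) then -1 else 1

variable {ρ} (hε : ρ (eps d) = -1)
include hε

theorem xiPow_comm (a b : Bool) {x y : Fin d} (h : x ≠ y) (v : V) :
    xiPow ρ a x (xiPow ρ b y v) = koszul a b • xiPow ρ b y (xiPow ρ a x v) := by
  have h : ρ (xi x) (ρ (xi y) v) = - ρ (xi y) (ρ (xi x) v) := by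
    rw [← Module.End.mul_apply, ← map_mul, xi_mul_xi h, map_mul, map_mul, hε]; simp
  cases a <;> cases b <;> simp [xiPow, koszul, h]

-- Split the double sum by whether both operators move the same point. If they do, that point has
-- colour j when the second one reaches it, so j = k is forced and the two factors ξ_x combine.
omit hε in
theorem recolor_recolor (a b : Bool) (i j k l : ℕ) (F : (Fin d → ℕ) → V) (c : Fin d → ℕ) :
    recolor ρ a i j (recolor ρ b k l F) c =
      (∑ x, ∑ y, if x ≠ y ∧ c x = i ∧ c y = k then
        xiPow ρ a x (xiPow ρ b y (F (Function.update (Function.update c x j) y l))) else 0) +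
      if j = k then recolor ρ (xor a b) i l F c else 0 := by
  have h2 : (if j = k then recolor ρ (xor a b) i l F c else 0) = ∑ x, if c x = i ∧ j = k then
      xiPow ρ (xor a b) x (F (Function.update c x l)) else 0 := by
    rw [recolor_apply]; split_ifs with h <;> simp [h]
  rw [h2, ← Finset.sum_add_distrib, recolor_apply]
  refine Finset.sum_congr rfl fun x _ => ?_
  rw [recolor_apply]
  by_cases hx : c x = i
  · rw [if_pos hx, map_sum, ← Finset.sum_erase_add _ _ (Finset.mem_univ x)]
    congr 1
    · rw [← Finset.sum_erase_add _ _ (Finset.mem_univ x)]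
      simp only [ne_eq, not_true_eq_false, false_and, if_false, add_zero]
      refine Finset.sum_congr rfl fun y hy => ?_
      have hyx : y ≠ x := Finset.ne_of_mem_erase hy
      rw [Function.update_of_ne hyx]
      by_cases hk : c y = k
      · simp [hk, hx, hyx.symm]
      · simp [hk]
    · simp only [Function.update_self, hx, true_and, Function.update_idem]
      split_ifs with h
      · rw [xiPow_self]
      · simp
  · simp [hx]

/-- These are the relations of q. Terms that move two distinct points supercommute because ξ_x and
ξ_y anticommute, so only the terms moving one point twice survive. -/
theorem recolor_comm (a b : Bool) (i j k l : ℕ) (F : (Fin d → ℕ) → V) :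
    recolor ρ a i j (recolor ρ b k l F) =
      koszul a b • recolor ρ b k l (recolor ρ a i j F) +
      ((if j = k then recolor ρ (xor a b) i l F else 0) -
        koszul a b • if l = i then recolor ρ (xor a b) k j F else 0) := by
  ext c
  have hoff : (∑ x, ∑ y, if x ≠ y ∧ c x = i ∧ c y = k then
        xiPow ρ a x (xiPow ρ b y (F (Function.update (Function.update c x j) y l))) else 0) =
      koszul a b • (∑ y, ∑ x, if y ≠ x ∧ c y = k ∧ c x = i then
        xiPow ρ b y (xiPow ρ a x (F (Function.update (Function.update c y l) x j))) else 0) := by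
    rw [Finset.sum_comm, Finset.smul_sum]
    refine Finset.sum_congr rfl fun y _ => ?_
    rw [Finset.smul_sum]
    refine Finset.sum_congr rfl fun x _ => ?_
    by_cases h : x ≠ y ∧ c x = i ∧ c y = k
    · rw [if_pos h, if_pos ⟨h.1.symm, h.2.2, h.2.1⟩, xiPow_comm hε a b h.1,
        Function.update_comm h.1]
    · rw [if_neg h, if_neg (fun h' => h ⟨h'.1.symm, h'.2.2, h'.2.1⟩), smul_zero]
  have hite : ∀ (p : Prop) [Decidable p] (F : (Fin d → ℕ) → V),
      (if p then F else 0) c = if p then F c else 0 := by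
    intro p _ F; split_ifs <;> rfl
  rw [Pi.add_apply, Pi.sub_apply, Pi.smul_apply, Pi.smul_apply, recolor_recolor, recolor_recolor,
    hoff, hite, hite, Bool.xor_comm b a, smul_add]
  abel

end Recolor

/-! ### Weight spaces and the odd Cartan operators -/

section BlockOperators

variable {d : ℕ} {V : Type*} [AddCommGroup V] [Module ℂ V]
  (ρ : Representation ℂ (SergeevGroup d) V)

/-- The vectors fixed by the Young subgroup that stabilizes the colouring `c`. -/
def youngFixed (c : Fin d → ℕ) : Submodule ℂ V where
  carrier := {v | ∀ σ : Equiv.Perm (Fin d), c ∘ σ = c → ρ (perm σ) v = v}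
  add_mem' hv hw σ hσ := by rw [map_add, hv σ hσ, hw σ hσ]
  zero_mem' σ _ := map_zero _
  smul_mem' r v hv σ hσ := by rw [map_smul, hv σ hσ]

/-- The sum of the `ξ_x` over the points `x` of colour `i`. -/
def blockXi (c : Fin d → ℕ) (i : ℕ) : Module.End ℂ V :=
  ∑ x ∈ Finset.univ.filter fun x => c x = i, ρ (xi x)

theorem blockXi_apply (c : Fin d → ℕ) (i : ℕ) (v : V) :
    blockXi ρ c i v = ∑ x ∈ Finset.univ.filter fun x => c x = i, ρ (xi x) v := by
  simp [blockXi]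

theorem blockXi_perm (c : Fin d → ℕ) (i : ℕ) {σ : Equiv.Perm (Fin d)} (hσ : c ∘ σ = c) (v : V) :
    ρ (perm σ) (blockXi ρ c i v) = blockXi ρ c i (ρ (perm σ) v) := by
  rw [blockXi_apply, blockXi_apply, map_sum]
  refine Finset.sum_equiv σ (fun x => ?_) (fun x _ => ?_)
  · simp [show c (σ x) = c x from congrFun hσ x]
  · rw [← Module.End.mul_apply, ← map_mul, perm_mul_xi, map_mul, Module.End.mul_apply]

theorem blockXi_mem_youngFixed (c : Fin d → ℕ) (i : ℕ) {v : V} (hv : v ∈ youngFixed ρ c) :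
    blockXi ρ c i v ∈ youngFixed ρ c := by
  intro σ hσ
  rw [blockXi_perm ρ c i hσ, hv σ hσ]

theorem perm_mem_youngFixed (c : Fin d → ℕ) (σ : Equiv.Perm (Fin d)) {v : V}
    (hv : v ∈ youngFixed ρ (c ∘ σ)) : ρ (perm σ) v ∈ youngFixed ρ c := by
  intro τ hτ
  have h := hv (σ⁻¹ * τ * σ) (by
    funext x
    simpa using congrFun hτ (σ x))
  conv_rhs => rw [← h]
  rw [← Module.End.mul_apply, ← Module.End.mul_apply, ← map_mul, ← map_mul, ← perm_mul, ← perm_mul]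
  congr 3
  group

variable {ρ} (hε : ρ (eps d) = -1)
include hε

theorem xi_xi_apply {x y : Fin d} (h : x ≠ y) (v : V) :
    ρ (xi x) (ρ (xi y) v) = - ρ (xi y) (ρ (xi x) v) := by
  rw [← Module.End.mul_apply, ← map_mul, xi_mul_xi h, map_mul, map_mul, hε]; simp

theorem blockXi_anticomm (c : Fin d → ℕ) {i j : ℕ} (h : i ≠ j) (v : V) :
    blockXi ρ c i (blockXi ρ c j v) = - blockXi ρ c j (blockXi ρ c i v) := by
  simp only [blockXi_apply, map_sum, ← Finset.sum_neg_distrib]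
  rw [Finset.sum_comm]
  refine Finset.sum_congr rfl fun x hx => Finset.sum_congr rfl fun y hy => ?_
  refine xi_xi_apply hε ?_ v
  rintro rfl
  exact h ((Finset.mem_filter.mp hx).2.symm.trans (Finset.mem_filter.mp hy).2)

/-- The cross terms cancel in pairs by anticommutation, and each point of colour i contributes ξ_x²
= 1. -/
theorem blockXi_sq (c : Fin d → ℕ) (i : ℕ) (v : V) :
    blockXi ρ c i (blockXi ρ c i v) =
      ((Finset.univ.filter fun x => c x = i).card : ℂ) • v := by
  simp only [blockXi_apply, map_sum]
  set B := Finset.univ.filter fun x => c x = i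
  have hsq : ∀ x, ρ (xi x) (ρ (xi x) v) = v := by
    intro x
    rw [← Module.End.mul_apply, ← map_mul, xi_mul_self]; simp
  have h1 : ∑ x ∈ B, ∑ y ∈ B, ρ (xi x) (ρ (xi y) v) = ∑ x ∈ B, ∑ y ∈ B,
      ((if x = y then v + v else 0) - ρ (xi x) (ρ (xi y) v)) := by
    conv_lhs => rw [Finset.sum_comm]
    refine Finset.sum_congr rfl fun x _ => Finset.sum_congr rfl fun y _ => ?_
    split_ifs with h
    · subst h; rw [hsq]; abel
    · rw [xi_xi_apply hε (Ne.symm h)]; abel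
  have h2 : ∑ x ∈ B, ∑ y ∈ B, (if x = y then v + v else 0) = (2 : ℂ) • (B.card : ℂ) • v := by
    have : ∀ x ∈ B, ∑ y ∈ B, (if x = y then v + v else 0) = (2 : ℂ) • v := by
      intro x hx
      rw [Finset.sum_ite_eq, if_pos hx, two_smul]
    rw [Finset.sum_congr rfl this, Finset.sum_const, ← Nat.cast_smul_eq_nsmul ℂ, smul_comm]
  simp only [Finset.sum_sub_distrib] at h1
  rw [h2] at h1
  have h3 : (2 : ℂ) • ∑ x ∈ B, ∑ y ∈ B, ρ (xi x) (ρ (xi y) v) = (2 : ℂ) • (B.card : ℂ) • v := by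
    rw [two_smul]
    nth_rewrite 1 [h1]
    abel
  rw [Finset.sum_comm]
  exact smul_right_injective V (two_ne_zero (α := ℂ)) h3

end BlockOperators

/-! ### Lowering from a highest weight space -/

section HighestWeight

variable {d : ℕ} {V : Type*} [AddCommGroup V] [Module ℂ V]
  {ρ : Representation ℂ (SergeevGroup d) V}

/-- Equivariance of a `V`-valued function of colourings. -/
def IsEquivariantColor (ρ : Representation ℂ (SergeevGroup d) V) (F : (Fin d → ℕ) → V) : Prop :=
  ∀ (σ : Equiv.Perm (Fin d)) (c : Fin d → ℕ), ρ (perm σ) (F (c ∘ σ)) = F c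

theorem IsEquivariantColor.mem_youngFixed {F : (Fin d → ℕ) → V} (hF : IsEquivariantColor ρ F)
    (c : Fin d → ℕ) : F c ∈ youngFixed ρ c := by
  intro σ hσ
  have h := hF σ c
  rwa [hσ] at h

theorem perm_xiPow (σ : Equiv.Perm (Fin d)) (a : Bool) (x : Fin d) (v : V) :
    ρ (perm σ) (xiPow ρ a x v) = xiPow ρ a (σ x) (ρ (perm σ) v) := by
  cases a
  · simp [xiPow]
  · simp only [xiPow, cond_true]
    rw [← Module.End.mul_apply, ← map_mul, perm_mul_xi, map_mul, Module.End.mul_apply]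

theorem IsEquivariantColor.recolor {F : (Fin d → ℕ) → V} (hF : IsEquivariantColor ρ F)
    (a : Bool) (i j : ℕ) : IsEquivariantColor ρ (recolor ρ a i j F) := by
  intro σ c
  rw [recolor_apply, recolor_apply, map_sum]
  refine Fintype.sum_equiv σ _ _ fun x => ?_
  have hu : Function.update (c ∘ σ) x j = Function.update c (σ x) j ∘ σ := by
    funext y
    by_cases h : y = x
    · subst h; simp
    · simp [Function.update_of_ne h, Function.update_of_ne (σ.injective.ne h)]
  rw [Function.comp_apply, hu]
  split_ifs
  · rw [perm_xiPow, hF]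
  · simp

/-- Equivariant functions supported on the recolourings of `c` by permutations, with value at `c`
in `K`. -/
structure IsSupportedAt (ρ : Representation ℂ (SergeevGroup d) V) (c : Fin d → ℕ)
    (K : Submodule ℂ V) (F : (Fin d → ℕ) → V) : Prop where
  equivariant : IsEquivariantColor ρ F
  support : ∀ c', F c' ≠ 0 → ∃ σ : Equiv.Perm (Fin d), c' = c ∘ σ
  mem : F c ∈ K

/-- This is Frobenius reciprocity: an equivariant function on the S(d)-orbit of c is determined by
its value at c, which may be any vector fixed by the stabilizer. -/
theorem exists_isSupportedAt (c : Fin d → ℕ) {K : Submodule ℂ V} (hK : K ≤ youngFixed ρ c)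
    {v : V} (hv : v ∈ K) : ∃ F, IsSupportedAt ρ c K F ∧ F c = v := by
  classical
  let F : (Fin d → ℕ) → V := fun c' =>
    if h : ∃ σ : Equiv.Perm (Fin d), c' = c ∘ σ then ρ (perm h.choose⁻¹) v else 0
  -- The value is independent of the chosen permutation, since two choices differ by an element of
  -- the Young subgroup, and that fixes v.
  have hF : ∀ τ : Equiv.Perm (Fin d), F (c ∘ τ) = ρ (perm τ⁻¹) v := by
    intro τ
    have h : ∃ σ : Equiv.Perm (Fin d), c ∘ τ = c ∘ σ := ⟨τ, rfl⟩
    have hs := h.choose_spec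
    simp only [F]
    rw [dif_pos h]
    set σ := h.choose
    have hfix := hK hv (τ * σ⁻¹) (by
      funext x
      have := congrFun hs (σ⁻¹ x)
      simpa using this)
    conv_rhs => rw [← hfix]
    rw [← Module.End.mul_apply, ← map_mul, ← perm_mul]
    congr 3
    group
  have h1 : F c = v := by
    have := hF 1
    simpa [perm_one] using this
  refine ⟨F, ⟨?_, ?_, ?_⟩, h1⟩
  · intro σ c'
    by_cases h : ∃ τ : Equiv.Perm (Fin d), c' = c ∘ τ
    · obtain ⟨τ, rfl⟩ := h
      have : (c ∘ τ) ∘ σ = c ∘ (τ * σ : Equiv.Perm (Fin d)) := rfl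
      rw [this, hF, hF, ← Module.End.mul_apply, ← map_mul, ← perm_mul]
      congr 3
      group
    · have h' : ¬ ∃ τ : Equiv.Perm (Fin d), c' ∘ σ = c ∘ τ := by
        rintro ⟨τ, hτ⟩
        refine h ⟨τ * σ⁻¹, ?_⟩
        funext x
        have := congrFun hτ (σ⁻¹ x)
        simpa using this
      simp only [F]
      rw [dif_neg h, dif_neg h', map_zero]
  · intro c' hc'
    by_contra h
    exact hc' (dif_neg h)
  · rw [h1]; exact hv

/-- No nonzero vector has a weight obtained from that of `c` by raising. -/
def IsHighestColor (ρ : Representation ℂ (SergeevGroup d) V) (c : Fin d → ℕ) : Prop :=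
  ∀ (σ : Equiv.Perm (Fin d)) (x : Fin d) (i : ℕ), i < c (σ x) →
    youngFixed ρ (Function.update (c ∘ σ) x i) = ⊥

/-- The functions obtained by lowering from those supported at `c` with value in `K`. -/
inductive Lowered (ρ : Representation ℂ (SergeevGroup d) V) (c : Fin d → ℕ)
    (K : Submodule ℂ V) : ((Fin d → ℕ) → V) → Prop
  | base (F : (Fin d → ℕ) → V) : IsSupportedAt ρ c K F → Lowered ρ c K F
  | add (F F' : (Fin d → ℕ) → V) : Lowered ρ c K F → Lowered ρ c K F' → Lowered ρ c K (F + F')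
  | smul (r : ℂ) (F : (Fin d → ℕ) → V) : Lowered ρ c K F → Lowered ρ c K (r • F)
  | lower (a : Bool) (i j : ℕ) (F : (Fin d → ℕ) → V) : j < i → Lowered ρ c K F →
      Lowered ρ c K (recolor ρ a i j F)

theorem IsSupportedAt.zero (c : Fin d → ℕ) (K : Submodule ℂ V) : IsSupportedAt ρ c K 0 :=
  ⟨fun _ _ => map_zero _, fun _ h => absurd rfl h, K.zero_mem⟩

variable {c : Fin d → ℕ} {K : Submodule ℂ V}

theorem Lowered.zero : Lowered ρ c K 0 := .base _ (.zero c K)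

theorem Lowered.sub {F F' : (Fin d → ℕ) → V} (h : Lowered ρ c K F) (h' : Lowered ρ c K F') :
    Lowered ρ c K (F - F') := by
  have := h.add _ _ (h'.smul (-1))
  rwa [neg_one_smul, ← sub_eq_add_neg] at this

theorem Lowered.equivariant {F : (Fin d → ℕ) → V} (h : Lowered ρ c K F) :
    IsEquivariantColor ρ F := by
  induction h with
  | base F hF => exact hF.equivariant
  | add F F' _ _ h h' => intro σ c; simp [h σ c, h' σ c]
  | smul r F _ h => intro σ c; simp [h σ c]
  | lower a i j F _ _ h => exact h.recolor a i j

/-- The sum of the colours serves as a height. Lowering strictly raises it, so a lowered function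
vanishes at every colouring of height at most that of c, and only the unlowered part is seen at c.
-/
theorem Lowered.values {F : (Fin d → ℕ) → V} (h : Lowered ρ c K F) :
    (∀ c', ∑ x, c' x < ∑ x, c x → F c' = 0) ∧ F c ∈ K := by
  induction h with
  | base F hF =>
    refine ⟨fun c' hc' => ?_, hF.mem⟩
    by_contra h
    obtain ⟨σ, rfl⟩ := hF.support c' h
    exact hc'.ne (Equiv.sum_comp σ c)
  | add F F' _ _ h h' =>
    exact ⟨fun c' hc' => by simp [h.1 c' hc', h'.1 c' hc'], K.add_mem h.2 h'.2⟩
  | smul r F _ h => exact ⟨fun c' hc' => by simp [h.1 c' hc'], K.smul_mem r h.2⟩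
  | lower a i j F hij _ h =>
    have key : ∀ c' : Fin d → ℕ, ∑ x, c' x ≤ ∑ x, c x → recolor ρ a i j F c' = 0 := by
      intro c' hc'
      rw [recolor_apply]
      refine Finset.sum_eq_zero fun x _ => ?_
      split_ifs with hx
      · rw [h.1, map_zero]
        refine lt_of_lt_of_le ?_ hc'
        refine Finset.sum_lt_sum (fun y _ => ?_) ⟨x, Finset.mem_univ x, ?_⟩
        · by_cases hy : y = x
          · subst hy; rw [Function.update_self]; omega
          · rw [Function.update_of_ne hy]
        · rw [Function.update_self]; omega
      · rfl
    exact ⟨fun c' hc' => key c' hc'.le, by rw [key c le_rfl]; exact K.zero_mem⟩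

theorem recolor_diag (a : Bool) (i : ℕ) (F : (Fin d → ℕ) → V) (c : Fin d → ℕ) :
    recolor ρ a i i F c = bif a then blockXi ρ c i (F c)
      else ((Finset.univ.filter fun x => c x = i).card : ℂ) • F c := by
  have : recolor ρ a i i F c =
      ∑ x ∈ Finset.univ.filter (fun x => c x = i), xiPow ρ a x (F c) := by
    rw [recolor_apply, Finset.sum_filter]
    refine Finset.sum_congr rfl fun x _ => ?_
    split_ifs with h
    · rw [← h, Function.update_eq_self]
    · rfl
  rw [this]
  cases a
  · simp [xiPow, Nat.cast_smul_eq_nsmul]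
  · simp [xiPow, blockXi_apply]

/-- A nonzero term at c' would mean that c' arises by raising one point of a colouring in the orbit
of c. The value at c' is fixed by the Young subgroup of c', and `hc` says that no nonzero vector is.
-/
theorem IsSupportedAt.recolor_raise (hc : IsHighestColor ρ c) {F : (Fin d → ℕ) → V}
    (hF : IsSupportedAt ρ c K F) (a : Bool) {i j : ℕ} (hij : i < j) :
    recolor ρ a i j F = 0 := by
  funext c'
  rw [Pi.zero_apply]
  by_cases h : ∃ x, c' x = i ∧ F (Function.update c' x j) ≠ 0
  · obtain ⟨x, hx, hne⟩ := h
    obtain ⟨σ, hσ⟩ := hF.support _ hne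
    have hxj : c (σ x) = j := by
      have := congrFun hσ x
      simpa using this.symm
    have hc' : c' = Function.update (c ∘ σ) x i := by
      rw [← hσ, Function.update_idem, ← hx, Function.update_eq_self]
    have hm := (hF.equivariant.recolor a i j).mem_youngFixed c'
    rw [hc', hc σ x i (by omega), ← hc'] at hm
    simpa using hm
  · push Not at h
    rw [recolor_apply]
    refine Finset.sum_eq_zero fun x _ => ?_
    split_ifs with hx
    · rw [h x hx, map_zero]
    · rfl

theorem IsSupportedAt.recolor_diag {F : (Fin d → ℕ) → V}
    (hKp : ∀ i, ∀ v ∈ K, blockXi ρ c i v ∈ K)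
    (hF : IsSupportedAt ρ c K F) (a : Bool) (i : ℕ) :
    IsSupportedAt ρ c K (recolor ρ a i i F) := by
  refine ⟨hF.equivariant.recolor a i i, fun c' hc' => hF.support c' fun h => hc' ?_, ?_⟩
  · rw [_root_.recolor_diag, h]; cases a <;> simp
  · rw [_root_.recolor_diag]
    cases a
    · exact K.smul_mem _ hF.mem
    · exact hKp i _ hF.mem

/-- An inductive substitute for the Poincaré–Birkhoff–Witt theorem. An arbitrary operator is
commuted past the lowering ones until it meets a base function, where raising gives zero and
diagonal units stay in K. Thus the lowered functions form a q-submodule. -/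
theorem Lowered.recolor (hε : ρ (eps d) = -1) (hc : IsHighestColor ρ c)
    (hKp : ∀ i, ∀ v ∈ K, blockXi ρ c i v ∈ K) {F : (Fin d → ℕ) → V} (h : Lowered ρ c K F) :
    ∀ (a : Bool) (i j : ℕ), Lowered ρ c K (recolor ρ a i j F) := by
  induction h with
  | base F hF =>
    intro a i j
    rcases lt_trichotomy i j with hij | rfl | hij
    · rw [hF.recolor_raise hc a hij]; exact .zero
    · exact .base _ (hF.recolor_diag hKp a i)
    · exact .lower a i j F hij (.base F hF)
  | add F F' _ _ h h' => intro a i j; rw [map_add]; exact .add _ _ (h a i j) (h' a i j)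
  | smul r F _ h => intro a i j; rw [map_smul]; exact .smul r _ (h a i j)
  | lower b k l F hkl _ h =>
    intro a i j
    rw [recolor_comm hε]
    have hite : ∀ (p : Prop) [Decidable p] (F : (Fin d → ℕ) → V), Lowered ρ c K F →
        Lowered ρ c K (if p then F else 0) := by
      intro p _ F hF; split_ifs
      · exact hF
      · exact .zero
    exact .add _ _ (.smul _ _ (.lower b k l _ hkl (h a i j)))
      (.sub (hite _ _ (h _ _ _)) (.smul _ _ (hite _ _ (h _ _ _))))

end HighestWeight

/-! ### From q-submodules back to subrepresentations -/

section Values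

variable {d : ℕ} {V : Type*} [AddCommGroup V] [Module ℂ V]
  {ρ : Representation ℂ (SergeevGroup d) V} {c : Fin d → ℕ} {K : Submodule ℂ V}

/-- Values of lowered functions at the colouring `e`. -/
def loweredValues (ρ : Representation ℂ (SergeevGroup d) V) (c : Fin d → ℕ)
    (K : Submodule ℂ V) (e : Fin d → ℕ) : Submodule ℂ V where
  carrier := {v | ∃ F, Lowered ρ c K F ∧ F e = v}
  add_mem' := by
    rintro _ _ ⟨F, hF, rfl⟩ ⟨F', hF', rfl⟩
    exact ⟨F + F', hF.add _ _ hF', rfl⟩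
  zero_mem' := ⟨0, .zero, rfl⟩
  smul_mem' := by
    rintro r _ ⟨F, hF, rfl⟩
    exact ⟨r • F, hF.smul r _, rfl⟩

theorem loweredValues_self_le : loweredValues ρ c K c ≤ K := by
  rintro _ ⟨F, hF, rfl⟩
  exact hF.values.2

theorem le_loweredValues_self (hK : K ≤ youngFixed ρ c) : K ≤ loweredValues ρ c K c := by
  intro v hv
  obtain ⟨F, hF, rfl⟩ := exists_isSupportedAt c hK hv
  exact ⟨F, .base F hF, rfl⟩

variable (hε : ρ (eps d) = -1) (hc : IsHighestColor ρ c)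
  (hKp : ∀ i, ∀ v ∈ K, blockXi ρ c i v ∈ K)
include hε hc hKp

/-- As b is unused, the even matrix unit from colour e y to b, evaluated at the new colouring, has a
single term, and this term is the old value. -/
theorem loweredValues_split (e : Fin d → ℕ) (y : Fin d) (b : ℕ) (hb : ∀ x, e x ≠ b) :
    loweredValues ρ c K e ≤ loweredValues ρ c K (Function.update e y b) := by
  rintro _ ⟨F, hF, rfl⟩
  refine ⟨recolor ρ false b (e y) F, hF.recolor hε hc hKp _ _ _, ?_⟩
  rw [recolor_apply, Finset.sum_eq_single y]
  · simp [xiPow]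
  · intro x _ hx
    rw [Function.update_of_ne hx, if_neg (hb x)]
  · simp

/-- The even matrix unit that recolours y with a gives, at the merged colouring, one term for each
point of colour a. These terms are values of F at transpositions of e, and all equal F e because F e
is fixed by the Young subgroup of the merged colouring. Their number is nonzero and can be divided
out. -/
theorem loweredValues_merge (e : Fin d → ℕ) (y : Fin d) (a : ℕ) (hy : ∀ x, x ≠ y → e x ≠ e y)
    (ha : a ≠ e y) {v : V} (hv : v ∈ loweredValues ρ c K e)
    (hfix : v ∈ youngFixed ρ (Function.update e y a)) :
    v ∈ loweredValues ρ c K (Function.update e y a) := by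
  obtain ⟨F, hF, rfl⟩ := hv
  set e' := Function.update e y a
  have key : recolor ρ false a (e y) F e' =
      ((Finset.univ.filter fun x => e' x = a).card : ℂ) • F e := by
    rw [recolor_apply, ← Finset.sum_filter, Nat.cast_smul_eq_nsmul, ← Finset.sum_const]
    refine Finset.sum_congr rfl fun x hx => ?_
    have hxa : e' x = a := (Finset.mem_filter.mp hx).2
    have hy' : e' y = a := Function.update_self ..
    have hswap : Function.update e' x (e y) = e ∘ Equiv.swap x y := by
      funext z
      rw [Function.comp_apply]
      by_cases hzx : z = x
      · subst hzx; simp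
      · rw [Function.update_of_ne hzx]
        by_cases hzy : z = y
        · subst hzy
          rw [hy', Equiv.swap_apply_right, ← hxa]
          exact Function.update_of_ne (Ne.symm hzx) ..
        · rw [Equiv.swap_apply_of_ne_of_ne hzx hzy]
          exact Function.update_of_ne hzy ..
    have hst : e' ∘ Equiv.swap x y = e' := by
      funext z
      rw [Function.comp_apply]
      by_cases hzx : z = x
      · subst hzx; rw [Equiv.swap_apply_left, hy', hxa]
      · by_cases hzy : z = y
        · subst hzy; rw [Equiv.swap_apply_right, hy', hxa]
        · rw [Equiv.swap_apply_of_ne_of_ne hzx hzy]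
    have h1 := hF.equivariant (Equiv.swap x y) e
    have h2 := hfix _ hst
    have hinj : Function.Injective (ρ (perm (Equiv.swap x y))) := ρ.apply_bijective _ |>.1
    have h3 := hinj (h1.trans h2.symm)
    rw [hswap, h3]
    rfl
  have hne : ((Finset.univ.filter fun x => e' x = a).card : ℂ) ≠ 0 := by
    rw [Nat.cast_ne_zero, ← Nat.pos_iff_ne_zero, Finset.card_pos]
    exact ⟨y, by simp [e']⟩
  refine ⟨_, (hF.recolor hε hc hKp false a (e y)).smul
    ((Finset.univ.filter fun x => e' x = a).card : ℂ)⁻¹ _, ?_⟩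
  rw [Pi.smul_apply, key, inv_smul_smul₀ hne]

/-- At an injective colouring the group is visible inside q: ξ_x acts as the odd diagonal unit of
colour e x, and the transposition of x and y as E_{e x, e y} E_{e y, e x} - 1. -/
theorem loweredValues_stable {e : Fin d → ℕ} (he : Function.Injective e)
    (g : SergeevGroup d) : ∀ v ∈ loweredValues ρ c K e, ρ g v ∈ loweredValues ρ c K e := by
  refine stable_of_gens ρ hε _ ?_ ?_ g
  · rintro x _ ⟨F, hF, rfl⟩
    refine ⟨_, hF.recolor hε hc hKp true (e x) (e x), ?_⟩
    rw [_root_.recolor_diag, cond_true, blockXi_apply, Finset.sum_eq_single x]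
    · intro y hy hne
      exact absurd (he (Finset.mem_filter.mp hy).2) hne
    · simp
  · intro σ
    induction σ using Equiv.Perm.swap_induction_on with
    | one => intro v hv; simpa [perm_one] using hv
    | swap_mul σ x y hxy ih =>
      intro v hv
      rw [perm_mul, map_mul, Module.End.mul_apply]
      obtain ⟨F, hF, h⟩ := ih v hv
      rw [← h]
      have h1 : ρ (perm (Equiv.swap x y)) (F e) = F (e ∘ Equiv.swap x y) := by
        have := hF.equivariant (Equiv.swap x y) (e ∘ Equiv.swap x y)
        have h2 : (e ∘ Equiv.swap x y) ∘ Equiv.swap x y = e := by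
          funext z; simp
        rwa [h2] at this
      refine ⟨_, (((hF.recolor hε hc hKp false (e y) (e x)).recolor hε hc hKp
        false (e x) (e y))).sub hF, ?_⟩
      have hexy : e x ≠ e y := he.ne hxy
      rw [h1, Pi.sub_apply, recolor_apply, Finset.sum_eq_single x, if_pos rfl, recolor_apply,
        Fintype.sum_eq_add x y hxy, Function.update_self, if_pos rfl, Function.update_of_ne hxy.symm,
        if_pos rfl]
      · have h2 : Function.update (Function.update e x (e y)) y (e x) = e ∘ Equiv.swap x y := by
          funext z
          rw [Function.comp_apply]
          by_cases hzy : z = y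
          · subst hzy; simp
          · rw [Function.update_of_ne hzy]
            by_cases hzx : z = x
            · subst hzx; simp
            · rw [Function.update_of_ne hzx, Equiv.swap_apply_of_ne_of_ne hzx hzy]
        rw [h2]
        simp [xiPow]
      · rintro z ⟨hzx, hzy⟩
        rw [Function.update_of_ne hzx, if_neg (he.ne hzy)]
      · intro z _ hzx
        rw [if_neg (he.ne hzx)]
      · simp

/-- A subspace of the highest weight space stable under the block operators generates a
subrepresentation with no other vectors of that weight. -/
theorem exists_stable_inf_youngFixed_le (hK : K ≤ youngFixed ρ c) :
    ∃ M : Submodule ℂ V, (∀ g, ∀ v ∈ M, ρ g v ∈ M) ∧ K ≤ M ∧ M ⊓ youngFixed ρ c ≤ K := by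
  classical
  obtain ⟨N, hN⟩ : ∃ N, ∀ x, c x < N :=
    ⟨(∑ x, c x) + 1, fun x => Nat.lt_succ_of_le
      (Finset.single_le_sum (f := c) (fun _ _ => Nat.zero_le _) (Finset.mem_univ x))⟩
  -- Distinct colours beyond all those of c. Recolouring point by point, splits lead from c to
  -- `fresh`, and merges lead back for vectors fixed by the Young subgroup of c.
  let fresh : Fin d → ℕ := fun x => N + x
  have hfresh : Function.Injective fresh := fun x y h => Fin.ext (by simpa [fresh] using h)
  have hcf : ∀ x y, c x ≠ fresh y := fun x y => by have := hN x; simp only [fresh]; omega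
  refine ⟨loweredValues ρ c K fresh, loweredValues_stable hε hc hKp hfresh, ?_, ?_⟩
  · have key : ∀ S : Finset (Fin d), K ≤ loweredValues ρ c K (fun x => if x ∈ S then fresh x
        else c x) := by
      intro S
      induction S using Finset.induction with
      | empty => simpa using le_loweredValues_self hK
      | insert y S hy ih =>
        refine ih.trans ?_
        have := loweredValues_split hε hc hKp (fun x => if x ∈ S then fresh x else c x) y (fresh y)
          (fun x => by
            split_ifs with hx
            · exact hfresh.ne (fun h => hy (h ▸ hx))
            · exact hcf x y)
        convert this using 2
        funext x
        by_cases hx : x = y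
        · subst hx; simp
        · simp [hx]
    simpa using key Finset.univ
  · rintro v ⟨hv, hfix⟩
    refine loweredValues_self_le (ρ := ρ) (c := c) ?_
    have key : ∀ S : Finset (Fin d), v ∈ loweredValues ρ c K (fun x => if x ∈ S then c x
        else fresh x) := by
      intro S
      induction S using Finset.induction with
      | empty => simpa using hv
      | insert y S hy ih =>
        have hu : (fun x => if x ∈ insert y S then c x else fresh x) =
            Function.update (fun x => if x ∈ S then c x else fresh x) y (c y) := by
          funext x
          by_cases hx : x = y
          · subst hx; simp
          · simp [hx]
        rw [hu]
        refine loweredValues_merge hε hc hKp _ y (c y) ?_ ?_ ih ?_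
        · intro x hx
          simp only [hy, if_false]
          split_ifs
          · exact hcf x y
          · exact hfresh.ne hx
        · simpa [hy] using hcf y y
        -- The stabilizer of a partly merged colouring lies in the stabilizer of c, so v is fixed at
        -- every stage.
        · rw [← hu]
          intro σ hσ
          refine hfix σ ?_
          funext x
          have h := congrFun hσ x
          simp only [Function.comp_apply] at h ⊢
          by_cases h1 : x ∈ insert y S <;> by_cases h2 : σ x ∈ insert y S
          · rwa [if_pos h1, if_pos h2] at h
          · rw [if_pos h1, if_neg h2] at h; exact absurd h.symm (hcf _ _)
          · rw [if_neg h1, if_pos h2] at h; exact absurd h (hcf _ _)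
          · rw [if_neg h1, if_neg h2] at h; rw [hfresh h]
    simpa using key Finset.univ

end Values

/-! ### Why highest weights are strict -/

section Strictness

variable {d : ℕ} {V : Type*} [AddCommGroup V] [Module ℂ V]
  {ρ : Representation ℂ (SergeevGroup d) V} {c : Fin d → ℕ}

/-- If neither raising nor moving a point from colour `i` to colour `j > i` leads to a weight of
`ρ`, then the weight of `c` does not occur, unless both colours are unused. -/
theorem youngFixed_eq_bot_of_simple_root (hε : ρ (eps d) = -1) (hc : IsHighestColor ρ c) {i j : ℕ}
    (hij : i < j) (hi : ∃ x, c x = i)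
    (hlow : ∀ (σ : Equiv.Perm (Fin d)) (x : Fin d), c (σ x) = i →
      youngFixed ρ (Function.update (c ∘ σ) x j) = ⊥) : youngFixed ρ c = ⊥ := by
  rw [eq_bot_iff]
  intro v hv
  obtain ⟨F, hF, rfl⟩ := exists_isSupportedAt c le_rfl hv
  have h1 : recolor ρ false j i F = 0 := by
    funext c'
    rw [Pi.zero_apply]
    by_cases h : ∃ x, c' x = j ∧ F (Function.update c' x i) ≠ 0
    · obtain ⟨x, hx, hne⟩ := h
      obtain ⟨σ, hσ⟩ := hF.support _ hne
      have hxi : c (σ x) = i := by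
        have := congrFun hσ x
        simpa using this.symm
      have hc' : c' = Function.update (c ∘ σ) x j := by
        rw [← hσ, Function.update_idem, ← hx, Function.update_eq_self]
      have hm := (hF.equivariant.recolor false j i).mem_youngFixed c'
      rw [hc', hlow σ x hxi, ← hc'] at hm
      simpa using hm
    · push Not at h
      rw [recolor_apply]
      refine Finset.sum_eq_zero fun x _ => ?_
      split_ifs with hx
      · rw [h x hx, map_zero]
      · rfl
  -- The supercommutator of the odd raising and the even lowering operator is the difference of two
  -- odd diagonal units. Both operators kill F, so the two block operators agree on F c.
  have h2 := congrFun (recolor_comm hε true false i j j i F) c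
  rw [h1, hF.recolor_raise hc true hij] at h2
  simp only [map_zero, if_true, Bool.xor_false, koszul, Bool.and_false, cond_false, one_smul,
    zero_add, Pi.zero_apply, Pi.sub_apply, recolor_diag, cond_true] at h2
  have h3 : blockXi ρ c i (F c) = blockXi ρ c j (F c) := (sub_eq_zero.mp h2.symm)
  -- Since the block operators agree on F c, the sum of their squares there equals their
  -- anticommutator, which is zero.
  have h4 : (((Finset.univ.filter fun x => c x = i).card : ℂ) +
      ((Finset.univ.filter fun x => c x = j).card : ℂ)) • F c = 0 := by
    rw [add_smul, ← blockXi_sq hε, ← blockXi_sq hε]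
    nth_rewrite 1 [h3]
    rw [blockXi_anticomm hε c hij.ne, h3, neg_add_cancel]
  have h5 : (((Finset.univ.filter fun x => c x = i).card : ℂ) +
      ((Finset.univ.filter fun x => c x = j).card : ℂ)) ≠ 0 := by
    rw [← Nat.cast_add, Nat.cast_ne_zero]
    obtain ⟨x, hx⟩ := hi
    have : 0 < (Finset.univ.filter fun x => c x = i).card :=
      Finset.card_pos.mpr ⟨x, by simpa using hx⟩
    omega
  exact (smul_eq_zero.mp h4).resolve_left h5

end Strictness

/-! ### Lexicographic order and sizes of colour classes -/

/-- Weakly decreasing lists are compared lexicographically by the largest entry whose multiplicities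
differ. -/
theorem List.lt_of_count_lt_of_pairwise {l l' : List ℕ} (hl : l.Pairwise (· ≥ ·))
    (hl' : l'.Pairwise (· ≥ ·)) {m : ℕ} (hm : l.count m < l'.count m)
    (h : ∀ k, m < k → l.count k = l'.count k) : l < l' := by
  induction l' generalizing l with
  | nil => simp at hm
  | cons b t' ih =>
    cases l with
    | nil => exact List.nil_lt_cons b t'
    | cons a t =>
      rw [List.cons_lt_cons_iff]
      rw [List.pairwise_cons] at hl hl'
      rcases lt_trichotomy a b with hab | rfl | hab
      · exact Or.inl hab
      · refine Or.inr ⟨rfl, ih hl.2 hl'.2 ?_ ?_⟩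
        · simp only [List.count_cons] at hm; omega
        · intro k hk
          have := h k hk
          simp only [List.count_cons] at this; omega
      · exfalso
        have hmem : m ∈ b :: t' := List.count_pos_iff.mp (by omega)
        have hmb : m ≤ b := by
          rcases List.mem_cons.mp hmem with rfl | hmt
          · exact le_rfl
          · exact hl'.1 m hmt
        have h1 := h a (by omega)
        have h2 : a ∈ b :: t' := by
          rw [← List.count_pos_iff, ← h1]; simp
        rcases List.mem_cons.mp h2 with rfl | hat
        · omega
        · have := hl'.1 a hat; omega

section ColorPartition

variable {d : ℕ}

/-- The number of points of colour `i`. -/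
def colorCard (c : Fin d → ℕ) (i : ℕ) : ℕ := (Finset.univ.filter fun x => c x = i).card

theorem colorCard_pos_iff (c : Fin d → ℕ) (i : ℕ) :
    0 < colorCard c i ↔ i ∈ Finset.univ.image c := by
  rw [colorCard, Finset.card_pos]
  simp [Finset.Nonempty]

/-- The partition formed by the sizes of the colour classes. -/
def colorPartition (c : Fin d → ℕ) : Nat.Partition d where
  parts := (Finset.univ.image c).val.map (colorCard c)
  parts_pos := by
    intro i hi
    obtain ⟨k, hk, rfl⟩ := Multiset.mem_map.mp hi
    exact (colorCard_pos_iff c k).mpr hk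
  parts_sum := by
    have := Finset.card_eq_sum_card_image c Finset.univ
    rw [Finset.card_univ, Fintype.card_fin] at this
    exact this.symm

theorem rows_pairwise (μ : Nat.Partition d) : μ.rows.Pairwise (· ≥ ·) :=
  Multiset.pairwise_sort _ _

theorem coe_rows (μ : Nat.Partition d) : (μ.rows : Multiset ℕ) = μ.parts := Multiset.sort_eq _ _

theorem count_rows_colorPartition (c : Fin d → ℕ) {m : ℕ} (hm : 0 < m) :
    (colorPartition c).rows.count m = {k | colorCard c k = m}.ncard := by
  have : {k | colorCard c k = m} =
      ((Finset.univ.image c).filter fun k => m = colorCard c k : Finset ℕ) := by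
    ext k
    simp only [Set.mem_ofPred_eq, Finset.coe_filter]
    constructor
    · rintro rfl; exact ⟨(colorCard_pos_iff c k).mp hm, rfl⟩
    · rintro ⟨_, rfl⟩; rfl
  rw [this, Set.ncard_coe_finset, ← Multiset.coe_count, coe_rows]
  exact Multiset.count_map (colorCard c) (Finset.univ.image c).val m

theorem colorCard_comp (c : Fin d → ℕ) (σ : Equiv.Perm (Fin d)) (i : ℕ) :
    colorCard (c ∘ σ) i = colorCard c i :=
  Finset.card_equiv σ (by simp)

theorem colorCard_update_of_ne (c : Fin d → ℕ) (x : Fin d) (a k : ℕ) (h1 : k ≠ a) (h2 : k ≠ c x) :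
    colorCard (Function.update c x a) k = colorCard c k := by
  unfold colorCard
  congr 1
  ext y
  by_cases h : y = x
  · subst h; simp [h1.symm, h2.symm]
  · simp [h]

theorem colorCard_update_self (c : Fin d → ℕ) (x : Fin d) (a : ℕ) (h : a ≠ c x) :
    colorCard (Function.update c x a) a = colorCard c a + 1 := by
  unfold colorCard
  rw [← Finset.card_insert_of_notMem (a := x) (by simpa using h.symm)]
  congr 1
  ext y
  by_cases h : y = x
  · subst h; simp
  · simp [h]

theorem colorCard_update_old (c : Fin d → ℕ) (x : Fin d) (a : ℕ) (h : a ≠ c x) :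
    colorCard (Function.update c x a) (c x) + 1 = colorCard c (c x) := by
  have := colorCard_update_self (Function.update c x a) x (c x) (by simpa using h.symm)
  rw [← this]; simp

theorem finite_colorCard_eq (c : Fin d → ℕ) {m : ℕ} (hm : 0 < m) :
    {k | colorCard c k = m}.Finite := by
  refine (Finset.univ.image c).finite_toSet.subset ?_
  rintro k rfl
  exact (colorCard_pos_iff c k).mp hm

/-- Moving a point to a colour class that is at least as large increases the partition. -/
theorem rows_lt_rows_update (c : Fin d → ℕ) (σ : Equiv.Perm (Fin d)) (x : Fin d) {a : ℕ}
    (hne : a ≠ c (σ x)) (hle : colorCard c (c (σ x)) ≤ colorCard c a) :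
    (colorPartition c).rows < (colorPartition (Function.update (c ∘ σ) x a)).rows := by
  have hb := colorCard_update_old (c ∘ σ) x a hne
  have ha := colorCard_update_self (c ∘ σ) x a hne
  have hk := fun k => colorCard_update_of_ne (c ∘ σ) x a k
  simp only [colorCard_comp, Function.comp_apply] at hb ha hk
  set c' := Function.update (c ∘ σ) x a
  -- The class that loses a point is no larger than the one that gains it, so the new size
  -- `colorCard c a + 1` is the largest part whose multiplicity changes.
  refine List.lt_of_count_lt_of_pairwise (rows_pairwise _) (rows_pairwise _)
    (m := colorCard c a + 1) ?_ ?_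
  · rw [count_rows_colorPartition _ (Nat.succ_pos _), count_rows_colorPartition _ (Nat.succ_pos _)]
    have : {k | colorCard c' k = colorCard c a + 1} =
        insert a {k | colorCard c k = colorCard c a + 1} := by
      ext k
      simp only [Set.mem_ofPred_eq, Set.mem_insert_iff]
      by_cases h1 : k = a
      · subst h1; simp [ha]
      · by_cases h2 : k = c (σ x)
        · subst h2; simp only [h1, false_or]; omega
        · rw [hk k h1 h2]; simp [h1]
    rw [this, Set.ncard_insert_of_notMem (by simp) (finite_colorCard_eq c (Nat.succ_pos _))]
    exact Nat.lt_succ_self _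
  · intro m hm
    rw [count_rows_colorPartition _ (by omega), count_rows_colorPartition _ (by omega)]
    congr 1
    ext k
    simp only [Set.mem_ofPred_eq]
    by_cases h1 : k = a
    · subst h1; omega
    · by_cases h2 : k = c (σ x)
      · subst h2; omega
      · rw [hk k h1 h2]

theorem colorPartition_eq_of_colorCard {c : Fin d → ℕ} {μ : Nat.Partition d}
    (h : ∀ i, colorCard c i = μ.rows.getD i 0) : colorPartition c = μ := by
  have hpos : ∀ k ∈ μ.rows, 0 < k := by
    intro k hk
    refine μ.parts_pos ?_
    rw [← coe_rows]; exact hk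
  have himg : Finset.univ.image c = Finset.range μ.rows.length := by
    ext i
    rw [← colorCard_pos_iff, h, Finset.mem_range]
    constructor
    · intro hi
      by_contra hlt
      rw [List.getD_eq_default _ _ (by omega)] at hi
      exact lt_irrefl _ hi
    · intro hi
      rw [List.getD_eq_getElem _ _ hi]
      exact hpos _ (List.getElem_mem hi)
  apply Nat.Partition.ext
  rw [← coe_rows μ]
  change (Finset.univ.image c).val.map (colorCard c) = _
  rw [himg, Finset.range_val, Multiset.range, Multiset.map_coe, funext h]
  congr 1
  refine List.ext_getElem (by simp) fun n h1 h2 => ?_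
  simp [h2]

/-- Rename each colour by its position in the list of used colours sorted by decreasing class size.
Renaming is injective on used colours, so the Young subgroup is unchanged. -/
theorem exists_colorCard_eq_rows (c : Fin d → ℕ) : ∃ c' : Fin d → ℕ,
    (∀ i, colorCard c' i = (colorPartition c).rows.getD i 0) ∧
      ∀ σ : Equiv.Perm (Fin d), c' ∘ σ = c' ↔ c ∘ σ = c := by
  set L := (Finset.univ.image c).toList.insertionSort fun a b => colorCard c b ≤ colorCard c a
    with hL
  have hperm : L.Perm (Finset.univ.image c).toList := List.perm_insertionSort _ _
  have hnodup : L.Nodup := hperm.nodup_iff.mpr (Finset.nodup_toList _)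
  have hmem : ∀ x, c x ∈ L := by
    intro x
    rw [hperm.mem_iff]; simp
  have hrows : L.map (colorCard c) = (colorPartition c).rows := by
    refine List.Perm.eq_of_pairwise (le := (· ≥ ·)) (fun a b _ _ h1 h2 => le_antisymm h2 h1) ?_
      (rows_pairwise _) ?_
    · rw [List.pairwise_map]
      have : Std.Total fun a b => colorCard c b ≤ colorCard c a := ⟨fun a b => le_total _ _⟩
      have : IsTrans ℕ fun a b => colorCard c b ≤ colorCard c a := ⟨fun a b c h1 h2 => h2.trans h1⟩
      exact List.pairwise_insertionSort _ _
    · rw [← Multiset.coe_eq_coe, coe_rows, ← Multiset.map_coe, Multiset.coe_eq_coe.mpr hperm,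
        Finset.coe_toList]
      rfl
  refine ⟨fun x => L.idxOf (c x), fun i => ?_, fun σ => ?_⟩
  · rw [← hrows]
    by_cases hi : i < L.length
    · rw [List.getD_eq_getElem _ _ (by simpa using hi), List.getElem_map]
      unfold colorCard
      congr 1
      ext x
      simp only [Finset.mem_filter, Finset.mem_univ, true_and]
      constructor
      · rintro rfl; simp
      · intro h; rw [h]; exact hnodup.idxOf_getElem i hi
    · rw [List.getD_eq_default _ _ (by simpa using hi)]
      unfold colorCard
      rw [Finset.card_eq_zero, Finset.filter_eq_empty_iff]
      intro x _ hx
      exact hi (hx ▸ List.idxOf_lt_length_of_mem (hmem x))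
  · constructor
    · intro h
      funext x
      exact (List.idxOf_inj (hmem _)).mp (congrFun h x)
    · intro h
      funext x
      simp only [Function.comp_apply]
      rw [show c (σ x) = c x from congrFun h x]

end ColorPartition

/-! ### Structure of the Clifford group -/

namespace Cliff

variable {d : ℕ}

/-- The presentation might collapse; the Clifford algebra of Euclidean space is a model in which ε
becomes -1, which differs from 1. -/
theorem eps_ne_one (d : ℕ) : eps d ≠ 1 := by
  let Q : QuadraticForm ℝ (EuclideanSpace ℝ (Fin d)) :=
    LinearMap.BilinMap.toQuadraticMap (innerₗ (EuclideanSpace ℝ (Fin d)))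
  have hQ : ∀ v, Q v = inner ℝ v v := fun v => rfl
  let b : Fin d → EuclideanSpace ℝ (Fin d) := fun i => EuclideanSpace.single i 1
  have hb : ∀ i j, inner ℝ (b i) (b j) = if i = j then (1 : ℝ) else 0 := by
    intro i j
    simp [b, EuclideanSpace.inner_single_left]
  let ι : EuclideanSpace ℝ (Fin d) → CliffordAlgebra Q := fun v => CliffordAlgebra.ι Q v
  have hsq : ∀ i, ι (b i) * ι (b i) = 1 := by
    intro i
    simp only [ι]
    rw [CliffordAlgebra.ι_sq_scalar, hQ, hb, if_pos rfl, map_one]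
  have hanti : ∀ i j, i ≠ j → ι (b i) * ι (b j) = - (ι (b j) * ι (b i)) := by
    intro i j h
    rw [eq_neg_iff_add_eq_zero]
    simp only [ι]
    rw [CliffordAlgebra.ι_mul_ι_add_swap]
    have : QuadraticMap.polar Q (b i) (b j) = 0 := by
      simp only [QuadraticMap.polar, hQ, inner_add_left, inner_add_right, hb, h, h.symm, if_true,
        if_false]
      norm_num
    rw [this, map_zero]
  let f : Cliff d →* (CliffordAlgebra Q)ˣ := lift (-1) (fun i => ⟨ι (b i), ι (b i), hsq i, hsq i⟩)
    (by ext; simp) (fun i => by ext; simpa using hsq i) (fun i => by ext; simp)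
    (fun i j h => by ext; simpa using hanti i j h)
  intro h
  have h1 : f (eps d) = -1 := lift_eps _ _ _ _ _ _
  rw [h, map_one] at h1
  have h2 : (1 : CliffordAlgebra Q) = -1 := congrArg Units.val h1
  have h3 : (2 : ℝ) • (1 : CliffordAlgebra Q) = 0 := by
    rw [two_smul]; nth_rewrite 1 [h2]; simp
  rcases smul_eq_zero.mp h3 with h4 | h4
  · norm_num at h4
  · exact one_ne_zero h4

theorem eps_comm (y : Cliff d) : eps d * y = y * eps d := by
  have h : (MulAut.conj (eps d)).toMonoidHom = MonoidHom.id (Cliff d) :=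
    hom_ext (by simp) fun i => by simp [eps_xi]
  have := DFunLike.congr_fun h y
  simpa [mul_inv_eq_iff_eq_mul] using this

theorem eps_inv : (eps d)⁻¹ = eps d := inv_eq_of_mul_eq_one_left (eps_sq d)

/-- The set of the `i` such that `ξ_i` occurs an odd number of times in a word. -/
def support (d : ℕ) : Cliff d →* Multiplicative (Fin d → ZMod 2) :=
  lift 1 (fun i => Multiplicative.ofAdd (Pi.single i 1)) (by simp)
    (fun i => by
      rw [← ofAdd_add, ← Pi.single_add, show (1 + 1 : ZMod 2) = 0 from rfl, Pi.single_zero,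
        ofAdd_zero])
    (fun i => by simp) (fun i j _ => by rw [one_mul, mul_comm])

theorem support_eps : support d (eps d) = 1 := lift_eps _ _ _ _ _ _

theorem support_xi (i : Fin d) : support d (xi i) = Multiplicative.ofAdd (Pi.single i 1) :=
  lift_xi _ _ _ _ _ _ i

theorem degree_eps : degree d (eps d) = 1 := lift_eps _ _ _ _ _ _

theorem degree_xi (i : Fin d) : degree d (xi i) = Multiplicative.ofAdd 1 :=
  lift_xi _ _ _ _ _ _ i

theorem mem_words_finRange (y : Cliff d) : y ∈ words (List.finRange d) := by
  have hy : y ∈ Subgroup.closure (Set.range (PresentedGroup.of (rels := cliffRels d))) := by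
    rw [PresentedGroup.closure_range_of]; trivial
  have hsq : ∀ a : CliffGen d, (PresentedGroup.of a : Cliff d)⁻¹ = PresentedGroup.of a := by
    intro a
    cases a with
    | eps => exact eps_inv
    | xi i => exact inv_eq_of_mul_eq_one_left (xi_sq i)
  have hmul : ∀ a : CliffGen d, ∀ z ∈ words (List.finRange d),
      (PresentedGroup.of a : Cliff d) * z ∈ words (List.finRange d) := by
    intro a z hz
    cases a with
    | eps => exact eps_mul_mem_words _ z hz
    | xi i => exact xi_mul_mem_words i _ (List.mem_finRange i) z hz
  induction hy using Subgroup.closure_induction_left with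
  | one => exact one_mem_words _
  | mul_left a ha z _ ih =>
    obtain ⟨b, rfl⟩ := ha
    exact hmul b z ih
  | inv_mul_cancel a ha z _ ih =>
    obtain ⟨b, rfl⟩ := ha
    rw [hsq b]
    exact hmul b z ih

/-- In a normally ordered word without repeated indices, a factor ξ_j makes coordinate j of the
support nonzero. Trivial support therefore leaves only powers of ε. -/
theorem support_words (l : List (Fin d)) (hl : l.Nodup) : ∀ y ∈ words l,
    (∀ i ∉ l, Multiplicative.toAdd (support d y) i = 0) ∧
      (support d y = 1 → y = 1 ∨ y = eps d) := by
  induction l with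
  | nil =>
    rintro y (rfl | rfl)
    · simp
    · simp [support_eps]
  | cons j l ih =>
    rw [List.nodup_cons] at hl
    rintro y (hy | ⟨z, hz, rfl⟩)
    · have := ih hl.2 y hy
      exact ⟨fun i hi => this.1 i fun h => hi (List.mem_cons_of_mem _ h), this.2⟩
    · have := ih hl.2 z hz
      dsimp only
      rw [map_mul, support_xi]
      refine ⟨fun i hi => ?_, fun h => ?_⟩
      · rw [List.mem_cons, not_or] at hi
        rw [toAdd_mul, toAdd_ofAdd, Pi.add_apply, Pi.single_eq_of_ne hi.1, this.1 i hi.2, zero_add]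
      · have h1 := congrFun (congrArg Multiplicative.toAdd h) j
        rw [toAdd_mul, toAdd_ofAdd, Pi.add_apply, Pi.single_eq_same, this.1 j hl.1, add_zero] at h1
        exact absurd h1 one_ne_zero

theorem eq_one_or_eq_eps_of_support {y : Cliff d} (h : support d y = 1) : y = 1 ∨ y = eps d :=
  (support_words _ (List.nodup_finRange d) y (mem_words_finRange y)).2 h

theorem support_surjective : Function.Surjective (support d) := by
  intro f
  have h : ∀ g : Fin d → ZMod 2, g ∈ Subgroup.toAddSubgroup' (support d).range := by
    intro g
    rw [← Finset.univ_sum_single g]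
    refine AddSubgroup.sum_mem _ fun i _ => ?_
    have h2 : ∀ z : ZMod 2, z = 0 ∨ z = 1 := by decide
    rcases h2 (g i) with hz | hz
    · rw [hz, Pi.single_zero]; exact AddSubgroup.zero_mem _
    · rw [hz]
      exact ⟨xi i, support_xi i⟩
  exact h (Multiplicative.toAdd f)

theorem degree_eq_sum (y : Cliff d) :
    Multiplicative.toAdd (degree d y) = ∑ i, Multiplicative.toAdd (support d y) i := by
  let s : Multiplicative (Fin d → ZMod 2) →* Multiplicative (ZMod 2) :=
    { toFun := fun f => Multiplicative.ofAdd (∑ i, Multiplicative.toAdd f i)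
      map_one' := by simp
      map_mul' := fun f g => by simp [Finset.sum_add_distrib] }
  have h : degree d = s.comp (support d) := by
    refine hom_ext ?_ fun i => ?_
    · simp [support_eps, degree_eps]
    · rw [MonoidHom.comp_apply, support_xi, degree_xi]
      change _ = Multiplicative.ofAdd (∑ j, Pi.single i (1 : ZMod 2) j)
      rw [Finset.sum_pi_single', if_pos (Finset.mem_univ i)]
  rw [h]; rfl

/-- `ε^z`. -/
def epsPow (d : ℕ) (z : ZMod 2) : Cliff d := if z = 0 then 1 else eps d

theorem epsPow_add (a b : ZMod 2) : epsPow d (a + b) = epsPow d a * epsPow d b := by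
  have h2 : ∀ z : ZMod 2, z = 0 ∨ z = 1 := by decide
  rcases h2 a with rfl | rfl <;> rcases h2 b with rfl | rfl
  · simp [epsPow]
  · simp [epsPow]
  · simp [epsPow]
  · rw [show (1 + 1 : ZMod 2) = 0 from rfl]
    simp [epsPow, eps_sq]

/-- Moving ξ_i past a word costs one ε for each letter ξ_j with j ≠ i, so the exponent is the degree
corrected by the parity of the occurrences of ξ_i. Both sides define homomorphisms in y, so
generators suffice. -/
theorem xi_mul (i : Fin d) (y : Cliff d) : xi i * y =
    epsPow d (Multiplicative.toAdd (degree d y) + Multiplicative.toAdd (support d y) i) *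
      (y * xi i) := by
  let g : Cliff d →* Cliff d :=
    { toFun := fun y => epsPow d (Multiplicative.toAdd (degree d y) +
        Multiplicative.toAdd (support d y) i) * y
      map_one' := by simp [epsPow]
      map_mul' := fun y z => by
        have hc : ∀ (z : ZMod 2) (y : Cliff d), epsPow d z * y = y * epsPow d z := by
          intro z y
          unfold epsPow
          split_ifs
          · simp
          · exact eps_comm y
        rw [map_mul (degree d), map_mul (support d), toAdd_mul, toAdd_mul, Pi.add_apply, add_add_add_comm, epsPow_add]
        rw [mul_assoc, mul_assoc, ← mul_assoc (epsPow d _) y z, hc _ y]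
        simp only [mul_assoc] }
  have h : (MulAut.conj (xi i)).toMonoidHom = g := by
    refine hom_ext ?_ fun j => ?_
    · simp [g, degree_eps, support_eps, epsPow, ← eps_xi]
    · simp only [MulEquiv.coe_toMonoidHom, MulAut.conj_apply, MonoidHom.coe_mk, OneHom.coe_mk, g,
        degree_xi, support_xi, toAdd_ofAdd]
      by_cases hij : i = j
      · subst hij
        rw [Pi.single_eq_same, show (1 + 1 : ZMod 2) = 0 from rfl]
        simp [epsPow]
      · rw [Pi.single_eq_of_ne hij, add_zero, xi_xi hij]
        simp [epsPow]
  have := DFunLike.congr_fun h y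
  change xi i * y * (xi i)⁻¹ = epsPow d _ * y at this
  rw [← mul_assoc, ← this, inv_mul_cancel_right]

end Cliff

/-! ### Graded modules of a Clifford algebra -/

/-- `(-1)^z`. -/
def zmodSign (z : ZMod 2) : ℂ := if z = 0 then 1 else -1

theorem zmodSign_add (a b : ZMod 2) : zmodSign (a + b) = zmodSign a * zmodSign b := by
  have h2 : ∀ z : ZMod 2, z = 0 ∨ z = 1 := by decide
  rcases h2 a with rfl | rfl <;> rcases h2 b with rfl | rfl <;> norm_num [zmodSign]
  decide

theorem zmodSign_mul_self (a : ZMod 2) : zmodSign a * zmodSign a = 1 := by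
  unfold zmodSign; split_ifs <;> norm_num

/-- Two finite-dimensional representations of a finite group whose characters are not orthogonal
have a nonzero intertwining map. -/
theorem exists_intertwiningMap_ne_zero {H K K' : Type*} [Group H] [Fintype H]
    [AddCommGroup K] [Module ℂ K] [FiniteDimensional ℂ K]
    [AddCommGroup K'] [Module ℂ K'] [FiniteDimensional ℂ K']
    (ρ : Representation ℂ H K) (σ : Representation ℂ H K')
    (h : ∑ g, σ.character g * ρ.character g⁻¹ ≠ 0) :
    ∃ T : K →ₗ[ℂ] K', T ≠ 0 ∧ ∀ g, T ∘ₗ ρ g = σ g ∘ₗ T := by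
  have hn : (Nat.card H : ℂ) ≠ 0 := Nat.cast_ne_zero.mpr Nat.card_pos.ne'
  let _ : Invertible (Nat.card H : ℂ) := invertibleOfNonzero hn
  have h1 := Representation.card_inv_mul_sum_char_mul_char_eq_finrank ρ σ
  have h2 : Module.finrank ℂ (Representation.IntertwiningMap ρ σ) ≠ 0 := by
    intro h0
    rw [h0, Nat.cast_zero] at h1
    exact mul_ne_zero (inv_ne_zero hn) h h1
  have := Module.nontrivial_of_finrank_pos (Nat.pos_of_ne_zero h2)
  obtain ⟨T, hT⟩ := exists_ne (0 : Representation.IntertwiningMap ρ σ)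
  refine ⟨T.toLinearMap, fun h0 => hT ?_, fun g => T.isIntertwining' g⟩
  ext1
  exact h0

section CliffordOperators

variable {l : ℕ} {K : Type*} [AddCommGroup K] [Module ℂ K]

/-- Anticommuting operators with nonzero scalar squares, odd with respect to the involution `P`. -/
structure IsCliffordSystem (m : Fin l → ℂ) (b : Fin l → Module.End ℂ K) (P : Module.End ℂ K) :
    Prop where
  ne_zero : ∀ i, m i ≠ 0
  sq : ∀ i, b i * b i = m i • 1
  anti : ∀ i j, i ≠ j → b i * b j = - (b j * b i)
  inv : P * P = 1
  odd : ∀ i, P * b i = - (b i * P)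

variable {m : Fin l → ℂ} {b : Fin l → Module.End ℂ K} {P : Module.End ℂ K}

/-- The representation of the Clifford group attached to a Clifford system. -/
theorem IsCliffordSystem.exists_rep (h : IsCliffordSystem m b P) {r : Fin l → ℂ}
    (hr : ∀ i, r i * r i = m i) : ∃ τ : Representation ℂ (Cliff l) K,
      τ (Cliff.eps l) = -1 ∧ ∀ i, τ (Cliff.xi i) = (r i)⁻¹ • b i := by
  have hr0 : ∀ i, r i ≠ 0 := fun i h0 => h.ne_zero i (by rw [← hr, h0, zero_mul])
  have hsq : ∀ i, ((r i)⁻¹ • b i) * ((r i)⁻¹ • b i) = 1 := by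
    intro i
    rw [smul_mul_smul_comm, h.sq, smul_smul, ← hr i]
    have := hr0 i
    rw [show (r i)⁻¹ * (r i)⁻¹ * (r i * r i) = 1 by field_simp, one_smul]
  let f : Cliff l →* (Module.End ℂ K)ˣ := Cliff.lift (-1)
    (fun i => ⟨(r i)⁻¹ • b i, (r i)⁻¹ • b i, hsq i, hsq i⟩)
    (by simp) (fun i => Units.ext (hsq i)) (fun i => by simp)
    (fun i j hij => Units.ext (by
      simp only [Units.val_mul, Units.val_neg, Units.val_one]
      rw [smul_mul_smul_comm, h.anti i j hij, mul_assoc, smul_mul_smul_comm, neg_one_mul, smul_neg,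
        mul_comm]))
  refine ⟨(Units.coeHom _).comp f, ?_, fun i => ?_⟩
  · have : f (Cliff.eps l) = -1 := Cliff.lift_eps _ _ _ _ _ _
    rw [MonoidHom.comp_apply, this]; simp
  · have : f (Cliff.xi i) = _ := Cliff.lift_xi _ _ _ _ _ _ i
    rw [MonoidHom.comp_apply, this]; simp

theorem clifford_parity {τ : Representation ℂ (Cliff l) K} (hε : τ (Cliff.eps l) = -1)
    (hP : P * P = 1) (hodd : ∀ i, P * τ (Cliff.xi i) = - (τ (Cliff.xi i) * P)) (y : Cliff l) :
    P * τ y = zmodSign (Multiplicative.toAdd (Cliff.degree l y)) • (τ y * P) := by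
  let f : Cliff l →* Module.End ℂ K :=
    { toFun := fun y => P * τ y * P
      map_one' := by simp [hP]
      map_mul' := fun y z => by
        rw [map_mul, show P * τ y * P * (P * τ z * P) = P * τ y * (P * P) * τ z * P by noncomm_ring,
          hP]
        noncomm_ring }
  let g : Cliff l →* Module.End ℂ K :=
    { toFun := fun y => zmodSign (Multiplicative.toAdd (Cliff.degree l y)) • τ y
      map_one' := by simp [zmodSign]
      map_mul' := fun y z => by
        rw [map_mul (Cliff.degree l), map_mul τ, toAdd_mul, zmodSign_add, smul_mul_smul_comm] }
  have hfg : f = g := by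
    refine Cliff.hom_ext ?_ fun i => ?_
    · simp [f, g, hε, hP, Cliff.degree_eps, zmodSign]
    · change P * τ (Cliff.xi i) * P = zmodSign _ • τ (Cliff.xi i)
      rw [hodd, neg_mul, mul_assoc, hP, Cliff.degree_xi]
      simp [zmodSign]
  have h := DFunLike.congr_fun hfg y
  change P * τ y * P = zmodSign _ • τ y at h
  rw [← smul_mul_assoc, ← h, mul_assoc _ P P, hP, mul_one]

theorem trace_eq_zero_of_conj_neg {A B : Module.End ℂ K} (hB : B * B = 1)
    (h : B * A = - (A * B)) : LinearMap.trace ℂ K A = 0 := by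
  have h1 : LinearMap.trace ℂ K (B * A * B) = LinearMap.trace ℂ K A := by
    rw [LinearMap.trace_mul_comm, ← mul_assoc, hB, one_mul]
  rw [h, neg_mul, mul_assoc, hB, mul_one, map_neg] at h1
  linear_combination -(1 / 2 : ℂ) * h1

/-- An odd y anticommutes with P, and an even y of nontrivial support anticommutes with ξ_i for any
i in its support, so the trace is its own negative. The grading is essential: for odd l the product
of all the ξ_i is central. -/
theorem clifford_character [FiniteDimensional ℂ K] {τ : Representation ℂ (Cliff l) K}
    (hε : τ (Cliff.eps l) = -1) (hP : P * P = 1)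
    (hodd : ∀ i, P * τ (Cliff.xi i) = - (τ (Cliff.xi i) * P)) (y : Cliff l) (h1 : y ≠ 1)
    (h2 : y ≠ Cliff.eps l) : τ.character y = 0 := by
  have h3 : Cliff.support l y ≠ 1 := fun h =>
    (Cliff.eq_one_or_eq_eps_of_support h).elim h1 h2
  have hz : ∀ z : ZMod 2, z = 0 ∨ z = 1 := by decide
  rcases hz (Multiplicative.toAdd (Cliff.degree l y)) with h0 | h0
  · obtain ⟨i, hi⟩ : ∃ i, Multiplicative.toAdd (Cliff.support l y) i ≠ 0 := by
      by_contra hc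
      push Not at hc
      exact h3 (Multiplicative.toAdd.injective (funext hc))
    have hi1 := (hz _).resolve_left hi
    have h4 := Cliff.xi_mul i y
    rw [h0, hi1] at h4
    refine trace_eq_zero_of_conj_neg (B := τ (Cliff.xi i)) ?_ ?_
    · rw [← map_mul, Cliff.xi_sq, map_one]
    · rw [← map_mul, h4, map_mul, map_mul]
      simp [Cliff.epsPow, hε]
  · refine trace_eq_zero_of_conj_neg (B := P) hP ?_
    rw [clifford_parity hε hP hodd, h0]
    simp [zmodSign]

theorem exists_sq_eq (m : Fin l → ℂ) : ∃ r : Fin l → ℂ, ∀ i, r i * r i = m i := by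
  choose r hr using fun i => IsAlgClosed.exists_pow_nat_eq (m i) (n := 2) two_pos
  exact ⟨r, fun i => by rw [← pow_two, hr]⟩

/-- Both characters live on 1 and ε, so their pairing is 2 dim K dim K' ≠ 0 and a nonzero
intertwiner T exists. One of T ± P' T P is then nonzero, and each is homogeneous. -/
theorem IsCliffordSystem.exists_homogeneous [FiniteDimensional ℂ K] [Nontrivial K]
    (h : IsCliffordSystem m b P) {K' : Type*} [AddCommGroup K'] [Module ℂ K']
    [FiniteDimensional ℂ K'] [Nontrivial K'] {b' : Fin l → Module.End ℂ K'}
    {P' : Module.End ℂ K'} (h' : IsCliffordSystem m b' P') :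
    ∃ s : ℂ, (s = 1 ∨ s = -1) ∧ ∃ T : K →ₗ[ℂ] K', T ≠ 0 ∧ (∀ i, T ∘ₗ b i = b' i ∘ₗ T) ∧
      P' ∘ₗ T = s • (T ∘ₗ P) := by
  classical
  obtain ⟨r, hr⟩ := exists_sq_eq m
  have hr0 : ∀ i, r i ≠ 0 := fun i h0 => h.ne_zero i (by rw [← hr, h0, zero_mul])
  obtain ⟨τ, hτε, hτ⟩ := h.exists_rep hr
  obtain ⟨τ', hτε', hτ'⟩ := h'.exists_rep hr
  let _ := Fintype.ofFinite (Cliff l)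
  have hodd : ∀ i, P * τ (Cliff.xi i) = - (τ (Cliff.xi i) * P) := by
    intro i; rw [hτ, mul_smul_comm, h.odd, smul_neg, smul_mul_assoc]
  have hodd' : ∀ i, P' * τ' (Cliff.xi i) = - (τ' (Cliff.xi i) * P') := by
    intro i; rw [hτ', mul_smul_comm, h'.odd, smul_neg, smul_mul_assoc]
  have hsum : ∑ g, τ'.character g * τ.character g⁻¹ ≠ 0 := by
    rw [Fintype.sum_eq_add 1 (Cliff.eps l) (Cliff.eps_ne_one l).symm]
    · have e1 : τ.character (Cliff.eps l) = - (Module.finrank ℂ K : ℂ) := by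
        simp [Representation.character, hτε]
      have e2 : τ'.character (Cliff.eps l) = - (Module.finrank ℂ K' : ℂ) := by
        simp [Representation.character, hτε']
      rw [inv_one, Cliff.eps_inv, e1, e2, Representation.char_one, Representation.char_one]
      have p1 : (Module.finrank ℂ K : ℂ) ≠ 0 := Nat.cast_ne_zero.mpr Module.finrank_pos.ne'
      have p2 : (Module.finrank ℂ K' : ℂ) ≠ 0 := Nat.cast_ne_zero.mpr Module.finrank_pos.ne'
      rw [neg_mul_neg, ← two_mul]
      exact mul_ne_zero two_ne_zero (mul_ne_zero p2 p1)
    · rintro y ⟨h1, h2⟩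
      rw [clifford_character hτε' h'.inv hodd' y h1 h2, zero_mul]
  obtain ⟨T, hT0, hT⟩ := exists_intertwiningMap_ne_zero τ τ' hsum
  have hTb : ∀ i, T ∘ₗ b i = b' i ∘ₗ T := by
    intro i
    have := hT (Cliff.xi i)
    rw [hτ, hτ', LinearMap.comp_smul, LinearMap.smul_comp] at this
    exact smul_right_injective _ (inv_ne_zero (hr0 i)) this
  have key : ∀ s : ℂ, s * s = 1 → (∀ i, (T + s • (P' ∘ₗ T ∘ₗ P)) ∘ₗ b i =
      b' i ∘ₗ (T + s • (P' ∘ₗ T ∘ₗ P))) ∧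
      P' ∘ₗ (T + s • (P' ∘ₗ T ∘ₗ P)) = s • ((T + s • (P' ∘ₗ T ∘ₗ P)) ∘ₗ P) := by
    intro s hs
    have hPP : ∀ v, P (P v) = v := fun v => LinearMap.congr_fun h.inv v
    have hPP' : ∀ v, P' (P' v) = v := fun v => LinearMap.congr_fun h'.inv v
    have ho : ∀ i v, P (b i v) = - b i (P v) := fun i v => LinearMap.congr_fun (h.odd i) v
    have ho' : ∀ i v, P' (b' i v) = - b' i (P' v) := fun i v => LinearMap.congr_fun (h'.odd i) v
    have hTb' : ∀ i v, T (b i v) = b' i (T v) := fun i v => LinearMap.congr_fun (hTb i) v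
    refine ⟨fun i => ?_, ?_⟩
    · ext v
      simp [ho, ho', hTb']
    · ext v
      simp [hPP, hPP', smul_smul, hs, add_comm]
  by_cases hplus : T + (1 : ℂ) • (P' ∘ₗ T ∘ₗ P) = 0
  · refine ⟨-1, Or.inr rfl, T + (-1 : ℂ) • (P' ∘ₗ T ∘ₗ P), fun h0 => hT0 ?_, key (-1) (by norm_num)⟩
    have : (2 : ℂ) • T = 0 := by
      rw [two_smul]
      calc T + T = (T + (1 : ℂ) • (P' ∘ₗ T ∘ₗ P)) + (T + (-1 : ℂ) • (P' ∘ₗ T ∘ₗ P)) := by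
            rw [one_smul, neg_one_smul]; abel
        _ = 0 := by rw [hplus, h0, add_zero]
    exact (smul_eq_zero.mp this).resolve_left two_ne_zero
  · exact ⟨1, Or.inl rfl, _, hplus, key 1 (by norm_num)⟩

/-- The product of all operators of a Clifford system, up to a scalar. -/
theorem IsCliffordSystem.exists_volume (h : IsCliffordSystem m b P) :
    ∃ Z : Module.End ℂ K, Function.Injective Z ∧
      (∀ i, b i * Z = zmodSign (l + 1) • (Z * b i)) ∧
      P * Z = zmodSign l • (Z * P) ∧
      ∀ J : Module.End ℂ K, (∀ i, J * b i = b i * J) → J * Z = Z * J := by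
  obtain ⟨r, hr⟩ := exists_sq_eq m
  have hr0 : ∀ i, r i ≠ 0 := fun i h0 => h.ne_zero i (by rw [← hr, h0, zero_mul])
  obtain ⟨τ, hτε, hτ⟩ := h.exists_rep hr
  have hodd : ∀ i, P * τ (Cliff.xi i) = - (τ (Cliff.xi i) * P) := by
    intro i; rw [hτ, mul_smul_comm, h.odd, smul_neg, smul_mul_assoc]
  -- An element of full support has degree l, whence the sign exponents l + 1 against a generator
  -- and l against P.
  obtain ⟨y, hy⟩ := Cliff.support_surjective (d := l) (Multiplicative.ofAdd fun _ => 1)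
  have hdeg : Multiplicative.toAdd (Cliff.degree l y) = (l : ZMod 2) := by
    rw [Cliff.degree_eq_sum, hy]; simp
  refine ⟨τ y, (τ.apply_bijective y).1, fun i => ?_, ?_, fun J hJ => ?_⟩
  · have h4 := congrArg τ (Cliff.xi_mul i y)
    have hb : b i = r i • τ (Cliff.xi i) := by rw [hτ, smul_inv_smul₀ (hr0 i)]
    have he : ∀ z, τ (Cliff.epsPow l z) = zmodSign z • 1 := by
      intro z; unfold Cliff.epsPow zmodSign; split_ifs <;> simp [hτε]
    rw [hdeg, hy, map_mul, map_mul, he, map_mul, smul_mul_assoc, one_mul] at h4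
    rw [hb, smul_mul_assoc, h4, mul_smul_comm, smul_comm]
    rfl
  · rw [clifford_parity hτε h.inv hodd, hdeg]
  · have hgen : ∀ a : CliffGen l, J * τ (PresentedGroup.of a) = τ (PresentedGroup.of a) * J := by
      intro a
      cases a with
      | eps => change J * τ (Cliff.eps l) = τ (Cliff.eps l) * J; rw [hτε]; simp
      | xi i =>
        change J * τ (Cliff.xi i) = τ (Cliff.xi i) * J
        rw [hτ, mul_smul_comm, hJ, smul_mul_assoc]
    have hall : ∀ z ∈ Subgroup.closure (Set.range (PresentedGroup.of (rels := cliffRels l))),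
        J * τ z = τ z * J := by
      intro z hz
      induction hz using Subgroup.closure_induction with
      | mem z hz => obtain ⟨a, rfl⟩ := hz; exact hgen a
      | one => simp
      | mul z w _ _ hz hw => rw [map_mul, ← mul_assoc, hz, mul_assoc, hw, mul_assoc]
      | inv z _ hz =>
        have h1 : τ z * τ z⁻¹ = 1 := by rw [← map_mul, mul_inv_cancel, map_one]
        have h2 : τ z⁻¹ * τ z = 1 := by rw [← map_mul, inv_mul_cancel, map_one]
        calc J * τ z⁻¹ = τ z⁻¹ * (τ z * J) * τ z⁻¹ := by rw [← mul_assoc, h2, one_mul]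
          _ = τ z⁻¹ * J * (τ z * τ z⁻¹) := by rw [← hz]; noncomm_ring
          _ = τ z⁻¹ * J := by rw [h1, mul_one]
    exact hall y (by rw [PresentedGroup.closure_range_of]; trivial)

end CliffordOperators

/-! ### Lexicographic highest weights -/

namespace SergeevGroup

theorem degree_perm {d : ℕ} (σ : Equiv.Perm (Fin d)) : (perm σ).degree = 0 := by
  simp [degree, perm]

theorem degree_xi {d : ℕ} (i : Fin d) : (xi i).degree = 1 := by
  simp [degree, xi, Cliff.degree_xi]

end SergeevGroup

section Weights

variable {d : ℕ} {V : Type*} [AddCommGroup V] [Module ℂ V]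

/-- `ρ` has a nonzero vector fixed by a Young subgroup of type `μ`. -/
def HasYoungWeight (ρ : Representation ℂ (SergeevGroup d) V) (μ : Nat.Partition d) : Prop :=
  ∃ c : Fin d → ℕ, (∀ i, colorCard c i = μ.rows.getD i 0) ∧ ∃ v : V, v ≠ 0 ∧ v ∈ youngFixed ρ c

/-- `lam` is the lexicographically largest weight of `ρ`. -/
def HasHighestYoungWeight (ρ : Representation ℂ (SergeevGroup d) V) (lam : Nat.Partition d) :
    Prop :=
  HasYoungWeight ρ lam ∧ ∀ μ, HasYoungWeight ρ μ → μ.rows ≤ lam.rows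

variable {ρ : Representation ℂ (SergeevGroup d) V} {lam : Nat.Partition d}

theorem rows_injective : Function.Injective (Nat.Partition.rows (d := d)) := by
  intro μ ν h
  apply Nat.Partition.ext
  rw [← coe_rows, ← coe_rows, h]

theorem HasHighestYoungWeight.unique {μ : Nat.Partition d} (h : HasHighestYoungWeight ρ lam)
    (h' : HasHighestYoungWeight ρ μ) : lam = μ :=
  rows_injective (le_antisymm (h'.2 _ h.1) (h.2 _ h'.1))

theorem hasYoungWeight_of_ne_bot {c : Fin d → ℕ} (h : youngFixed ρ c ≠ ⊥) :
    HasYoungWeight ρ (colorPartition c) := by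
  obtain ⟨v, hv, hv0⟩ := (Submodule.ne_bot_iff _).mp h
  obtain ⟨c', hc', hst⟩ := exists_colorCard_eq_rows c
  exact ⟨c', hc', v, hv0, fun σ hσ => hv σ ((hst σ).mp hσ)⟩

theorem HasYoungWeight.map {V' : Type*} [AddCommGroup V'] [Module ℂ V']
    {ρ' : Representation ℂ (SergeevGroup d) V'} {μ : Nat.Partition d} (h : HasYoungWeight ρ μ)
    {f : V →ₗ[ℂ] V'} (hinj : Function.Injective f) (hf : ∀ x v, f (ρ x v) = ρ' x (f v)) :
    HasYoungWeight ρ' μ := by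
  obtain ⟨c, hc, v, hv, hfix⟩ := h
  refine ⟨c, hc, f v, fun h0 => hv (hinj (by rw [h0, map_zero])), fun σ hσ => ?_⟩
  rw [← hf, hfix σ hσ]

/-- An injective colouring has trivial stabilizer, so some weight always occurs, and there are
finitely many partitions. -/
theorem exists_hasHighestYoungWeight [Nontrivial V] : ∃ lam, HasHighestYoungWeight ρ lam := by
  classical
  obtain ⟨v, hv⟩ := exists_ne (0 : V)
  have h1 : HasYoungWeight ρ (colorPartition (fun x : Fin d => (x : ℕ))) := by
    refine hasYoungWeight_of_ne_bot ((Submodule.ne_bot_iff _).mpr ⟨v, fun σ hσ => ?_, hv⟩)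
    have : σ = 1 := Equiv.ext fun x => Fin.ext (congrFun hσ x)
    rw [this, perm_one, map_one]; rfl
  obtain ⟨lam, hlam, hmax⟩ := Finset.exists_max_image
    (Finset.univ.filter fun μ => HasYoungWeight ρ μ) Nat.Partition.rows
    ⟨_, Finset.mem_filter.mpr ⟨Finset.mem_univ _, h1⟩⟩
  exact ⟨lam, (Finset.mem_filter.mp hlam).2,
    fun μ hμ => hmax μ (Finset.mem_filter.mpr ⟨Finset.mem_univ _, hμ⟩)⟩

theorem HasHighestYoungWeight.youngFixed_eq_bot (h : HasHighestYoungWeight ρ lam)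
    {c : Fin d → ℕ} (hc : lam.rows < (colorPartition c).rows) : youngFixed ρ c = ⊥ := by
  by_contra hne
  exact absurd hc (not_lt.mpr (h.2 _ (hasYoungWeight_of_ne_bot hne)))

theorem rows_getD_antitone (μ : Nat.Partition d) {i j : ℕ} (hij : i ≤ j) :
    μ.rows.getD j 0 ≤ μ.rows.getD i 0 := by
  by_cases hj : j < μ.rows.length
  · rw [List.getD_eq_getElem _ _ hj, List.getD_eq_getElem _ _ (hij.trans_lt hj)]
    rcases hij.eq_or_lt with rfl | h
    · exact le_rfl
    · exact List.pairwise_iff_getElem.mp (rows_pairwise μ) i j _ _ h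
  · rw [List.getD_eq_default _ _ (not_lt.mp hj)]; exact Nat.zero_le _

/-- Smaller colours carry longer rows, so moving a point to a smaller colour increases the partition
lexicographically. -/
theorem HasHighestYoungWeight.isHighestColor (h : HasHighestYoungWeight ρ lam) {c : Fin d → ℕ}
    (hc : ∀ i, colorCard c i = lam.rows.getD i 0) : IsHighestColor ρ c := by
  intro σ x i hi
  refine h.youngFixed_eq_bot ?_
  rw [← colorPartition_eq_of_colorCard hc]
  refine rows_lt_rows_update c σ x hi.ne ?_
  rw [hc, hc]
  exact rows_getD_antitone lam hi.le

/-- Between two rows of equal length, moving a point in either direction increases the partition, so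
both raising and lowering lead to absent weights and `youngFixed_eq_bot_of_simple_root` applies. -/
theorem HasHighestYoungWeight.mem_distincts (hε : ρ (eps d) = -1)
    (h : HasHighestYoungWeight ρ lam) : lam ∈ Nat.Partition.distincts d := by
  rw [Nat.Partition.distincts, Finset.mem_filter]
  refine ⟨Finset.mem_univ _, ?_⟩
  rw [← coe_rows, Multiset.coe_nodup]
  by_contra hnd
  obtain ⟨c, hc, v, hv, hfix⟩ := h.1
  have h1 : ∃ i j : ℕ, i < j ∧ ∃ hj : j < lam.rows.length, lam.rows.getD i 0 = lam.rows[j] := by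
    rw [List.nodup_iff_pairwise_ne, List.pairwise_iff_getElem] at hnd
    push Not at hnd
    obtain ⟨i, j, hi, hj, hij, he⟩ := hnd
    exact ⟨i, j, hij, hj, by rw [List.getD_eq_getElem _ _ hi, he]⟩
  obtain ⟨i, j, hij, hj, he⟩ := h1
  have hpos : 0 < lam.rows[j] := by
    refine lam.parts_pos ?_
    rw [← coe_rows]; exact List.getElem_mem hj
  have hci : colorCard c i = colorCard c j := by rw [hc, hc, he, List.getD_eq_getElem _ _ hj]
  have hbot := youngFixed_eq_bot_of_simple_root hε (h.isHighestColor hc) hij ?_ ?_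
  · rw [hbot] at hfix
    exact hv hfix
  · have : 0 < colorCard c i := by rw [hc, he]; exact hpos
    obtain ⟨x, hx⟩ := Finset.card_pos.mp this
    exact ⟨x, (Finset.mem_filter.mp hx).2⟩
  · intro σ x hx
    refine h.youngFixed_eq_bot ?_
    rw [← colorPartition_eq_of_colorCard hc]
    refine rows_lt_rows_update c σ x ?_ ?_
    · omega
    · rw [hx, hci]

theorem exists_perm_of_colorCard_eq {c c' : Fin d → ℕ} (h : ∀ i, colorCard c i = colorCard c' i) :
    ∃ σ : Equiv.Perm (Fin d), c' ∘ σ = c := by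
  have e : ∀ i, Nonempty ({x // c x = i} ≃ {x // c' x = i}) := by
    intro i
    refine ⟨Fintype.equivOfCardEq ?_⟩
    rw [Fintype.card_subtype, Fintype.card_subtype]
    exact h i
  refine ⟨Equiv.ofFiberEquiv fun i => (e i).some, ?_⟩
  funext x
  exact Equiv.ofFiberEquiv_map _ x

theorem HasYoungWeight.youngFixed_ne_bot (h : HasYoungWeight ρ lam) {c : Fin d → ℕ}
    (hc : ∀ i, colorCard c i = lam.rows.getD i 0) : youngFixed ρ c ≠ ⊥ := by
  obtain ⟨c', hc', v, hv, hfix⟩ := h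
  obtain ⟨σ, rfl⟩ := exists_perm_of_colorCard_eq (c := c') (c' := c) fun i => by rw [hc, hc']
  refine (Submodule.ne_bot_iff _).mpr ⟨_, perm_mem_youngFixed ρ c σ hfix, fun h0 => hv ?_⟩
  exact (ρ.apply_bijective (perm σ)).1 (h0.trans (map_zero _).symm)

end Weights

/-! ### Irreducible supermodules and Schur's lemma -/

section SuperRepresentations

variable {d : ℕ} {V : Type*} [AddCommGroup V] [Module ℂ V]
  {V' : Type*} [AddCommGroup V'] [Module ℂ V']

/-- `P` is the parity involution of a supermodule structure on the representation `ρ`. -/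
structure IsParity (ρ : Representation ℂ (SergeevGroup d) V) (P : Module.End ℂ V) : Prop where
  inv : ∀ v, P (P v) = v
  parity : ∀ x v, P (ρ x v) = zmodSign x.degree • ρ x (P v)

/-- Irreducibility as a supermodule. -/
structure IsSuperIrreducible (ρ : Representation ℂ (SergeevGroup d) V) (P : Module.End ℂ V) :
    Prop extends IsParity ρ P where
  nontrivial : Nontrivial V
  eq_bot_or_eq_top : ∀ W : Submodule ℂ V, (∀ x, ∀ v ∈ W, ρ x v ∈ W) → (∀ v ∈ W, P v ∈ W) →
    W = ⊥ ∨ W = ⊤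

variable {ρ : Representation ℂ (SergeevGroup d) V} {P : Module.End ℂ V}
  {ρ' : Representation ℂ (SergeevGroup d) V'} {P' : Module.End ℂ V'}

theorem IsParity.perm (h : IsParity ρ P) (σ : Equiv.Perm (Fin d)) (v : V) :
    P (ρ (perm σ) v) = ρ (perm σ) (P v) := by
  rw [h.parity, degree_perm]; simp [zmodSign]

theorem IsParity.blockXi (h : IsParity ρ P) (c : Fin d → ℕ) (i : ℕ) (v : V) :
    P (blockXi ρ c i v) = - blockXi ρ c i (P v) := by
  rw [blockXi_apply, blockXi_apply, map_sum, ← Finset.sum_neg_distrib]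
  refine Finset.sum_congr rfl fun x _ => ?_
  rw [h.parity, SergeevGroup.degree_xi]; simp [zmodSign]

theorem IsParity.mem_youngFixed (h : IsParity ρ P) {c : Fin d → ℕ} {v : V}
    (hv : v ∈ youngFixed ρ c) : P v ∈ youngFixed ρ c := by
  intro σ hσ
  rw [← h.perm, hv σ hσ]

/-- The largest graded subspace of a subrepresentation is a subrepresentation. -/
theorem IsParity.stable_inf_comap (h : IsParity ρ P) {M : Submodule ℂ V}
    (hM : ∀ x, ∀ v ∈ M, ρ x v ∈ M) :
    (∀ x, ∀ v ∈ M ⊓ M.comap P, ρ x v ∈ M ⊓ M.comap P) ∧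
      ∀ v ∈ M ⊓ M.comap P, P v ∈ M ⊓ M.comap P := by
  refine ⟨fun x v hv => ⟨hM x v hv.1, ?_⟩, fun v hv => ⟨hv.2, ?_⟩⟩
  · change P (ρ x v) ∈ M
    rw [h.parity]
    exact M.smul_mem _ (hM x _ hv.2)
  · change P (P v) ∈ M
    rw [h.inv]
    exact hv.1

theorem IsSuperIrreducible.bijective (h : IsSuperIrreducible ρ P) (h' : IsSuperIrreducible ρ' P')
    {f : V →ₗ[ℂ] V'} (hf0 : f ≠ 0) (hf : ∀ x v, f (ρ x v) = ρ' x (f v)) {s : ℂ}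
    (hs : s ≠ 0) (hP : ∀ v, P' (f v) = s • f (P v)) : Function.Bijective f := by
  constructor
  · rw [← LinearMap.ker_eq_bot]
    refine (h.eq_bot_or_eq_top (LinearMap.ker f) (fun x v hv => ?_) (fun v hv => ?_)).resolve_right
      fun ht => hf0 (LinearMap.ker_eq_top.mp ht)
    · rw [LinearMap.mem_ker] at hv ⊢
      rw [hf, hv, map_zero]
    · rw [LinearMap.mem_ker] at hv ⊢
      have := hP v
      rw [hv, map_zero] at this
      exact (smul_eq_zero.mp this.symm).resolve_left hs
  · rw [← LinearMap.range_eq_top]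
    refine (h'.eq_bot_or_eq_top (LinearMap.range f) ?_ ?_).resolve_left
      fun ht => hf0 (LinearMap.range_eq_bot.mp ht)
    · rintro x _ ⟨v, rfl⟩
      exact ⟨ρ x v, hf x v⟩
    · rintro _ ⟨v, rfl⟩
      exact ⟨s • P v, by rw [hP, map_smul]⟩

/-- Commuting with P makes the eigenspaces graded; an odd endomorphism need not be scalar. -/
theorem IsSuperIrreducible.exists_eq_smul [FiniteDimensional ℂ V] (h : IsSuperIrreducible ρ P)
    {f : Module.End ℂ V} (hf : ∀ x v, f (ρ x v) = ρ x (f v)) (hP : ∀ v, P (f v) = f (P v)) :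
    ∃ r : ℂ, f = r • 1 := by
  have := h.nontrivial
  obtain ⟨r, hr⟩ := Module.End.exists_eigenvalue f
  refine ⟨r, ?_⟩
  have ht := (h.eq_bot_or_eq_top (f.eigenspace r) (fun x v hv => ?_) (fun v hv => ?_)).resolve_left
    hr
  · ext v
    have : v ∈ f.eigenspace r := by rw [ht]; trivial
    simpa using Module.End.mem_eigenspace_iff.mp this
  · rw [Module.End.mem_eigenspace_iff] at hv ⊢
    rw [hf, hv, map_smul]
  · rw [Module.End.mem_eigenspace_iff] at hv ⊢
    rw [← hP, hv, map_smul]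

variable {c : Fin d → ℕ}

/-- The highest weight space is an irreducible graded Clifford module, since a proper nonzero K
would generate a subrepresentation that still misses part of this weight space. Intersecting with
the preimage under P makes that subrepresentation graded. -/
theorem IsSuperIrreducible.eq_bot_or_eq_youngFixed (h : IsSuperIrreducible ρ P)
    (hε : ρ (eps d) = -1) (hc : IsHighestColor ρ c) {K : Submodule ℂ V} (hK : K ≤ youngFixed ρ c)
    (hKp : ∀ i, ∀ v ∈ K, _root_.blockXi ρ c i v ∈ K) (hKP : ∀ v ∈ K, P v ∈ K) :
    K = ⊥ ∨ K = youngFixed ρ c := by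
  obtain ⟨M, hM, hKM, hMK⟩ := exists_stable_inf_youngFixed_le hε hc hKp hK
  have hst := h.toIsParity.stable_inf_comap hM
  have hKM' : K ≤ M ⊓ M.comap P := fun v hv => ⟨hKM hv, hKM (hKP v hv)⟩
  rcases h.eq_bot_or_eq_top _ hst.1 hst.2 with h0 | h1
  · left; rw [h0] at hKM'; exact le_bot_iff.mp hKM'
  · right
    refine le_antisymm hK ((le_inf ?_ le_rfl).trans hMK)
    rw [inf_eq_top_iff] at h1
    rw [h1.1]; exact le_top

end SuperRepresentations

/-! ### Extending maps from highest weight spaces -/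

section Extension

variable {d : ℕ} {V : Type*} [AddCommGroup V] [Module ℂ V]
  {V' : Type*} [AddCommGroup V'] [Module ℂ V']
  {ρ : Representation ℂ (SergeevGroup d) V} {P : Module.End ℂ V}
  {ρ' : Representation ℂ (SergeevGroup d) V'} {P' : Module.End ℂ V'} {c : Fin d → ℕ}

/-- A homogeneous map between highest weight spaces that commutes with the block operators extends
to a homogeneous homomorphism. -/
theorem exists_hom_of_youngFixed (h : IsSuperIrreducible ρ P) (h' : IsSuperIrreducible ρ' P')
    (hε : ρ (eps d) = -1) (hε' : ρ' (eps d) = -1) (hc : IsHighestColor ρ c)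
    (hc' : IsHighestColor ρ' c) {T : youngFixed ρ c →ₗ[ℂ] V'} (hT0 : T ≠ 0)
    (hfix : ∀ k, T k ∈ youngFixed ρ' c)
    (hT : ∀ i (k : youngFixed ρ c), T ⟨blockXi ρ c i k, blockXi_mem_youngFixed ρ c i k.2⟩ = blockXi ρ' c i (T k))
    {s : ℂ} (hs : s = 1 ∨ s = -1)
    (hP : ∀ k, P' (T k) = s • T ⟨P k, h.toIsParity.mem_youngFixed k.2⟩) :
    ∃ f : V →ₗ[ℂ] V', f ≠ 0 ∧ (∀ x v, f (ρ x v) = ρ' x (f v)) ∧ ∀ v, P' (f v) = s • f (P v) := by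
  have hss : s * s = 1 := by rcases hs with rfl | rfl <;> norm_num
  -- The graph Γ of T lies in the highest weight space of V ⊕ V' and generates a subrepresentation
  -- meeting that space only in Γ. Irreducibility of both summands makes it the graph of a
  -- homomorphism.
  set R := ρ.prod ρ'
  have hR : ∀ x v, R x v = (ρ x v.1, ρ' x v.2) := fun x v => rfl
  have hRε : R (eps d) = -1 := by
    refine LinearMap.ext fun v => ?_
    rw [hR, hε, hε']; rfl
  have hRfix : ∀ (e : Fin d → ℕ) v,
      v ∈ youngFixed R e ↔ v.1 ∈ youngFixed ρ e ∧ v.2 ∈ youngFixed ρ' e := by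
    intro e v
    constructor
    · intro hv
      exact ⟨fun σ hσ => congrArg Prod.fst (hv σ hσ), fun σ hσ => congrArg Prod.snd (hv σ hσ)⟩
    · intro hv σ hσ
      rw [hR, hv.1 σ hσ, hv.2 σ hσ]
  have hRc : IsHighestColor R c := by
    intro σ x i hi
    rw [eq_bot_iff]
    intro v hv
    obtain ⟨h1, h2⟩ := (hRfix _ v).mp hv
    rw [hc σ x i hi] at h1
    rw [hc' σ x i hi] at h2
    exact Prod.ext h1 h2
  have hRb : ∀ i v, blockXi R c i v = (blockXi ρ c i v.1, blockXi ρ' c i v.2) := by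
    intro i v
    simp only [blockXi_apply]
    ext
    · rw [Prod.fst_sum]; rfl
    · rw [Prod.snd_sum]; rfl
  let Γ : Submodule ℂ (V × V') := LinearMap.range ((youngFixed ρ c).subtype.prod T)
  have hΓ : ∀ v, v ∈ Γ ↔ ∃ k : youngFixed ρ c, (k.1, T k) = v := fun v => Iff.rfl
  have hΓfix : Γ ≤ youngFixed R c := by
    rintro _ ⟨k, rfl⟩
    exact (hRfix c _).mpr ⟨k.2, hfix k⟩
  have hΓb : ∀ i, ∀ v ∈ Γ, blockXi R c i v ∈ Γ := by
    rintro i _ ⟨k, rfl⟩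
    rw [hRb]
    exact ⟨⟨blockXi ρ c i k, blockXi_mem_youngFixed ρ c i k.2⟩, Prod.ext rfl (hT i k)⟩
  obtain ⟨M₀, hM₀, hΓM₀, hM₀Γ⟩ := exists_stable_inf_youngFixed_le hRε hRc hΓb hΓfix
  -- Twisting the parity of V' by s makes Γ stable under Q even when T is odd.
  let Q : Module.End ℂ (V × V') := P.prodMap (s • P')
  have hQv : ∀ v, Q v = (P v.1, s • P' v.2) := fun v => rfl
  have hQ : IsParity R Q := by
    refine ⟨fun v => ?_, fun x v => ?_⟩
    · rw [hQv, hQv]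
      refine Prod.ext (h.inv _) ?_
      simp [smul_smul, hss, h'.inv]
    · rw [hQv, hR, hQv, hR]
      refine Prod.ext (h.parity x _) ?_
      simp only [Prod.smul_snd, map_smul, h'.parity]
      rw [smul_comm]
  obtain ⟨hMR, hMQ⟩ := hQ.stable_inf_comap hM₀
  set M := M₀ ⊓ M₀.comap Q
  have hΓM : Γ ≤ M := by
    intro v hv
    refine ⟨hΓM₀ hv, hΓM₀ ?_⟩
    obtain ⟨k, rfl⟩ := hv
    refine ⟨⟨P k, h.toIsParity.mem_youngFixed k.2⟩, Prod.ext rfl ?_⟩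
    change T _ = s • P' (T k)
    rw [hP, smul_smul, hss, one_smul]
  have hMΓ : M ⊓ youngFixed R c ≤ Γ := (inf_le_inf_right _ inf_le_left).trans hM₀Γ
  obtain ⟨k, hk⟩ : ∃ k, T k ≠ 0 := by
    by_contra hcon
    push Not at hcon
    exact hT0 (LinearMap.ext hcon)
  -- If M contained all of V', it would contain (0, T k), which would then lie in the graph Γ and
  -- force T k = 0.
  have hker : M.comap (LinearMap.inr ℂ V V') = ⊥ := by
    refine (h'.eq_bot_or_eq_top _ (fun x v hv => ?_) (fun v hv => ?_)).resolve_right fun ht => hk ?_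
    · have := hMR x _ hv
      rw [hR] at this
      simpa using this
    · have := M.smul_mem s (hMQ _ hv)
      rw [hQv] at this
      simpa [smul_smul, hss] using this
    · have h1 : (0, T k) ∈ M := by
        have : T k ∈ M.comap (LinearMap.inr ℂ V V') := by rw [ht]; trivial
        exact this
      obtain ⟨k', hk'⟩ := (hΓ _).mp
        (hMΓ ⟨h1, (hRfix c _).mpr ⟨Submodule.zero_mem _, hfix k⟩⟩)
      have h2 : k' = 0 := Subtype.ext (congrArg Prod.fst hk')
      have h3 : T k' = T k := congrArg Prod.snd hk'
      rw [← h3, h2, map_zero]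
  have hrange : M.map (LinearMap.fst ℂ V V') = ⊤ := by
    refine (h.eq_bot_or_eq_top _ ?_ ?_).resolve_left fun hb => hk ?_
    · rintro x _ ⟨v, hv, rfl⟩
      exact ⟨_, hMR x v hv, rfl⟩
    · rintro _ ⟨v, hv, rfl⟩
      exact ⟨_, hMQ v hv, rfl⟩
    · have h1 : k.1 ∈ M.map (LinearMap.fst ℂ V V') := ⟨_, hΓM ((hΓ _).mpr ⟨k, rfl⟩), rfl⟩
      rw [hb] at h1
      have h2 : k = 0 := Subtype.ext h1
      rw [h2, map_zero]
  have huniq : ∀ v w w', (v, w) ∈ M → (v, w') ∈ M → w = w' := by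
    intro v w w' hw hw'
    have h1 : w - w' ∈ M.comap (LinearMap.inr ℂ V V') := by
      have := M.sub_mem hw hw'
      simpa using this
    rw [hker] at h1
    exact sub_eq_zero.mp h1
  have hex : ∀ v, ∃ w, (v, w) ∈ M := by
    intro v
    have hv : v ∈ M.map (LinearMap.fst ℂ V V') := by rw [hrange]; trivial
    obtain ⟨⟨v₁, w⟩, hvw, rfl⟩ := hv
    exact ⟨w, hvw⟩
  choose φ hφ using hex
  let f : V →ₗ[ℂ] V' :=
    { toFun := φ
      map_add' := fun v w => huniq _ _ _ (hφ _) (M.add_mem (hφ v) (hφ w))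
      map_smul' := fun r v => huniq _ _ _ (hφ _) (M.smul_mem r (hφ v)) }
  refine ⟨f, fun h0 => hk ?_, fun x v => huniq _ _ _ (hφ _) (hMR x _ (hφ v)), fun v => ?_⟩
  · have h1 : f k.1 = T k := huniq _ _ _ (hφ _) (hΓM ((hΓ _).mpr ⟨k, rfl⟩))
    rw [← h1, h0, LinearMap.zero_apply]
  · have h1 : f (P v) = s • P' (f v) := huniq _ _ _ (hφ _) (hMQ _ (hφ v))
    rw [h1, smul_smul, hss, one_smul]

end Extension

/-! ### Uniqueness of the irreducibles and their odd endomorphisms -/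

section HighestWeightSpace

variable {d : ℕ} {V : Type*} [AddCommGroup V] [Module ℂ V]
  {ρ : Representation ℂ (SergeevGroup d) V} {P : Module.End ℂ V} {c : Fin d → ℕ}

/-- The block operator on the vectors fixed by the Young subgroup. -/
def youngXi (ρ : Representation ℂ (SergeevGroup d) V) (c : Fin d → ℕ) (i : ℕ) :
    Module.End ℂ (youngFixed ρ c) :=
  (blockXi ρ c i).restrict fun _ hv => blockXi_mem_youngFixed ρ c i hv

/-- The parity involution on the vectors fixed by the Young subgroup. -/
def IsParity.young (h : IsParity ρ P) (c : Fin d → ℕ) : Module.End ℂ (youngFixed ρ c) :=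
  P.restrict fun _ hv => h.mem_youngFixed hv

theorem blockXi_eq_zero {i : ℕ} (hi : colorCard c i = 0) : blockXi ρ c i = 0 := by
  rw [blockXi, Finset.card_eq_zero.mp hi, Finset.sum_empty]

theorem IsParity.isCliffordSystem (h : IsParity ρ P) (hε : ρ (eps d) = -1) {l : ℕ}
    (hl : ∀ i : ℕ, i < l ↔ colorCard c i ≠ 0) :
    IsCliffordSystem (l := l) (fun i => (colorCard c i : ℂ)) (fun i => youngXi ρ c i)
      (h.young c) := by
  refine ⟨fun i => Nat.cast_ne_zero.mpr ((hl i).mp i.2), fun i => ?_, fun i j hij => ?_, ?_,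
    fun i => ?_⟩
  · refine LinearMap.ext fun v => Subtype.ext ?_
    exact blockXi_sq hε c i v.1
  · refine LinearMap.ext fun v => Subtype.ext ?_
    exact blockXi_anticomm hε c (fun h => hij (Fin.ext h)) v.1
  · exact LinearMap.ext fun v => Subtype.ext (h.inv v.1)
  · exact LinearMap.ext fun v => Subtype.ext (h.blockXi c i v.1)

variable {lam : Nat.Partition d}

theorem lt_length_iff_colorCard_ne_zero (hc : ∀ i, colorCard c i = lam.rows.getD i 0) (i : ℕ) :
    i < lam.parts.card ↔ colorCard c i ≠ 0 := by
  rw [hc, ← coe_rows, Multiset.coe_card]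
  constructor
  · intro hi
    rw [List.getD_eq_getElem _ _ hi]
    refine (lam.parts_pos ?_).ne'
    rw [← coe_rows]; exact List.getElem_mem hi
  · intro h
    by_contra hi
    exact h (List.getD_eq_default _ _ (not_lt.mp hi))

/-- Irreducible spin supermodules with the same highest weight are isomorphic up to parity. -/
theorem exists_equivariant_of_highest [FiniteDimensional ℂ V] {V' : Type*} [AddCommGroup V']
    [Module ℂ V'] [FiniteDimensional ℂ V'] {ρ' : Representation ℂ (SergeevGroup d) V'}
    {P' : Module.End ℂ V'} (h : IsSuperIrreducible ρ P) (h' : IsSuperIrreducible ρ' P')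
    (hε : ρ (eps d) = -1) (hε' : ρ' (eps d) = -1) (hlam : HasHighestYoungWeight ρ lam)
    (hlam' : HasHighestYoungWeight ρ' lam) :
    ∃ f : V →ₗ[ℂ] V', Function.Bijective f ∧ ∀ x v, f (ρ x v) = ρ' x (f v) := by
  obtain ⟨c, hc, v, hv0, hv⟩ := hlam.1
  have hl := lt_length_iff_colorCard_ne_zero hc
  have : Nontrivial (youngFixed ρ c) :=
    Submodule.nontrivial_iff_ne_bot.mpr (hlam.1.youngFixed_ne_bot hc)
  have : Nontrivial (youngFixed ρ' c) :=
    Submodule.nontrivial_iff_ne_bot.mpr (hlam'.1.youngFixed_ne_bot hc)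
  -- Both highest weight spaces are graded modules of one Clifford algebra, whose generators square
  -- to the parts of `lam`.
  obtain ⟨s, hs, T, hT0, hT, hTP⟩ := (h.toIsParity.isCliffordSystem hε hl).exists_homogeneous
    (h'.toIsParity.isCliffordSystem hε' hl)
  obtain ⟨f, hf0, hf, hfP⟩ := exists_hom_of_youngFixed h h' hε hε' (hlam.isHighestColor hc)
    (hlam'.isHighestColor hc) (T := (youngFixed ρ' c).subtype ∘ₗ T)
    (fun h0 => hT0 (LinearMap.ext fun k => Subtype.ext (LinearMap.congr_fun h0 k)))
    (fun k => (T k).2) (fun i k => by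
      by_cases hi : i < lam.parts.card
      · exact congrArg Subtype.val (LinearMap.congr_fun (hT ⟨i, hi⟩) k)
      · rw [hl, not_not] at hi
        simp only [blockXi_eq_zero (ρ := ρ) hi, blockXi_eq_zero (ρ := ρ') hi]
        exact map_zero _)
    hs (fun k => congrArg Subtype.val (LinearMap.congr_fun hTP k))
  refine ⟨f, h.bijective h' hf0 hf (s := s) ?_ hfP, hf⟩
  rcases hs with rfl | rfl <;> norm_num

/-- If the highest weight has an odd number of parts, there is an odd automorphism. -/
theorem exists_odd_automorphism (h : IsSuperIrreducible ρ P) (hε : ρ (eps d) = -1)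
    (hlam : HasHighestYoungWeight ρ lam) (hodd : Odd lam.parts.card) :
    ∃ f : V →ₗ[ℂ] V, f ≠ 0 ∧ (∀ x v, f (ρ x v) = ρ x (f v)) ∧ ∀ v, P (f v) = - f (P v) := by
  obtain ⟨c, hc, v, hv0, hv⟩ := hlam.1
  have hl := lt_length_iff_colorCard_ne_zero hc
  -- For an odd number of parts, Z commutes with the block operators and anticommutes with parity,
  -- so it is a Clifford map that extends to V.
  obtain ⟨Z, hZinj, hZb, hZP, _⟩ := (h.toIsParity.isCliffordSystem hε hl).exists_volume
  have hl1 : ((lam.parts.card : ℕ) : ZMod 2) = 1 := ZMod.natCast_eq_one_iff_odd.mpr hodd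
  rw [hl1] at hZb hZP
  have e1 : zmodSign (1 + 1) = 1 := by rw [show (1 + 1 : ZMod 2) = 0 from rfl]; simp [zmodSign]
  have e2 : zmodSign 1 = -1 := by simp [zmodSign]
  simp only [e1, one_smul] at hZb
  rw [e2] at hZP
  obtain ⟨f, hf0, hf, hfP⟩ := exists_hom_of_youngFixed h h hε hε (hlam.isHighestColor hc)
    (hlam.isHighestColor hc) (T := (youngFixed ρ c).subtype ∘ₗ Z)
    (fun h0 => hv0 (by
      have h1 : Z ⟨v, hv⟩ = 0 := Subtype.ext (LinearMap.congr_fun h0 ⟨v, hv⟩)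
      have h2 := hZinj (h1.trans (map_zero Z).symm)
      exact congrArg Subtype.val h2))
    (fun k => (Z k).2) (fun i k => by
      by_cases hi : i < lam.parts.card
      · exact (congrArg Subtype.val (LinearMap.congr_fun (hZb ⟨i, hi⟩) k)).symm
      · rw [hl, not_not] at hi
        simp only [blockXi_eq_zero (ρ := ρ) hi]
        exact map_zero _)
    (Or.inr rfl) (fun k => congrArg Subtype.val (LinearMap.congr_fun hZP k))
  exact ⟨f, hf0, hf, fun v => by rw [hfP, neg_one_smul]⟩

/-- If the highest weight has an even number of parts, there is no odd endomorphism. -/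
theorem odd_endomorphism_eq_zero [FiniteDimensional ℂ V] (h : IsSuperIrreducible ρ P)
    (hε : ρ (eps d) = -1) (hlam : HasHighestYoungWeight ρ lam) (heven : Even lam.parts.card)
    {f : V →ₗ[ℂ] V} (hf : ∀ x v, f (ρ x v) = ρ x (f v)) (hfP : ∀ v, P (f v) = - f (P v)) :
    f = 0 := by
  by_contra hf0
  have hinj := (h.bijective h hf0 hf (s := -1) (by norm_num)
    (fun v => by rw [hfP, neg_one_smul])).1
  obtain ⟨c, hc, -⟩ := hlam.1
  have hl := lt_length_iff_colorCard_ne_zero hc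
  have : Nontrivial (youngFixed ρ c) :=
    Submodule.nontrivial_iff_ne_bot.mpr (hlam.1.youngFixed_ne_bot hc)
  have hC := h.toIsParity.isCliffordSystem hε hl
  obtain ⟨Z, hZinj, hZb, hZP, hZ⟩ := hC.exists_volume
  have hl1 : ((lam.parts.card : ℕ) : ZMod 2) = 0 :=
    (ZMod.natCast_eq_zero_iff_even).mpr heven
  rw [hl1] at hZb hZP
  have e1 : zmodSign (0 + 1) = -1 := by simp [zmodSign]
  have e2 : zmodSign 0 = 1 := by simp [zmodSign]
  have hZb' : ∀ (i : Fin lam.parts.card) (k : youngFixed ρ c),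
      youngXi ρ c i (Z k) = - Z (youngXi ρ c i k) := fun i k => by
    have := LinearMap.congr_fun (hZb i) k
    rw [e1] at this
    exact this.trans (neg_one_smul ℂ (Z (youngXi ρ c i k)))
  rw [e2, one_smul] at hZP
  set p := h.toIsParity.young c
  -- For an even number of parts, Z anticommutes with the block operators and commutes with p. So Z
  -- p commutes with all of them, and it is a scalar because the highest weight space is
  -- irreducible.
  obtain ⟨r, hr⟩ := Module.End.exists_eigenvalue (Z * p)
  have hEb : ∀ i : Fin lam.parts.card, ∀ k ∈ (Z * p).eigenspace r,
      youngXi ρ c i k ∈ (Z * p).eigenspace r := by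
    intro i k hk
    rw [Module.End.mem_eigenspace_iff] at hk ⊢
    have h2 : p (youngXi ρ c i k) = - youngXi ρ c i (p k) := LinearMap.congr_fun (hC.odd i) k
    rw [Module.End.mul_apply] at hk ⊢
    rw [h2, map_neg, ← hZb', hk, map_smul]
  have hEP : ∀ k ∈ (Z * p).eigenspace r, p k ∈ (Z * p).eigenspace r := by
    intro k hk
    rw [Module.End.mem_eigenspace_iff] at hk ⊢
    have h1 : (Z * p) * p = p * (Z * p) := by
      rw [← mul_assoc, hZP]
    rw [← Module.End.mul_apply, h1, Module.End.mul_apply, hk, map_smul]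
  have hE : ((Z * p).eigenspace r).map (youngFixed ρ c).subtype = youngFixed ρ c := by
    refine (h.eq_bot_or_eq_youngFixed hε (hlam.isHighestColor hc)
      (Submodule.map_subtype_le _ _) ?_ ?_).resolve_left fun hb => hr ?_
    · rintro i _ ⟨k, hk, rfl⟩
      by_cases hi : i < lam.parts.card
      · exact ⟨_, hEb ⟨i, hi⟩ k hk, rfl⟩
      · rw [hl, not_not] at hi
        rw [blockXi_eq_zero (ρ := ρ) hi]
        exact Submodule.zero_mem _
    · rintro _ ⟨k, hk, rfl⟩
      exact ⟨_, hEP k hk, rfl⟩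
    · exact Submodule.map_injective_of_injective (Submodule.subtype_injective _)
        (hb.trans (Submodule.map_bot _).symm)
  have hscal : ∀ k : youngFixed ρ c, Z (p k) = r • k := by
    intro k
    have hk : k.1 ∈ ((Z * p).eigenspace r).map (youngFixed ρ c).subtype := by rw [hE]; exact k.2
    obtain ⟨k', hk', he⟩ := hk
    have : k' = k := Subtype.ext he
    rw [← this]
    exact Module.End.mem_eigenspace_iff.mp hk'
  let J : Module.End ℂ (youngFixed ρ c) := f.restrict fun v hv σ hσ => by rw [← hf, hv σ hσ]
  have hJ := hZ J fun i => LinearMap.ext fun v => Subtype.ext (by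
    change f (blockXi ρ c i v) = blockXi ρ c i (f v)
    simp only [blockXi_apply, map_sum, hf])
  have hJp : ∀ k, p (J k) = - J (p k) := fun k => Subtype.ext (hfP k)
  obtain ⟨k, hk⟩ := exists_ne (0 : youngFixed ρ c)
  -- J commutes with Z but anticommutes with p, while Z p is the scalar r.
  have h1 : r • J k = - (r • J k) := by
    calc r • J k = J (Z (p k)) := by rw [hscal, map_smul]
      _ = Z (J (p k)) := LinearMap.congr_fun hJ _
      _ = - Z (p (J k)) := by rw [hJp, map_neg, neg_neg]
      _ = - (r • J k) := by rw [hscal]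
  have h2 : r • J k = 0 := by
    have : (2 : ℂ) • (r • J k) = 0 := by
      rw [two_smul]; nth_rewrite 1 [h1]; exact neg_add_cancel _
    exact (smul_eq_zero.mp this).resolve_left two_ne_zero
  have hpp : p (p k) = k := LinearMap.congr_fun hC.inv k
  -- The case r = 0 contradicts injectivity of Z and p; the case J k = 0 contradicts injectivity of
  -- f.
  rcases smul_eq_zero.mp h2 with h3 | h3
  · have h4 := hscal k
    rw [h3, zero_smul] at h4
    have h5 := hZinj (h4.trans (map_zero Z).symm)
    rw [h5, map_zero] at hpp
    exact hk hpp.symm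
  · refine hk (Subtype.ext (hinj ?_))
    have := congrArg Subtype.val h3
    exact this.trans (map_zero f).symm

end HighestWeightSpace

/-! ### Orthogonality relations -/

section Orthogonality

variable {d : ℕ} {V : Type*} [AddCommGroup V] [Module ℂ V]
  {V' : Type*} [AddCommGroup V'] [Module ℂ V']
  {ρ : Representation ℂ (SergeevGroup d) V} {P : Module.End ℂ V}
  {ρ' : Representation ℂ (SergeevGroup d) V'} {P' : Module.End ℂ V'}

theorem exists_homogeneous_parts (h : IsParity ρ P) (h' : IsParity ρ' P') {f : V →ₗ[ℂ] V'}
    (hf : ∀ x v, f (ρ x v) = ρ' x (f v)) : ∃ f₀ f₁ : V →ₗ[ℂ] V', f = f₀ + f₁ ∧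
      ((∀ x v, f₀ (ρ x v) = ρ' x (f₀ v)) ∧ ∀ v, P' (f₀ v) = f₀ (P v)) ∧
      ((∀ x v, f₁ (ρ x v) = ρ' x (f₁ v)) ∧ ∀ v, P' (f₁ v) = - f₁ (P v)) := by
  set g : V →ₗ[ℂ] V' := P' ∘ₗ f ∘ₗ P
  have hgv : ∀ v, g v = P' (f (P v)) := fun v => rfl
  have hg : ∀ x v, g (ρ x v) = ρ' x (g v) := by
    intro x v
    rw [hgv, h.parity, map_smul, hf, map_smul, h'.parity, smul_smul, zmodSign_mul_self, one_smul]
    rfl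
  have hgP : ∀ v, P' (g v) = f (P v) := fun v => h'.inv _
  have hfP : ∀ v, P' (f v) = g (P v) := fun v => by rw [hgv, h.inv]
  refine ⟨(1 / 2 : ℂ) • (f + g), (1 / 2 : ℂ) • (f - g), ?_, ⟨fun x v => ?_, fun v => ?_⟩,
    fun x v => ?_, fun v => ?_⟩
  · rw [← smul_add, add_add_sub_cancel, ← two_smul ℂ f, smul_smul]; norm_num
  · simp [hf, hg]
  · simp [hfP, hgP, add_comm]
  · simp [hf, hg]
  · simp only [LinearMap.smul_apply, LinearMap.sub_apply, map_smul, map_sub, hfP, hgP]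
    rw [← smul_neg, neg_sub]

theorem HasHighestYoungWeight.of_bijective {lam : Nat.Partition d}
    (hlam : HasHighestYoungWeight ρ lam) {f : V →ₗ[ℂ] V'} (hbij : Function.Bijective f)
    (hf : ∀ x v, f (ρ x v) = ρ' x (f v)) : HasHighestYoungWeight ρ' lam := by
  refine ⟨hlam.1.map hbij.1 hf, fun μ hμ => hlam.2 μ ?_⟩
  let e := LinearEquiv.ofBijective f hbij
  refine hμ.map (f := e.symm.toLinearMap) e.symm.injective fun x v => ?_
  change e.symm (ρ' x v) = ρ x (e.symm v)
  rw [LinearEquiv.symm_apply_eq]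
  change _ = f (ρ x (e.symm v))
  rw [hf]
  change _ = ρ' x (e (e.symm v))
  rw [LinearEquiv.apply_symm_apply]

/-- A nonzero homogeneous part of f would be bijective and would transport the highest weight. -/
theorem hom_eq_zero_of_highest_ne (h : IsSuperIrreducible ρ P) (h' : IsSuperIrreducible ρ' P')
    {lam μ : Nat.Partition d} (hlam : HasHighestYoungWeight ρ lam)
    (hμ : HasHighestYoungWeight ρ' μ) (hne : lam ≠ μ) {f : V →ₗ[ℂ] V'}
    (hf : ∀ x v, f (ρ x v) = ρ' x (f v)) : f = 0 := by
  obtain ⟨f₀, f₁, rfl, ⟨h0, h0P⟩, h1, h1P⟩ := exists_homogeneous_parts h.toIsParity h'.toIsParity hf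
  have e0 : f₀ = 0 := by
    by_contra hn
    exact hne ((hlam.of_bijective (h.bijective h' hn h0 one_ne_zero
      (fun v => by rw [h0P, one_smul])) h0).unique hμ)
  have e1 : f₁ = 0 := by
    by_contra hn
    exact hne ((hlam.of_bijective (h.bijective h' hn h1 (neg_ne_zero.mpr one_ne_zero)
      (fun v => by rw [h1P, neg_one_smul])) h1).unique hμ)
  rw [e0, e1, add_zero]

variable [Fintype (SergeevGroup d)]

theorem sum_character_eq_finrank [FiniteDimensional ℂ V] [FiniteDimensional ℂ V'] :
    ∑ g, ρ'.character g * ρ.character g⁻¹ =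
      Nat.card (SergeevGroup d) * Module.finrank ℂ (Representation.IntertwiningMap ρ ρ') := by
  have hn : (Nat.card (SergeevGroup d) : ℂ) ≠ 0 := Nat.cast_ne_zero.mpr Nat.card_pos.ne'
  let _ : Invertible (Nat.card (SergeevGroup d) : ℂ) := invertibleOfNonzero hn
  rw [← Representation.card_inv_mul_sum_char_mul_char_eq_finrank ρ ρ', mul_inv_cancel_left₀ hn]

theorem sum_character_of_highest_ne [FiniteDimensional ℂ V] [FiniteDimensional ℂ V']
    (h : IsSuperIrreducible ρ P) (h' : IsSuperIrreducible ρ' P')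
    {lam μ : Nat.Partition d} (hlam : HasHighestYoungWeight ρ lam)
    (hμ : HasHighestYoungWeight ρ' μ) (hne : lam ≠ μ) :
    ∑ g, ρ'.character g * ρ.character g⁻¹ = 0 := by
  have : Subsingleton (Representation.IntertwiningMap ρ ρ') := by
    refine ⟨fun a b => ?_⟩
    have key : ∀ a : Representation.IntertwiningMap ρ ρ', a.toLinearMap = 0 := fun a =>
      hom_eq_zero_of_highest_ne h h' hlam hμ hne fun x v => LinearMap.congr_fun (a.isIntertwining' x) v
    ext1
    rw [key a, key b]
  rw [sum_character_eq_finrank, Module.finrank_zero_of_subsingleton, Nat.cast_zero, mul_zero]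

theorem sum_character_self_of_even [FiniteDimensional ℂ V] (h : IsSuperIrreducible ρ P)
    (hε : ρ (eps d) = -1) {lam : Nat.Partition d} (hlam : HasHighestYoungWeight ρ lam)
    (heven : Even lam.parts.card) :
    ∑ g, ρ.character g * ρ.character g⁻¹ = Nat.card (SergeevGroup d) := by
  have := h.nontrivial
  have h1 : Module.finrank ℂ (Representation.IntertwiningMap ρ ρ) = 1 := by
    let e : Representation.IntertwiningMap ρ ρ := ⟨LinearMap.id, fun _ => rfl⟩
    refine finrank_eq_one e ?_ fun a => ?_
    · intro h0
      obtain ⟨v, hv⟩ := exists_ne (0 : V)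
      exact hv (LinearMap.congr_fun (congrArg Representation.IntertwiningMap.toLinearMap h0) v)
    · have hf : ∀ x v, a.toLinearMap (ρ x v) = ρ x (a.toLinearMap v) :=
        fun x v => LinearMap.congr_fun (a.isIntertwining' x) v
      obtain ⟨f₀, f₁, hsum, ⟨h0, h0P⟩, h1, h1P⟩ :=
        exists_homogeneous_parts h.toIsParity h.toIsParity hf
      obtain ⟨r, hr⟩ := h.exists_eq_smul h0 h0P
      refine ⟨r, ?_⟩
      ext1
      rw [hsum, odd_endomorphism_eq_zero h hε hlam heven h1 h1P, hr, add_zero]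
      rfl
  rw [sum_character_eq_finrank, h1, Nat.cast_one, mul_one]

/-- The endomorphism algebra has basis 1 and an odd automorphism J: composing an odd endomorphism
with J⁻¹ gives an even one, which is a scalar. -/
theorem sum_character_self_of_odd [FiniteDimensional ℂ V] (h : IsSuperIrreducible ρ P)
    (hε : ρ (eps d) = -1) {lam : Nat.Partition d} (hlam : HasHighestYoungWeight ρ lam)
    (hodd : Odd lam.parts.card) :
    ∑ g, ρ.character g * ρ.character g⁻¹ = Nat.card (SergeevGroup d) * 2 := by
  have := h.nontrivial
  obtain ⟨J, hJ0, hJ, hJP⟩ := exists_odd_automorphism h hε hlam hodd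
  have hJbij := h.bijective h hJ0 hJ (neg_ne_zero.mpr one_ne_zero)
    (fun v => by rw [hJP, neg_one_smul])
  let e : Representation.IntertwiningMap ρ ρ := ⟨LinearMap.id, fun _ => rfl⟩
  let j : Representation.IntertwiningMap ρ ρ := ⟨J, fun x => LinearMap.ext fun v => hJ x v⟩
  let Φ : ℂ × ℂ →ₗ[ℂ] Representation.IntertwiningMap ρ ρ :=
    (LinearMap.toSpanSingleton ℂ _ e).coprod (LinearMap.toSpanSingleton ℂ _ j)
  have hΦ : ∀ a b v, (Φ (a, b)).toLinearMap v = a • v + b • J v := fun a b v => rfl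
  have hinj : Function.Injective Φ := by
    rw [injective_iff_map_eq_zero]
    rintro ⟨a, b⟩ hab
    have key : ∀ v, a • v + b • J v = 0 := fun v => by
      rw [← hΦ, hab]; rfl
    obtain ⟨v, hv⟩ := exists_ne (0 : V)
    have h1 := key v
    have h2 := congrArg P (key (P v))
    rw [map_add, map_smul, map_smul, h.inv, hJP, h.inv, map_zero, smul_neg] at h2
    have h3 : (2 : ℂ) • (a • v) = 0 := by
      calc (2 : ℂ) • (a • v) = (a • v + b • J v) + (a • v + -(b • J v)) := by rw [two_smul]; abel
        _ = 0 := by rw [h1, h2, add_zero]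
    have ha : a = 0 := by simpa [hv] using h3
    rw [ha, zero_smul, zero_add] at h1
    have hJv : J v ≠ 0 := fun h0 => hv (hJbij.1 (h0.trans (map_zero J).symm))
    have hb : b = 0 := (smul_eq_zero.mp h1).resolve_right hJv
    rw [ha, hb]; rfl
  have hsurj : Function.Surjective Φ := by
    intro a
    have hf : ∀ x v, a.toLinearMap (ρ x v) = ρ x (a.toLinearMap v) :=
      fun x v => LinearMap.congr_fun (a.isIntertwining' x) v
    obtain ⟨f₀, f₁, hsum, ⟨h0, h0P⟩, h1, h1P⟩ :=
      exists_homogeneous_parts h.toIsParity h.toIsParity hf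
    obtain ⟨r, hr⟩ := h.exists_eq_smul h0 h0P
    let Je := LinearEquiv.ofBijective J hJbij
    have hJe : ∀ v, J (Je.symm v) = v := fun v => Je.apply_symm_apply v
    obtain ⟨t, ht⟩ := h.exists_eq_smul (f := Je.symm.toLinearMap ∘ₗ f₁)
      (fun x v => hJbij.1 (by
        change J (Je.symm (f₁ (ρ x v))) = J (ρ x (Je.symm (f₁ v)))
        rw [hJ, hJe, hJe, h1]))
      (fun v => hJbij.1 (by
        change J (P (Je.symm (f₁ v))) = J (Je.symm (f₁ (P v)))
        have := hJP (Je.symm (f₁ v))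
        rw [hJe, h1P] at this
        rw [hJe, neg_inj.mp this]))
    refine ⟨(r, t), ?_⟩
    ext1
    refine LinearMap.ext fun v => ?_
    rw [hΦ, hsum, LinearMap.add_apply, hr]
    have h2 : f₁ v = J (t • v) := by
      have := congrArg J (LinearMap.congr_fun ht v)
      change J (Je.symm (f₁ v)) = J (t • v) at this
      rw [← this, hJe]
    rw [h2, map_smul]
    rfl
  have hfr : Module.finrank ℂ (Representation.IntertwiningMap ρ ρ) = 2 := by
    rw [← (LinearEquiv.ofBijective Φ ⟨hinj, hsurj⟩).finrank_eq]; simp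
  rw [sum_character_eq_finrank, hfr]; norm_num

end Orthogonality

/-! ### Spin class functions and completeness of the irreducible characters -/

namespace SergeevGroup

variable {d : ℕ}

theorem degree_mul (x y : SergeevGroup d) : (x * y).degree = x.degree + y.degree := by
  have h : ∀ σ, (Cliff.degree d).comp (Cliff.permAction d σ).toMonoidHom = Cliff.degree d := by
    intro σ
    refine Cliff.hom_ext ?_ fun i => ?_
    · simp [permAction_eps]
    · simp [permAction_xi, Cliff.degree_xi]
  have h1 := DFunLike.congr_fun (h x.right) y.left
  change Cliff.degree d (Cliff.permAction d x.right y.left) = _ at h1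
  rw [degree, SemidirectProduct.mul_left, map_mul, h1, toAdd_mul]; rfl

theorem degree_one : (1 : SergeevGroup d).degree = 0 := by simp [degree]

theorem degree_inv (x : SergeevGroup d) : x⁻¹.degree = x.degree := by
  have h := degree_mul x x⁻¹
  rw [mul_inv_cancel, degree_one] at h
  have h2 : ∀ a b : ZMod 2, 0 = a + b → b = a := by decide
  exact h2 _ _ h

theorem eps_mul_comm (x : SergeevGroup d) : eps d * x = x * eps d := by
  refine SemidirectProduct.ext ?_ ?_
  · simp [eps, permAction_eps, Cliff.eps_comm]
  · simp [eps]

/-- Even class functions that change sign under multiplication by `ε`. -/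
structure IsSpinClassFunction (f : SergeevGroup d → ℂ) : Prop where
  conj : ∀ g x, f (g * x * g⁻¹) = f x
  even : ∀ x, x.degree ≠ 0 → f x = 0
  spin : ∀ x, f (eps d * x) = - f x

end SergeevGroup

section Completeness

variable {d : ℕ} [Fintype (SergeevGroup d)]

theorem spinClassFunction_smul_equivariant {f : SergeevGroup d → ℂ} (hf : IsSpinClassFunction f)
    {V : Type*} [AddCommGroup V] [Module ℂ V] (ρ : Representation ℂ (SergeevGroup d) V)
    (g : SergeevGroup d) (v : V) : ∑ x, f x • ρ x (ρ g v) = ρ g (∑ x, f x • ρ x v) := by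
  rw [map_sum]
  refine Fintype.sum_equiv (MulAut.conj g⁻¹).toEquiv _ _ fun x => ?_
  change _ = ρ g (f (g⁻¹ * x * g⁻¹⁻¹) • ρ (g⁻¹ * x * g⁻¹⁻¹) v)
  rw [hf.conj, map_smul, ← Module.End.mul_apply, ← map_mul, ← Module.End.mul_apply, ← map_mul]
  congr 3
  group

/-- Maschke's averaging of a projection over the group, followed by averaging over the parity
involution so that the complement is graded too. -/
theorem exists_stable_complement {V : Type*} [AddCommGroup V] [Module ℂ V]
    {ρ : Representation ℂ (SergeevGroup d) V} {P : Module.End ℂ V} (hP : IsParity ρ P)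
    {W : Submodule ℂ V} (hW : ∀ x, ∀ v ∈ W, ρ x v ∈ W) (hWP : ∀ v ∈ W, P v ∈ W) :
    ∃ q : Module.End ℂ V, (∀ v, q v ∈ W) ∧ (∀ v ∈ W, q v = v) ∧
      (∀ x v, q (ρ x v) = ρ x (q v)) ∧ ∀ v, q (P v) = P (q v) := by
  obtain ⟨p, hp⟩ := W.subtype.exists_leftInverse_of_injective (Submodule.ker_subtype W)
  have hpw : ∀ v (hv : v ∈ W), (p v : V) = v := fun v hv =>
    congrArg Subtype.val (LinearMap.congr_fun hp ⟨v, hv⟩)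
  have hn : (Fintype.card (SergeevGroup d) : ℂ) ≠ 0 := Nat.cast_ne_zero.mpr Fintype.card_ne_zero
  let q₀ : Module.End ℂ V :=
    (Fintype.card (SergeevGroup d) : ℂ)⁻¹ • ∑ x, ρ x ∘ₗ W.subtype ∘ₗ p ∘ₗ ρ x⁻¹
  have hq₀ : ∀ v, q₀ v = (Fintype.card (SergeevGroup d) : ℂ)⁻¹ • ∑ x, ρ x (p (ρ x⁻¹ v)) := by
    intro v; simp [q₀]
  have h1 : ∀ v, q₀ v ∈ W := by
    intro v
    rw [hq₀]
    exact W.smul_mem _ (W.sum_mem fun x _ => hW x _ (p _).2)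
  have h2 : ∀ v ∈ W, q₀ v = v := by
    intro v hv
    have : ∀ x, ρ x (p (ρ x⁻¹ v)) = v := by
      intro x
      rw [hpw _ (hW _ v hv), ← Module.End.mul_apply, ← map_mul, mul_inv_cancel, map_one]; rfl
    rw [hq₀, Finset.sum_congr rfl fun x _ => this x, Finset.sum_const, Finset.card_univ,
      ← Nat.cast_smul_eq_nsmul ℂ, inv_smul_smul₀ hn]
  have h3 : ∀ g v, q₀ (ρ g v) = ρ g (q₀ v) := by
    intro g v
    rw [hq₀, hq₀, map_smul, map_sum]
    congr 1
    refine Fintype.sum_equiv (Equiv.mulLeft g⁻¹) _ _ fun x => ?_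
    rw [Equiv.coe_mulLeft, ← Module.End.mul_apply (ρ g), ← map_mul, mul_inv_cancel_left,
      ← Module.End.mul_apply (ρ x⁻¹), ← map_mul, mul_inv_rev, inv_inv]
  refine ⟨(1 / 2 : ℂ) • (q₀ + P ∘ₗ q₀ ∘ₗ P), fun v => ?_, fun v hv => ?_, fun x v => ?_,
    fun v => ?_⟩
  · exact W.smul_mem _ (W.add_mem (h1 v) (hWP _ (h1 _)))
  · simp only [LinearMap.smul_apply, LinearMap.add_apply, LinearMap.comp_apply]
    rw [h2 v hv, h2 _ (hWP v hv), hP.inv, ← two_smul ℂ v, smul_smul]; norm_num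
  · simp only [LinearMap.smul_apply, LinearMap.add_apply, LinearMap.comp_apply, map_smul, map_add]
    rw [h3, hP.parity, map_smul, map_smul, h3, hP.parity, smul_smul, zmodSign_mul_self, one_smul]
  · simp only [LinearMap.smul_apply, LinearMap.add_apply, LinearMap.comp_apply, map_smul, map_add,
      hP.inv]
    rw [add_comm]

omit [Fintype (SergeevGroup d)] in
theorem IsParity.restrict {V : Type*} [AddCommGroup V] [Module ℂ V]
    {ρ : Representation ℂ (SergeevGroup d) V} {P : Module.End ℂ V} (hP : IsParity ρ P)
    (W : Subrepresentation ρ) (hWP : ∀ v ∈ W.toSubmodule, P v ∈ W.toSubmodule) :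
    IsParity W.toRepresentation (P.restrict hWP) :=
  ⟨fun v => Subtype.ext (hP.inv v), fun x v => Subtype.ext (hP.parity x v)⟩

/-- A spin class function orthogonal to the characters of the irreducible spin supermodules acts
as zero on every supermodule. -/
theorem sum_smul_eq_zero {f : SergeevGroup d → ℂ} (hf : IsSpinClassFunction f)
    (horth : ∀ (V : Type) [AddCommGroup V] [Module ℂ V] [FiniteDimensional ℂ V]
      (ρ : Representation ℂ (SergeevGroup d) V) (P : Module.End ℂ V),
      IsSuperIrreducible ρ P → ρ (eps d) = -1 → ∑ x, f x * ρ.character x = 0) (n : ℕ) :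
    ∀ (V : Type) [AddCommGroup V] [Module ℂ V] [FiniteDimensional ℂ V]
      (ρ : Representation ℂ (SergeevGroup d) V) (P : Module.End ℂ V), IsParity ρ P →
      Module.finrank ℂ V = n → ∀ v, ∑ x, f x • ρ x v = 0 := by
  induction n using Nat.strong_induction_on with
  | _ n ih =>
    intro V _ _ _ ρ P hP hn v
    by_cases hV : Nontrivial V
    swap
    · rw [not_nontrivial_iff_subsingleton] at hV
      exact Subsingleton.elim _ _
    by_cases hirr : ∀ W : Submodule ℂ V, (∀ x, ∀ v ∈ W, ρ x v ∈ W) → (∀ v ∈ W, P v ∈ W) →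
        W = ⊥ ∨ W = ⊤
    · have hI : IsSuperIrreducible ρ P := ⟨hP, hV, hirr⟩
      have heε : ∀ v, ρ (eps d) (ρ (eps d) v) = v := by
        intro v
        rw [← Module.End.mul_apply, ← map_mul, eps, ← map_mul, Cliff.eps_sq, map_one, map_one]; rfl
      -- As ε is central of even degree, its fixed space is a graded subrepresentation, so ε acts on
      -- V as -1 or as 1.
      rcases hirr (LinearMap.ker (ρ (eps d) - 1)) (fun x v hv => by
          rw [LinearMap.mem_ker, LinearMap.sub_apply, sub_eq_zero] at hv ⊢
          rw [← Module.End.mul_apply, ← map_mul, eps_mul_comm, map_mul, Module.End.mul_apply, hv]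
          rfl) (fun v hv => by
          rw [LinearMap.mem_ker, LinearMap.sub_apply, sub_eq_zero] at hv ⊢
          have := hP.parity (eps d) v
          rw [hv] at this
          have hdeg : (eps d).degree = 0 := by simp [degree, eps, Cliff.degree_eps]
          rw [hdeg, zmodSign, if_pos rfl, one_smul] at this
          exact this.symm) with hb | ht
      · have hspin : ρ (eps d) = -1 := by
          refine LinearMap.ext fun w => ?_
          have h1 : ρ (eps d) w + w ∈ LinearMap.ker (ρ (eps d) - 1) := by
            rw [LinearMap.mem_ker, LinearMap.sub_apply, map_add, heε, sub_eq_zero]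
            exact add_comm _ _
          rw [hb] at h1
          exact eq_neg_of_add_eq_zero_left h1
        -- The operator is a scalar by Schur's lemma, and its trace is zero by orthogonality.
        obtain ⟨r, hr⟩ := hI.exists_eq_smul (f := ∑ x, f x • ρ x)
          (fun g w => by
            simp only [LinearMap.sum_apply, LinearMap.smul_apply]
            exact spinClassFunction_smul_equivariant hf ρ g w)
          (fun w => by
            simp only [LinearMap.sum_apply, LinearMap.smul_apply, map_sum, map_smul]
            refine Finset.sum_congr rfl fun x _ => ?_
            by_cases hx : x.degree = 0
            · rw [hP.parity, hx]; simp [zmodSign]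
            · rw [hf.even x hx]; simp)
        have htr := congrArg (LinearMap.trace ℂ V) hr
        rw [map_sum, map_smul, LinearMap.trace_one] at htr
        have h0 : ∑ x, LinearMap.trace ℂ V (f x • ρ x) = 0 := by
          rw [← horth V ρ P hI hspin]
          exact Finset.sum_congr rfl fun x _ => by rw [map_smul]; rfl
        rw [h0] at htr
        have hr0 : r = 0 := (smul_eq_zero.mp htr.symm).resolve_right
          (Nat.cast_ne_zero.mpr Module.finrank_pos.ne')
        have := LinearMap.congr_fun hr v
        rw [hr0, zero_smul, LinearMap.sum_apply] at this
        exact this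
      · have h1 : ∀ w, ρ (eps d) w = w := fun w => by
          have : w ∈ LinearMap.ker (ρ (eps d) - 1) := by rw [ht]; trivial
          rw [LinearMap.mem_ker, LinearMap.sub_apply, sub_eq_zero] at this
          exact this
        -- With ε acting trivially, the substitution x ↦ ε x changes the sign of the sum.
        have h2 : ∑ x, f x • ρ x v = ∑ x, - (f x • ρ x v) := by
          rw [← Equiv.sum_comp (Equiv.mulLeft (eps d))]
          refine Finset.sum_congr rfl fun x _ => ?_
          rw [Equiv.coe_mulLeft, hf.spin, map_mul, Module.End.mul_apply, h1, neg_smul]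
        rw [Finset.sum_neg_distrib] at h2
        have h3 : (2 : ℂ) • ∑ x, f x • ρ x v = 0 := by
          rw [two_smul]; nth_rewrite 1 [h2]; exact neg_add_cancel _
        exact (smul_eq_zero.mp h3).resolve_left two_ne_zero
    · push Not at hirr
      obtain ⟨W, hW, hWP, hb, ht⟩ := hirr
      obtain ⟨q, hqW, hq, hqρ, hqP⟩ := exists_stable_complement hP hW hWP
      have key : ∀ U : Submodule ℂ V, (∀ x, ∀ v ∈ U, ρ x v ∈ U) → (∀ v ∈ U, P v ∈ U) → U ≠ ⊤ →
          ∀ u ∈ U, ∑ x, f x • ρ x u = 0 := by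
        intro U hU hUP hlt u hu
        have := ih (Module.finrank ℂ U) (hn ▸ Submodule.finrank_lt hlt) U
          (Subrepresentation.toRepresentation ⟨U, fun g v hv => hU g v hv⟩) _
          (hP.restrict ⟨U, fun g v hv => hU g v hv⟩ hUP) rfl ⟨u, hu⟩
        have := congrArg Subtype.val this
        rw [AddSubmonoidClass.coe_finsetSum] at this
        exact this
      have h1 := key W hW hWP ht (q v) (hqW v)
      have h2 := key (LinearMap.ker q) (fun x w hw => by
          rw [LinearMap.mem_ker] at hw ⊢; rw [hqρ, hw, map_zero]) (fun w hw => by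
          rw [LinearMap.mem_ker] at hw ⊢; rw [hqP, hw, map_zero]) (fun hk => hb ?_) (v - q v) (by
          rw [LinearMap.mem_ker, map_sub, hq _ (hqW v), sub_self])
      · have : v = q v + (v - q v) := by abel
        rw [this]
        simp only [map_add, smul_add, Finset.sum_add_distrib]
        rw [h1, h2, add_zero]
      · rw [eq_bot_iff]
        intro w hw
        have : w ∈ LinearMap.ker q := by rw [hk]; trivial
        rw [LinearMap.mem_ker, hq w hw] at this
        exact this

/-- On the regular representation, graded by degree, the operator ∑ f(x) ρ(x) sends the delta
function at 1 to f. -/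
theorem eq_zero_of_orthogonal {f : SergeevGroup d → ℂ} (hf : IsSpinClassFunction f)
    (horth : ∀ (V : Type) [AddCommGroup V] [Module ℂ V] [FiniteDimensional ℂ V]
      (ρ : Representation ℂ (SergeevGroup d) V) (P : Module.End ℂ V),
      IsSuperIrreducible ρ P → ρ (eps d) = -1 → ∑ x, f x * ρ.character x = 0) : f = 0 := by
  classical
  let ρ : Representation ℂ (SergeevGroup d) (SergeevGroup d → ℂ) :=
    { toFun := fun x => LinearMap.funLeft ℂ ℂ fun y => x⁻¹ * y
      map_one' := by ext; simp [LinearMap.funLeft_apply]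
      map_mul' := fun x y => by ext; simp [LinearMap.funLeft_apply, mul_assoc] }
  have hρ : ∀ x h y, ρ x h y = h (x⁻¹ * y) := fun _ _ _ => rfl
  let P : Module.End ℂ (SergeevGroup d → ℂ) :=
    { toFun := fun h y => zmodSign y.degree * h y
      map_add' := fun h h' => by ext; simp [mul_add]
      map_smul' := fun r h => by ext; simp [mul_left_comm] }
  have hPv : ∀ h y, P h y = zmodSign y.degree * h y := fun _ _ => rfl
  have hP : IsParity ρ P := by
    refine ⟨fun v => ?_, fun x v => ?_⟩
    · ext y; rw [hPv, hPv, ← mul_assoc, zmodSign_mul_self, one_mul]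
    · ext y
      rw [hPv, hρ, Pi.smul_apply, hρ, hPv, degree_mul, degree_inv, zmodSign_add, smul_eq_mul,
        mul_assoc, ← mul_assoc, ← mul_assoc, zmodSign_mul_self, one_mul]
  funext y
  have h := congrFun (sum_smul_eq_zero hf horth _ _ ρ P hP rfl (Pi.single 1 1)) y
  rw [Finset.sum_apply, Finset.sum_eq_single y] at h
  · simpa [hρ] using h
  · intro x _ hx
    have : x⁻¹ * y ≠ 1 := fun h => hx (inv_mul_eq_one.mp h)
    simp [hρ, this]
  · simp

end Completeness

/-! ### Gradings and parity involutions -/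

namespace SpinSupermodule

variable {d : ℕ} (M : SpinSupermodule d)

theorem exists_parity : ∃ P : Module.End ℂ M.carrier,
    (∀ v ∈ M.grade 0, P v = v) ∧ ∀ v ∈ M.grade 1, P v = - v := by
  refine ⟨(M.grade 0).projection _ M.isCompl - (M.grade 1).projection _ M.isCompl.symm,
    fun v hv => ?_, fun v hv => ?_⟩
  · have h1 := Submodule.projection_apply_left M.isCompl ⟨v, hv⟩
    have h2 := Submodule.projection_apply_right M.isCompl.symm ⟨v, hv⟩
    rw [LinearMap.sub_apply, h1, h2, sub_zero]
  · have h1 := Submodule.projection_apply_right M.isCompl ⟨v, hv⟩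
    have h2 := Submodule.projection_apply_left M.isCompl.symm ⟨v, hv⟩
    rw [LinearMap.sub_apply, h1, h2, zero_sub]

/-- The parity involution of a supermodule. -/
noncomputable def parity : Module.End ℂ M.carrier := M.exists_parity.choose

theorem parity_even {v : M.carrier} (hv : v ∈ M.grade 0) : M.parity v = v :=
  M.exists_parity.choose_spec.1 v hv

theorem parity_odd {v : M.carrier} (hv : v ∈ M.grade 1) : M.parity v = - v :=
  M.exists_parity.choose_spec.2 v hv

theorem parity_of_mem {i : ZMod 2} {v : M.carrier} (hv : v ∈ M.grade i) :
    M.parity v = zmodSign i • v := by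
  have h2 : ∀ z : ZMod 2, z = 0 ∨ z = 1 := by decide
  rcases h2 i with rfl | rfl
  · rw [M.parity_even hv]; simp [zmodSign]
  · rw [M.parity_odd hv]; simp [zmodSign]

theorem exists_decomposition (v : M.carrier) :
    ∃ v₀ ∈ M.grade 0, ∃ v₁ ∈ M.grade 1, v₀ + v₁ = v := by
  have : v ∈ M.grade 0 ⊔ M.grade 1 := by rw [M.isCompl.sup_eq_top]; trivial
  exact Submodule.mem_sup.mp this

theorem isParity : IsParity M.ρ M.parity := by
  refine ⟨fun v => ?_, fun x v => ?_⟩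
  · obtain ⟨v₀, h0, v₁, h1, rfl⟩ := M.exists_decomposition v
    simp [M.parity_even h0, M.parity_odd h1]
  · obtain ⟨v₀, h0, v₁, h1, rfl⟩ := M.exists_decomposition v
    simp only [map_add, smul_add, M.parity_of_mem (M.map_grade x _ _ h0),
      M.parity_of_mem (M.map_grade x _ _ h1), M.parity_of_mem h0, M.parity_of_mem h1, map_smul,
      smul_smul]
    rw [zmodSign_add, zmodSign_add, mul_comm, mul_comm (zmodSign 1)]

theorem spin_eq : M.ρ (eps d) = -1 := LinearMap.ext M.spin

theorem isSuperIrreducible (h : M.IsIrreducible) : IsSuperIrreducible M.ρ M.parity := by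
  refine ⟨M.isParity, h.1, fun W hW hWP => h.2 W hW ?_⟩
  refine le_antisymm (sup_le inf_le_left inf_le_left) fun v hv => ?_
  obtain ⟨v₀, h0, v₁, h1, rfl⟩ := M.exists_decomposition v
  have hp := hWP _ hv
  rw [map_add, M.parity_even h0, M.parity_odd h1] at hp
  have e0 : v₀ = (1 / 2 : ℂ) • ((v₀ + v₁) + (v₀ + -v₁)) := by
    rw [show (v₀ + v₁) + (v₀ + -v₁) = (2 : ℂ) • v₀ by rw [two_smul]; abel, smul_smul]; norm_num
  have e1 : v₁ = (1 / 2 : ℂ) • ((v₀ + v₁) - (v₀ + -v₁)) := by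
    rw [show (v₀ + v₁) - (v₀ + -v₁) = (2 : ℂ) • v₁ by rw [two_smul]; abel, smul_smul]; norm_num
  refine Submodule.add_mem_sup ⟨?_, h0⟩ ⟨?_, h1⟩
  · rw [e0]; exact W.smul_mem _ (W.add_mem hv hp)
  · rw [e1]; exact W.smul_mem _ (W.sub_mem hv hp)

/-- The supermodule attached to a representation with a parity involution. -/
def ofParity {V : Type} [AddCommGroup V] [Module ℂ V] [FiniteDimensional ℂ V]
    {ρ : Representation ℂ (SergeevGroup d) V} {P : Module.End ℂ V} (hP : IsParity ρ P)
    (hε : ρ (eps d) = -1) : SpinSupermodule d where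
  carrier := V
  ρ := ρ
  grade i := LinearMap.ker (P - zmodSign i • 1)
  isCompl := by
    have hm : ∀ i v, v ∈ LinearMap.ker (P - zmodSign i • 1) ↔ P v = zmodSign i • v := by
      intro i v
      rw [LinearMap.mem_ker, LinearMap.sub_apply, sub_eq_zero]; rfl
    constructor
    · rw [Submodule.disjoint_def]
      intro v h0 h1
      rw [hm] at h0 h1
      rw [h0] at h1
      simp only [zmodSign, if_true, one_smul, one_ne_zero, if_false, neg_one_smul] at h1
      have h3 : (2 : ℂ) • v = 0 := by
        rw [two_smul]; nth_rewrite 1 [h1]; exact neg_add_cancel _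
      exact (smul_eq_zero.mp h3).resolve_left two_ne_zero
    · rw [codisjoint_iff, eq_top_iff]
      intro v _
      refine Submodule.mem_sup.mpr ⟨(1 / 2 : ℂ) • (v + P v), (hm _ _).mpr ?_,
        (1 / 2 : ℂ) • (v - P v), (hm _ _).mpr ?_, ?_⟩
      · simp [zmodSign, hP.inv, add_comm]
      · simp only [zmodSign, one_ne_zero, if_false, map_smul, map_sub, hP.inv, neg_one_smul]
        rw [← smul_neg, neg_sub]
      · rw [← smul_add, add_add_sub_cancel, ← two_smul ℂ v, smul_smul]; norm_num
  map_grade x i v hv := by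
    rw [LinearMap.mem_ker, LinearMap.sub_apply, sub_eq_zero] at hv ⊢
    have hv' : P v = zmodSign i • v := hv
    change P (ρ x v) = zmodSign _ • ρ x v
    rw [hP.parity, hv', map_smul, smul_smul, zmodSign_add, mul_comm]
  spin v := by rw [hε]; rfl

theorem isIrreducible_of_parity {P : Module.End ℂ M.carrier} (h : IsSuperIrreducible M.ρ P)
    (hgrade : ∀ i, ∀ v ∈ M.grade i, P v = zmodSign i • v) : M.IsIrreducible := by
  refine ⟨h.nontrivial, fun W hW hgr => h.eq_bot_or_eq_top W hW fun v hv => ?_⟩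
  rw [← hgr] at hv
  obtain ⟨v₀, ⟨hw0, h0⟩, v₁, ⟨hw1, h1⟩, rfl⟩ := Submodule.mem_sup.mp hv
  rw [map_add, hgrade 0 v₀ h0, hgrade 1 v₁ h1]
  exact W.add_mem (W.smul_mem _ hw0) (W.smul_mem _ hw1)

theorem ofParity_isIrreducible {V : Type} [AddCommGroup V] [Module ℂ V] [FiniteDimensional ℂ V]
    {ρ : Representation ℂ (SergeevGroup d) V} {P : Module.End ℂ V} (h : IsSuperIrreducible ρ P)
    (hε : ρ (eps d) = -1) : (ofParity h.toIsParity hε).IsIrreducible := by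
  refine isIrreducible_of_parity (ofParity h.toIsParity hε) (P := P) h fun i v hv => ?_
  exact sub_eq_zero.mp hv

end SpinSupermodule

/-! ### Characters of the chosen irreducibles -/

section SpinIrrep

variable {d : ℕ}

/-- `lam` is the highest weight of some irreducible spin supermodule. -/
def IsSpinWeight (lam : Nat.Partition d) : Prop :=
  (spinIrrep lam).IsIrreducible ∧ (spinIrrep lam).HasHighestWeight lam

theorem isSpinWeight_of_exists {lam : Nat.Partition d} {M : SpinSupermodule d}
    (h : M.IsIrreducible) (hlam : M.HasHighestWeight lam) : IsSpinWeight lam :=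
  Classical.epsilon_spec (p := fun M : SpinSupermodule d =>
    M.IsIrreducible ∧ M.HasHighestWeight lam) ⟨M, h, hlam⟩

theorem IsSpinWeight.mem_distincts {lam : Nat.Partition d} (h : IsSpinWeight lam) :
    lam ∈ Nat.Partition.distincts d :=
  HasHighestYoungWeight.mem_distincts (spinIrrep lam).spin_eq h.2

theorem zeta_eq_character (lam : Nat.Partition d) : zeta lam = (spinIrrep lam).ρ.character := rfl

/-- This justifies the choice in `spinIrrep`: an irreducible supermodule is itself a witness for its
highest weight, and the chosen witness is isomorphic to it up to parity. -/
theorem exists_isSpinWeight_character_eq {V : Type} [AddCommGroup V] [Module ℂ V]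
    [FiniteDimensional ℂ V] {ρ : Representation ℂ (SergeevGroup d) V} {P : Module.End ℂ V}
    (h : IsSuperIrreducible ρ P) (hε : ρ (eps d) = -1) :
    ∃ lam : Nat.Partition d, IsSpinWeight lam ∧ ρ.character = zeta lam := by
  have := h.nontrivial
  obtain ⟨lam, hlam⟩ := exists_hasHighestYoungWeight (ρ := ρ)
  have hw : IsSpinWeight lam := isSpinWeight_of_exists
    (SpinSupermodule.ofParity_isIrreducible h hε) hlam
  refine ⟨lam, hw, ?_⟩
  obtain ⟨f, hbij, hf⟩ := exists_equivariant_of_highest h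
    ((spinIrrep lam).isSuperIrreducible hw.1) hε (spinIrrep lam).spin_eq hlam hw.2
  let e := LinearEquiv.ofBijective f hbij
  funext x
  rw [zeta_eq_character, Representation.character, Representation.character,
    ← LinearMap.trace_conj' (ρ x) e]
  congr 1
  refine LinearMap.ext fun v => ?_
  obtain ⟨w, rfl⟩ := e.surjective v
  rw [LinearEquiv.conj_apply_apply, LinearEquiv.symm_apply_apply]
  exact hf x w

variable [Fintype (SergeevGroup d)]

theorem SergeevGroup.IsSpinClassFunction.eq_zero_of_zeta {f : SergeevGroup d → ℂ}
    (hf : IsSpinClassFunction f)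
    (h : ∀ lam : Nat.Partition d, IsSpinWeight lam → ∑ x, f x * zeta lam x = 0) : f = 0 := by
  refine eq_zero_of_orthogonal hf fun V _ _ _ ρ P hI hε => ?_
  obtain ⟨lam, hlam, he⟩ := exists_isSpinWeight_character_eq hI hε
  rw [he]
  exact h lam hlam

theorem sum_zeta_of_ne {lam μ : Nat.Partition d} (hlam : IsSpinWeight lam) (hμ : IsSpinWeight μ)
    (hne : lam ≠ μ) : ∑ x, zeta lam x * zeta μ x⁻¹ = 0 :=
  sum_character_of_highest_ne ((spinIrrep μ).isSuperIrreducible hμ.1)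
    ((spinIrrep lam).isSuperIrreducible hlam.1) hμ.2 hlam.2 hne.symm

/-- `1` for an even number of parts and `2` for an odd number of parts. -/
def spinNorm (lam : Nat.Partition d) : ℂ := if Even lam.parts.card then 1 else 2

theorem sum_zeta_self {lam : Nat.Partition d} (hlam : IsSpinWeight lam) :
    ∑ x, zeta lam x * zeta lam x⁻¹ = Nat.card (SergeevGroup d) * spinNorm lam := by
  unfold spinNorm
  split_ifs with h
  · rw [mul_one]
    exact sum_character_self_of_even ((spinIrrep lam).isSuperIrreducible hlam.1)
      (spinIrrep lam).spin_eq hlam.2 h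
  · exact sum_character_self_of_odd ((spinIrrep lam).isSuperIrreducible hlam.1)
      (spinIrrep lam).spin_eq hlam.2 (Nat.not_even_iff_odd.mp h)

omit [Fintype (SergeevGroup d)] in
theorem isSpinClassFunction_zeta (lam : Nat.Partition d) : IsSpinClassFunction (zeta lam) := by
  refine ⟨fun g x => Representation.char_conj _ _ _, fun x hx => ?_, fun x => ?_⟩
  · refine trace_eq_zero_of_conj_neg (B := (spinIrrep lam).parity)
      (LinearMap.ext (spinIrrep lam).isParity.inv) (LinearMap.ext fun v => ?_)
    rw [Module.End.mul_apply, (spinIrrep lam).isParity.parity, zmodSign, if_neg hx, neg_one_smul]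
    rfl
  · rw [zeta, map_mul, SpinSupermodule.spin_eq, neg_one_mul, map_neg]; rfl

/-- The expansion of a spin class function in irreducible characters, given that all strict
partitions are highest weights. -/
theorem SergeevGroup.IsSpinClassFunction.eq_sum_zeta {f : SergeevGroup d → ℂ}
    (hf : IsSpinClassFunction f) (hall : ∀ lam ∈ Nat.Partition.distincts d, IsSpinWeight lam)
    (y : SergeevGroup d) :
    f y = ∑ lam ∈ Nat.Partition.distincts d,
      (Nat.card (SergeevGroup d) * spinNorm lam)⁻¹ * (∑ x, f x⁻¹ * zeta lam x) * zeta lam y := by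
  have hn : (Nat.card (SergeevGroup d) : ℂ) ≠ 0 := Nat.cast_ne_zero.mpr Nat.card_pos.ne'
  have hs : ∀ lam : Nat.Partition d, spinNorm lam ≠ 0 := by
    intro lam; unfold spinNorm; split_ifs <;> norm_num
  let A : Nat.Partition d → ℂ := fun lam =>
    (Nat.card (SergeevGroup d) * spinNorm lam)⁻¹ * ∑ x, f x⁻¹ * zeta lam x
  let g : SergeevGroup d → ℂ := fun y => ∑ lam ∈ Nat.Partition.distincts d, A lam * zeta lam y
  -- Inverses enter because orthogonality pairs ζ(x) with ζ(x⁻¹), while completeness pairs at the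
  -- same x.
  have hfg : IsSpinClassFunction (fun y => f y⁻¹ - g y⁻¹) := by
    have hz := fun lam : Nat.Partition d => isSpinClassFunction_zeta lam
    refine ⟨fun a x => ?_, fun x hx => ?_, fun x => ?_⟩
    · have h1 : (a * x * a⁻¹)⁻¹ = a * x⁻¹ * a⁻¹ := by group
      simp only [h1, hf.conj, g, (hz _).conj]
    · have hx' : x⁻¹.degree ≠ 0 := by rwa [degree_inv]
      simp only [hf.even _ hx', g, (hz _).even _ hx', mul_zero, Finset.sum_const_zero, sub_zero]
    · have h1 : (eps d * x)⁻¹ = eps d * x⁻¹ := by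
        have : (eps d)⁻¹ = eps d := by
          rw [inv_eq_iff_mul_eq_one, eps, ← map_mul, Cliff.eps_sq, map_one]
        rw [mul_inv_rev, this, eps_mul_comm]
      simp only [h1, hf.spin, g, (hz _).spin, mul_neg, Finset.sum_neg_distrib]
      ring
  have h0 := hfg.eq_zero_of_zeta fun μ hμ => by
    simp only [sub_mul, Finset.sum_sub_distrib, sub_eq_zero]
    have h1 : ∑ x, g x⁻¹ * zeta μ x = ∑ lam ∈ Nat.Partition.distincts d,
        A lam * ∑ x, zeta μ x * zeta lam x⁻¹ := by
      simp only [g, Finset.sum_mul]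
      rw [Finset.sum_comm]
      refine Finset.sum_congr rfl fun lam _ => ?_
      rw [Finset.mul_sum]
      exact Finset.sum_congr rfl fun x _ => by ring
    rw [h1, Finset.sum_eq_single μ]
    · rw [sum_zeta_self hμ]
      have := hs μ
      simp only [A]
      field_simp
    · intro lam hlam hne
      rw [sum_zeta_of_ne hμ (hall lam hlam) hne.symm, mul_zero]
    · intro hn; exact absurd hμ.mem_distincts hn
  have h2 := congrFun h0 y⁻¹
  simp only [inv_inv, Pi.zero_apply, sub_eq_zero] at h2
  exact h2

end SpinIrrep

/-! ### Cycles and centralizers in the symmetric group -/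

section InvariantFunctions

variable {d : ℕ} (σ : Equiv.Perm (Fin d))

theorem comp_eq_iff_sameCycle {X : Type*} (f : Fin d → X) :
    f ∘ σ = f ↔ ∀ x y, σ.SameCycle x y → f x = f y := by
  constructor
  · intro h x y hxy
    obtain ⟨i, rfl⟩ := hxy.exists_nat_pow_eq
    clear hxy
    induction i with
    | zero => rfl
    | succ i ih => rw [pow_succ', Equiv.Perm.mul_apply, ih]; exact (congrFun h _).symm
  · intro h
    funext x
    exact (h x (σ x) (Equiv.Perm.sameCycle_apply_right.mpr (Equiv.Perm.SameCycle.refl σ x))).symm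

/-- The cycle of a point, fixed points included. -/
def cycleIndex (x : Fin d) : {x // σ x = x} ⊕ σ.cycleFactorsFinset :=
  if h : σ x = x then Sum.inl ⟨x, h⟩
  else Sum.inr ⟨σ.cycleOf x, Equiv.Perm.cycleOf_mem_cycleFactorsFinset_iff.mpr
    (Equiv.Perm.mem_support.mpr h)⟩

theorem cycleIndex_surjective : Function.Surjective (cycleIndex σ) := by
  rintro (⟨x, hx⟩ | ⟨c, hc⟩)
  · exact ⟨x, dif_pos hx⟩
  · obtain ⟨x, hx⟩ := (Equiv.Perm.mem_cycleFactorsFinset_iff.mp hc).1.nonempty_support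
    have h1 := Equiv.Perm.cycle_is_cycleOf hx hc
    have h2 : σ x ≠ x := Equiv.Perm.mem_support.mp
      (Equiv.Perm.mem_cycleFactorsFinset_support_le hc hx)
    refine ⟨x, ?_⟩
    rw [cycleIndex, dif_neg h2]
    simp only [← h1]

theorem cycleIndex_eq_iff (x y : Fin d) : cycleIndex σ x = cycleIndex σ y ↔ σ.SameCycle x y := by
  unfold cycleIndex
  constructor
  · intro h
    split_ifs at h with hx hy
    · rw [Sum.inl.injEq, Subtype.mk.injEq] at h
      rw [h]
    · rw [Sum.inr.injEq, Subtype.mk.injEq] at h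
      have h3 := (Equiv.Perm.mem_support_cycleOf_iff (f := σ) (x := y) (y := x)).mp (by
        rw [← h, Equiv.Perm.mem_support_cycleOf_iff]
        exact ⟨Equiv.Perm.SameCycle.refl _ _, Equiv.Perm.mem_support.mpr hx⟩)
      exact h3.1.symm
  · intro h
    by_cases hx : σ x = x
    · have := h.eq_of_left hx
      subst this; rfl
    · have hy : σ y ≠ y := fun hy => hx (h.apply_eq_self_iff.mpr hy)
      rw [dif_neg hx, dif_neg hy, Sum.inr.injEq, Subtype.mk.injEq, h.cycleOf_eq]

theorem card_cycleIndex : Nat.card ({x // σ x = x} ⊕ σ.cycleFactorsFinset) =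
    σ.partition.parts.card := by
  rw [Nat.card_eq_fintype_card, Fintype.card_sum, Equiv.Perm.parts_partition, Multiset.card_add,
    Multiset.card_replicate, add_comm, Fintype.card_coe, Equiv.Perm.cycleType_def,
    Multiset.card_map]
  congr 1
  rw [Fintype.card_subtype, ← Finset.card_compl]
  congr 1
  ext x
  simp

theorem card_invariant_functions (X : Type*) [Finite X] :
    Nat.card {f : Fin d → X // f ∘ σ = f} = Nat.card X ^ σ.partition.parts.card := by
  rw [← card_cycleIndex, ← Nat.card_fun]
  symm
  refine Nat.card_congr (Equiv.ofBijective (fun g => ⟨g ∘ cycleIndex σ, ?_⟩) ⟨?_, ?_⟩)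
  · rw [comp_eq_iff_sameCycle]
    intro x y h
    exact congrArg g ((cycleIndex_eq_iff σ x y).mpr h)
  · intro g g' h
    exact (cycleIndex_surjective σ).injective_comp_right (congrArg Subtype.val h)
  · rintro ⟨f, hf⟩
    rw [comp_eq_iff_sameCycle] at hf
    refine ⟨f ∘ Function.surjInv (cycleIndex_surjective σ), Subtype.ext ?_⟩
    funext x
    exact hf _ _ ((cycleIndex_eq_iff σ _ _).mp (Function.surjInv_eq (cycleIndex_surjective σ) _))

/-- The centralizer formula in terms of `cycleType` treats fixed points separately; counted as parts
equal to 1, they contribute exactly the factorial of their number. -/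
theorem card_centralizer_eq_zNumber {γ : Nat.Partition d} (hσ : σ.partition.parts = γ.parts) :
    Nat.card (Subgroup.centralizer {σ}) = γ.zNumber := by
  rw [Equiv.Perm.nat_card_centralizer, Nat.Partition.zNumber, ← hσ, Finset.prod_mul_distrib,
    ← Finset.prod_multiset_count, Equiv.Perm.parts_partition, Multiset.prod_add,
    Multiset.prod_replicate, one_pow, mul_one, Equiv.Perm.sum_cycleType]
  set m := Fintype.card (Fin d) - σ.support.card
  have h1 : 1 ∉ σ.cycleType.toFinset := by
    rw [Multiset.mem_toFinset]
    intro h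
    exact absurd (Equiv.Perm.one_lt_of_mem_cycleType h) (lt_irrefl _)
  -- When there are no fixed points, the inserted index 1 contributes 0! = 1.
  have h2 : ∏ k ∈ (σ.cycleType + Multiset.replicate m 1).toFinset,
      (Multiset.count k (σ.cycleType + Multiset.replicate m 1)).factorial =
      ∏ k ∈ insert 1 σ.cycleType.toFinset,
        (Multiset.count k (σ.cycleType + Multiset.replicate m 1)).factorial := by
    refine Finset.prod_subset ?_ ?_
    · intro k hk
      rw [Multiset.mem_toFinset, Multiset.mem_add] at hk
      rw [Finset.mem_insert, Multiset.mem_toFinset]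
      rcases hk with hk | hk
      · exact Or.inr hk
      · exact Or.inl (Multiset.eq_of_mem_replicate hk)
    · intro k _ hk
      rw [Multiset.mem_toFinset] at hk
      rw [Multiset.count_eq_zero_of_notMem hk, Nat.factorial_zero]
  rw [h2, Finset.prod_insert h1, Multiset.count_add, Multiset.count_replicate_self,
    Multiset.count_eq_zero_of_notMem (by rwa [← Multiset.mem_toFinset]), zero_add]
  have h3 : ∏ k ∈ σ.cycleType.toFinset,
      (Multiset.count k (σ.cycleType + Multiset.replicate m 1)).factorial =
      ∏ k ∈ σ.cycleType.toFinset, (Multiset.count k σ.cycleType).factorial := by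
    refine Finset.prod_congr rfl fun k hk => ?_
    rw [Multiset.count_add, Multiset.count_replicate, if_neg, add_zero]
    rintro rfl
    exact h1 hk
  rw [h3]
  ring

end InvariantFunctions

theorem Nat.Partition.exists_perm_partition {d : ℕ} (γ : Nat.Partition d) :
    ∃ σ : Equiv.Perm (Fin d), σ.partition.parts = γ.parts := by
  have hsplit := Multiset.filter_add_not (fun n => 2 ≤ n) γ.parts
  have hones : γ.parts.filter (fun n => ¬ 2 ≤ n) =
      Multiset.replicate (γ.parts.filter fun n => ¬ 2 ≤ n).card 1 := by
    refine Multiset.eq_replicate_card.mpr fun n hn => ?_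
    rw [Multiset.mem_filter] at hn
    have := γ.parts_pos hn.1
    omega
  have hsum : (γ.parts.filter fun n => 2 ≤ n).sum +
      (γ.parts.filter fun n => ¬ 2 ≤ n).card = d := by
    have h1 := congrArg Multiset.sum hsplit
    rw [Multiset.sum_add, γ.parts_sum, hones, Multiset.sum_replicate, smul_eq_mul, mul_one] at h1
    exact h1
  obtain ⟨σ, hσ⟩ := (Equiv.Perm.exists_with_cycleType_iff (Fin d)
    (m := γ.parts.filter fun n => 2 ≤ n)).mpr
    ⟨by rw [Fintype.card_fin]; omega, fun n hn => (Multiset.mem_filter.mp hn).2⟩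
  refine ⟨σ, ?_⟩
  rw [Equiv.Perm.parts_partition, ← Equiv.Perm.sum_cycleType, hσ, Fintype.card_fin]
  conv_rhs => rw [← hsplit, hones]
  congr 2
  omega

/-! ### Centralizers of permutations with odd cycles -/

section OddCycles

variable {d : ℕ} {σ : Equiv.Perm (Fin d)} {γ : Nat.Partition d}

theorem odd_orderOf_of_parts (hγ : γ ∈ Nat.Partition.odds d) (hσ : σ.partition.parts = γ.parts) :
    Odd (orderOf σ) := by
  have hodd : ∀ n ∈ σ.cycleType, Odd n := by
    intro n hn
    have h1 : n ∈ γ.parts := by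
      rw [← hσ, Equiv.Perm.parts_partition]
      exact Multiset.mem_add.mpr (Or.inl hn)
    have h2 := (Finset.mem_filter.mp hγ).2 n h1
    exact Nat.not_even_iff_odd.mp h2
  rw [← Equiv.Perm.lcm_cycleType]
  generalize σ.cycleType = s at hodd
  induction s using Multiset.induction with
  | empty => simp
  | cons a s ih =>
    rw [Multiset.lcm_cons]
    exact (Odd.of_dvd_nat ((hodd a (Multiset.mem_cons_self a s)).mul
      (ih fun n hn => hodd n (Multiset.mem_cons_of_mem hn))) (Nat.lcm_dvd_mul _ _))

/-- Iterating σ y = ε y gives σⁿ y = εⁿ y, and at the odd order of σ this reads y = ε y. -/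
theorem permAction_ne_eps_mul (h : Odd (orderOf σ)) (y : Cliff d) :
    Cliff.permAction d σ y ≠ Cliff.eps d * y := by
  intro hy
  have key : ∀ n : ℕ, Cliff.permAction d (σ ^ n) y = Cliff.eps d ^ n * y := by
    intro n
    induction n with
    | zero => simp
    | succ n ih =>
      rw [pow_succ', map_mul, MulAut.mul_apply, ih, map_mul, map_pow, permAction_eps, hy,
        ← mul_assoc, ← pow_succ]
  have h1 := key (orderOf σ)
  rw [pow_orderOf_eq_one, map_one, MulAut.one_apply] at h1
  obtain ⟨k, hk⟩ := h
  have h2 : Cliff.eps d ^ orderOf σ = Cliff.eps d := by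
    rw [hk, pow_succ, pow_mul, pow_two, Cliff.eps_sq, one_pow, one_mul]
  rw [h2] at h1
  exact Cliff.eps_ne_one d (mul_eq_right.mp h1.symm)

theorem support_permAction (σ : Equiv.Perm (Fin d)) (y : Cliff d) :
    Multiplicative.toAdd (Cliff.support d (Cliff.permAction d σ y)) =
      Multiplicative.toAdd (Cliff.support d y) ∘ σ.symm := by
  let r : Multiplicative (Fin d → ZMod 2) →* Multiplicative (Fin d → ZMod 2) :=
    { toFun := fun f => Multiplicative.ofAdd (Multiplicative.toAdd f ∘ σ.symm)
      map_one' := rfl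
      map_mul' := fun _ _ => rfl }
  have h : (Cliff.support d).comp (Cliff.permAction d σ).toMonoidHom =
      r.comp (Cliff.support d) := by
    refine Cliff.hom_ext ?_ fun i => ?_
    · simp [permAction_eps, Cliff.support_eps]
    · simp only [MonoidHom.comp_apply, MulEquiv.coe_toMonoidHom, permAction_xi, Cliff.support_xi]
      apply Multiplicative.toAdd.injective
      change Pi.single (σ i) (1 : ZMod 2) = Pi.single i 1 ∘ σ.symm
      funext j
      by_cases hj : j = σ i
      · subst hj; simp
      · have : σ.symm j ≠ i := fun h => hj ((Equiv.symm_apply_eq σ).mp h)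
        rw [Function.comp_apply, Pi.single_eq_of_ne hj, Pi.single_eq_of_ne this]
  exact congrArg Multiplicative.toAdd (DFunLike.congr_fun h y)

/-- The support determines y up to ε, and odd order rules out the factor ε. -/
theorem permAction_eq_self_iff (h : Odd (orderOf σ)) (y : Cliff d) :
    Cliff.permAction d σ y = y ↔ Multiplicative.toAdd (Cliff.support d y) ∘ σ =
      Multiplicative.toAdd (Cliff.support d y) := by
  have h1 := support_permAction σ y
  constructor
  · intro hy
    rw [hy] at h1
    conv_lhs => rw [h1]
    funext x; simp
  · intro hy
    have h2 : Cliff.support d (Cliff.permAction d σ y * y⁻¹) = 1 := by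
      rw [map_mul, map_inv, mul_inv_eq_one]
      apply Multiplicative.toAdd.injective
      rw [h1]
      conv_lhs => rw [← hy]
      funext x; simp
    rcases Cliff.eq_one_or_eq_eps_of_support h2 with h3 | h3
    · exact mul_inv_eq_one.mp h3
    · exact absurd (mul_inv_eq_iff_eq_mul.mp h3) (permAction_ne_eps_mul h y)

theorem card_support_ker (d : ℕ) : Nat.card (Cliff.support d).ker = 2 := by
  have : ((Cliff.support d).ker : Set (Cliff d)) = {1, Cliff.eps d} := by
    ext y
    constructor
    · exact fun h => Cliff.eq_one_or_eq_eps_of_support h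
    · rintro (rfl | rfl)
      · exact Subgroup.one_mem _
      · exact Cliff.support_eps
  change Nat.card ((Cliff.support d).ker : Set (Cliff d)) = 2
  rw [this, Nat.card_coe_set_eq, Set.ncard_pair (Cliff.eps_ne_one d).symm]

theorem card_comap_support (B : Subgroup (Multiplicative (Fin d → ZMod 2))) :
    Nat.card (B.comap (Cliff.support d)) = 2 * Nat.card B := by
  have h1 := (B.comap (Cliff.support d)).card_mul_index
  rw [Subgroup.index_comap_of_surjective B Cliff.support_surjective,
    ← (Cliff.support d).ker.card_mul_index, card_support_ker, Subgroup.index_ker,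
    MonoidHom.range_eq_top.mpr Cliff.support_surjective, Subgroup.card_top, ← B.card_mul_index,
    ← mul_assoc] at h1
  exact Nat.eq_of_mul_eq_mul_right (Nat.pos_of_ne_zero B.index_ne_zero_of_finite) h1

/-- The fixed elements are the preimage, under a surjection with kernel {1, ε}, of the ℤ/2-valued
functions constant on the cycles of σ. -/
theorem card_permAction_fixed (h : Odd (orderOf σ)) :
    Nat.card {y // Cliff.permAction d σ y = y} = 2 ^ (σ.partition.parts.card + 1) := by
  let B : Subgroup (Multiplicative (Fin d → ZMod 2)) :=
    { carrier := {f | Multiplicative.toAdd f ∘ σ = Multiplicative.toAdd f}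
      mul_mem' := fun {f g} hf hg => by
        change (Multiplicative.toAdd f + Multiplicative.toAdd g) ∘ σ = _ + _
        have hf' : Multiplicative.toAdd f ∘ σ = Multiplicative.toAdd f := hf
        have hg' : Multiplicative.toAdd g ∘ σ = Multiplicative.toAdd g := hg
        rw [Pi.add_comp, hf', hg']
        rfl
      one_mem' := rfl
      inv_mem' := fun {f} hf => by
        change (-Multiplicative.toAdd f) ∘ σ = -_
        have hf' : Multiplicative.toAdd f ∘ σ = Multiplicative.toAdd f := hf
        rw [Pi.neg_comp, hf'] }
  have h1 : Nat.card B = 2 ^ σ.partition.parts.card := by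
    have := card_invariant_functions σ (ZMod 2)
    rw [Nat.card_zmod] at this
    rw [← this]
    rfl
  rw [pow_succ', ← h1, ← card_comap_support]
  exact Nat.card_congr (Equiv.subtypeEquivRight fun y => permAction_eq_self_iff h y)

/-- An element commutes with σ exactly when its Clifford part is fixed by σ and its permutation part
commutes with σ. These two conditions count 2^(ℓ+1) and z_γ. -/
theorem card_centralizer_perm (hγ : γ ∈ Nat.Partition.odds d)
    (hσ : σ.partition.parts = γ.parts) :
    Nat.card (Subgroup.centralizer {perm σ}) = γ.theta := by
  have hodd := odd_orderOf_of_parts hγ hσ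
  have e : (Subgroup.centralizer {perm σ}) ≃
      {y // Cliff.permAction d σ y = y} × Subgroup.centralizer {σ} := by
    have key : ∀ x : SergeevGroup d, x ∈ Subgroup.centralizer {perm σ} ↔
        Cliff.permAction d σ x.left = x.left ∧ x.right ∈ Subgroup.centralizer {σ} := by
      intro x
      rw [Subgroup.mem_centralizer_singleton_iff, Subgroup.mem_centralizer_singleton_iff,
        SemidirectProduct.ext_iff]
      simp [perm, eq_comm]
    exact
      { toFun := fun x => (⟨x.1.left, ((key _).mp x.2).1⟩, ⟨x.1.right, ((key _).mp x.2).2⟩)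
        invFun := fun p => ⟨⟨p.1.1, p.2.1⟩, (key _).mpr ⟨p.1.2, p.2.2⟩⟩
        left_inv := fun x => rfl
        right_inv := fun p => rfl }
  rw [Nat.card_congr e, Nat.card_prod, card_permAction_fixed hodd,
    card_centralizer_eq_zNumber σ hσ, Nat.Partition.theta, hσ]

end OddCycles

/-! ### Class sums and coefficients of the elements u -/

namespace SergeevGroup

variable {d : ℕ}

section ClassFunctions

variable [Fintype (SergeevGroup d)]

theorem coeff_mul_eq_sum (z w : MonoidAlgebra ℂ (SergeevGroup d)) (g : SergeevGroup d) :
    (z * w).coeff g = ∑ h, z.coeff h * w.coeff (h⁻¹ * g) := by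
  rw [MonoidAlgebra.coeff_mul_apply_left, Finsupp.sum_fintype]
  intro h; rw [zero_mul]

theorem IsSpinClassFunction.coeff_mul {z w : MonoidAlgebra ℂ (SergeevGroup d)}
    (hz : IsSpinClassFunction z.coeff) (hw : IsSpinClassFunction w.coeff) :
    IsSpinClassFunction (z * w).coeff := by
  refine ⟨fun g x => ?_, fun x hx => ?_, fun x => ?_⟩
  · rw [coeff_mul_eq_sum, coeff_mul_eq_sum]
    refine (Fintype.sum_equiv (MulAut.conj g).toEquiv _ _ fun h => ?_).symm
    change _ = z.coeff (g * h * g⁻¹) * w.coeff ((g * h * g⁻¹)⁻¹ * (g * x * g⁻¹))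
    rw [hz.conj, show (g * h * g⁻¹)⁻¹ * (g * x * g⁻¹) = g * (h⁻¹ * x) * g⁻¹ by group, hw.conj]
  · rw [coeff_mul_eq_sum]
    refine Finset.sum_eq_zero fun h _ => ?_
    by_cases hh : h.degree = 0
    · rw [hw.even, mul_zero]
      rwa [degree_mul, degree_inv, hh, zero_add]
    · rw [hz.even h hh, zero_mul]
  · rw [coeff_mul_eq_sum, coeff_mul_eq_sum, ← Finset.sum_neg_distrib]
    refine Finset.sum_congr rfl fun h _ => ?_
    rw [← mul_assoc, ← eps_mul_comm, mul_assoc, hw.spin, mul_neg]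

theorem asAlgebraHom_eq_sum {V : Type*} [AddCommGroup V] [Module ℂ V]
    (ρ : Representation ℂ (SergeevGroup d) V) (z : MonoidAlgebra ℂ (SergeevGroup d)) :
    ρ.asAlgebraHom z = ∑ x, z.coeff x • ρ x := by
  rw [Representation.asAlgebraHom_def, MonoidAlgebra.lift_apply, Finsupp.sum_fintype]
  intro x; rw [zero_smul]

end ClassFunctions

theorem eps_mul_eps : eps d * eps d = 1 := by
  rw [eps, ← map_mul, Cliff.eps_sq, map_one]

theorem eps_inv : (eps d)⁻¹ = eps d := inv_eq_of_mul_eq_one_left eps_mul_eps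

theorem eps_mul_eps_mul (x : SergeevGroup d) : eps d * (eps d * x) = x := by
  rw [← mul_assoc, eps_mul_eps, one_mul]

theorem degree_eps : (eps d).degree = 0 := by
  rw [degree, eps, SemidirectProduct.left_inl, Cliff.degree_eps]; rfl

theorem IsSpinClassFunction.comp_inv {f : SergeevGroup d → ℂ} (hf : IsSpinClassFunction f) :
    IsSpinClassFunction fun x => f x⁻¹ := by
  refine ⟨fun g x => ?_, fun x hx => ?_, fun x => ?_⟩
  · rw [show (g * x * g⁻¹)⁻¹ = g * x⁻¹ * g⁻¹ by group, hf.conj]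
  · exact hf.even _ (by rwa [degree_inv])
  · rw [mul_inv_rev, eps_inv, ← eps_mul_comm, hf.spin]

theorem mem_conjClass_iff {γ : Nat.Partition d} {σ : Equiv.Perm (Fin d)}
    (hσ : σ.partition.parts = γ.parts) {x : SergeevGroup d} :
    x ∈ conjClass γ ↔ IsConj (perm σ) x := by
  refine ⟨?_, fun h => ⟨σ, hσ, h⟩⟩
  rintro ⟨τ, hτ, h⟩
  have h1 : IsConj σ τ := Equiv.Perm.partition_eq_of_isConj.mpr
    (Nat.Partition.ext (hσ.trans hτ.symm))
  exact ((SemidirectProduct.inr : _ →* SergeevGroup d).map_isConj h1).trans h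

theorem mem_conjClass_of_isConj {γ : Nat.Partition d} {x y : SergeevGroup d} (h : IsConj x y) :
    x ∈ conjClass γ ↔ y ∈ conjClass γ :=
  ⟨fun ⟨σ, hσ, hx⟩ => ⟨σ, hσ, hx.trans h⟩, fun ⟨σ, hσ, hx⟩ => ⟨σ, hσ, hx.trans h.symm⟩⟩

theorem conj_mem_conjClass {γ : Nat.Partition d} (g x : SergeevGroup d) :
    g * x * g⁻¹ ∈ conjClass γ ↔ x ∈ conjClass γ :=
  (mem_conjClass_of_isConj (isConj_iff.mpr ⟨g, rfl⟩)).symm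

theorem degree_eq_zero_of_mem_conjClass {γ : Nat.Partition d} {x : SergeevGroup d}
    (hx : x ∈ conjClass γ) : x.degree = 0 := by
  obtain ⟨σ, _, h⟩ := hx
  obtain ⟨g, rfl⟩ := isConj_iff.mp h
  rw [degree_mul, degree_mul, degree_inv, degree_perm, add_zero]
  exact CharTwo.add_self_eq_zero _

theorem partition_right_of_mem_conjClass {γ : Nat.Partition d} {x : SergeevGroup d}
    (hx : x ∈ conjClass γ) : x.right.partition.parts = γ.parts := by
  obtain ⟨σ, hσ, h⟩ := hx
  have h1 : IsConj σ x.right := (SemidirectProduct.rightHom : SergeevGroup d →* _).map_isConj h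
  rw [← hσ, Equiv.Perm.partition_eq_of_isConj.mp h1]

theorem perm_inv_mem_conjClass {γ : Nat.Partition d} {σ : Equiv.Perm (Fin d)}
    (hσ : σ.partition.parts = γ.parts) : (perm σ)⁻¹ ∈ conjClass γ := by
  refine ⟨σ⁻¹, ?_, ?_⟩
  · rw [← hσ]
    congr 1
    refine Equiv.Perm.partition_eq_of_isConj.mp ?_
    rw [Equiv.Perm.isConj_iff_cycleType_eq, Equiv.Perm.cycleType_inv]
  · rw [perm, map_inv]; exact IsConj.refl _

/-- Comparing Clifford parts in g σ = ε σ g gives an element y with σ y = ε y, impossible for odd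
order. This is what keeps u_γ from cancelling. -/
theorem eps_mul_perm_notMem_conjClass {γ γ' : Nat.Partition d} (hγ : γ ∈ Nat.Partition.odds d)
    {σ : Equiv.Perm (Fin d)} (hσ : σ.partition.parts = γ.parts) :
    eps d * perm σ ∉ conjClass γ' := by
  intro h
  have h1 : σ.partition.parts = γ'.parts := by
    have := partition_right_of_mem_conjClass h
    rwa [show (eps d * perm σ).right = σ by simp [eps, perm]] at this
  rw [mem_conjClass_iff h1] at h
  obtain ⟨g, hg⟩ := isConj_iff.mp h
  have hodd := odd_orderOf_of_parts hγ hσ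
  have h2 : g * perm σ = eps d * perm σ * g := by rw [← hg]; group
  have h3 := congrArg SemidirectProduct.left h2
  simp only [perm, eps, SemidirectProduct.mul_left, SemidirectProduct.left_inr,
    SemidirectProduct.left_inl, SemidirectProduct.right_inl, SemidirectProduct.mul_right,
    SemidirectProduct.right_inr, map_one, mul_one, one_mul] at h3
  refine permAction_ne_eps_mul hodd g.left ?_
  nth_rewrite 2 [h3]
  rw [← mul_assoc, Cliff.eps_sq, one_mul]

theorem coeff_classSum (γ : Nat.Partition d) (x : SergeevGroup d) [Decidable (x ∈ conjClass γ)] :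
    (classSum γ).coeff x = if x ∈ conjClass γ then 1 else 0 := by
  classical
  simp only [classSum, MonoidAlgebra.coeff_sum, MonoidAlgebra.of_apply, MonoidAlgebra.coeff_single,
    Finsupp.finsetSum_apply, Finsupp.single_apply, Finset.sum_ite_eq', Set.Finite.mem_toFinset]

theorem coeff_u (γ : Nat.Partition d) (x : SergeevGroup d) [Decidable (x ∈ conjClass γ)]
    [Decidable (eps d * x ∈ conjClass γ)] :
    (u γ).coeff x = 1 / 2 * ((if x ∈ conjClass γ then 1 else 0) -
      if eps d * x ∈ conjClass γ then 1 else 0) := by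
  rw [u, MonoidAlgebra.coeff_smul_apply, MonoidAlgebra.coeff_sub, Finsupp.sub_apply,
    MonoidAlgebra.of_apply, MonoidAlgebra.coeff_single_mul_apply, coeff_classSum, eps_inv,
    coeff_classSum, smul_eq_mul, one_mul]

theorem isSpinClassFunction_coeff_u (γ : Nat.Partition d) : IsSpinClassFunction (u γ).coeff := by
  classical
  refine ⟨fun g x => ?_, fun x hx => ?_, fun x => ?_⟩
  · have h1 : eps d * (g * x * g⁻¹) = g * (eps d * x) * g⁻¹ := by
      rw [← mul_assoc, ← mul_assoc, eps_mul_comm, mul_assoc g]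
    simp only [coeff_u, h1, conj_mem_conjClass]
  · have h1 : x ∉ conjClass γ := fun h => hx (degree_eq_zero_of_mem_conjClass h)
    have h2 : eps d * x ∉ conjClass γ := fun h => hx <| by
      simpa only [degree_mul, degree_eps, zero_add] using degree_eq_zero_of_mem_conjClass h
    rw [coeff_u, if_neg h1, if_neg h2, sub_zero, mul_zero]
  · rw [coeff_u, coeff_u, eps_mul_eps_mul]; ring

/-- Coefficients at pure permutations are, up to the factor 1/2, coordinates dual to the u_γ with γ
odd. -/
theorem coeff_u_perm {γ γ' : Nat.Partition d} (hγ : γ ∈ Nat.Partition.odds d)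
    {σ : Equiv.Perm (Fin d)} (hσ : σ.partition.parts = γ.parts) :
    (u γ').coeff (perm σ) = if γ' = γ then 1 / 2 else 0 := by
  classical
  rw [coeff_u, if_neg (eps_mul_perm_notMem_conjClass hγ hσ), sub_zero]
  by_cases h : γ' = γ
  · subst h
    rw [if_pos rfl, if_pos ⟨σ, hσ, IsConj.refl _⟩, mul_one]
  · rw [if_neg h, if_neg fun hm => h ?_, mul_zero]
    exact Nat.Partition.ext ((partition_right_of_mem_conjClass hm).symm.trans hσ)

theorem coeff_sum_u_perm (a : Nat.Partition d → ℂ) {γ : Nat.Partition d}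
    (hγ : γ ∈ Nat.Partition.odds d) {σ : Equiv.Perm (Fin d)} (hσ : σ.partition.parts = γ.parts) :
    (∑ γ ∈ Nat.Partition.odds d, a γ • u γ).coeff (perm σ) = a γ / 2 := by
  rw [MonoidAlgebra.coeff_sum, Finsupp.finsetSum_apply]
  simp only [MonoidAlgebra.coeff_smul_apply, coeff_u_perm hγ hσ, smul_eq_mul, mul_ite, mul_zero,
    Finset.sum_ite_eq', if_pos hγ]
  ring

theorem card_conjClass_mul_theta {γ : Nat.Partition d} (hγ : γ ∈ Nat.Partition.odds d) :
    Nat.card (conjClass γ) * γ.theta = Nat.card (SergeevGroup d) := by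
  obtain ⟨σ, hσ⟩ := γ.exists_perm_partition
  rw [← card_centralizer_perm hγ hσ, Subgroup.nat_card_centralizer_nat_card_stabilizer]
  have h : conjClass γ = MulAction.orbit (ConjAct (SergeevGroup d)) (perm σ) := by
    ext x
    rw [mem_conjClass_iff hσ, ConjAct.mem_orbit_conjAct, isConj_comm]
  rw [h, ← Nat.card_prod]
  exact Nat.card_congr (MulAction.orbitProdStabilizerEquivGroup (ConjAct (SergeevGroup d)) (perm σ))

end SergeevGroup

/-! ### Expansion of products and the structure constants -/

section StructureConstants

variable {d : ℕ}

theorem isSpinClassFunction_coeff_sum_u (s : Finset (Nat.Partition d)) (a : Nat.Partition d → ℂ) :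
    IsSpinClassFunction (∑ γ ∈ s, a γ • u γ).coeff := by
  have h : ∀ x, (∑ γ ∈ s, a γ • u γ).coeff x = ∑ γ ∈ s, a γ * (u γ).coeff x := by
    intro x
    rw [MonoidAlgebra.coeff_sum, Finsupp.finsetSum_apply]; rfl
  have hu := fun γ : Nat.Partition d => isSpinClassFunction_coeff_u γ
  refine ⟨fun g x => ?_, fun x hx => ?_, fun x => ?_⟩
  · simp only [h, (hu _).conj]
  · simp only [h, (hu _).even x hx, mul_zero, Finset.sum_const_zero]
  · simp only [h, (hu _).spin, mul_neg, Finset.sum_neg_distrib]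

theorem finrank_spinIrrep_ne_zero {lam : Nat.Partition d} (h : IsSpinWeight lam) :
    (Module.finrank ℂ (spinIrrep lam).carrier : ℂ) ≠ 0 := by
  have := h.1.1
  exact Nat.cast_ne_zero.mpr Module.finrank_pos.ne'

theorem zeta_eq_of_mem_conjClass (lam : Nat.Partition d) {γ : Nat.Partition d}
    {x y : SergeevGroup d} (hx : x ∈ conjClass γ) (hy : y ∈ conjClass γ) :
    zeta lam x = zeta lam y := by
  obtain ⟨σ, hσ, hx⟩ := hx
  obtain ⟨g, rfl⟩ := isConj_iff.mp (hx.symm.trans ((mem_conjClass_iff hσ).mp hy))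
  exact ((isSpinClassFunction_zeta lam).conj g x).symm

theorem sum_conjClass_zeta (lam : Nat.Partition d) {γ : Nat.Partition d} {x : SergeevGroup d}
    (hx : x ∈ conjClass γ) :
    ∑ y ∈ (Set.toFinite (conjClass γ)).toFinset, zeta lam y =
      Nat.card (conjClass γ) * zeta lam x := by
  rw [Finset.sum_congr rfl fun y hy =>
    zeta_eq_of_mem_conjClass lam ((Set.Finite.mem_toFinset _).mp hy) hx, Finset.sum_const,
    nsmul_eq_mul, ← Set.ncard_eq_toFinset_card, Nat.card_coe_set_eq]

variable [Fintype (SergeevGroup d)]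

theorem sum_coeff_mul_zeta (z : MonoidAlgebra ℂ (SergeevGroup d)) (lam : Nat.Partition d) :
    ∑ x, z.coeff x * zeta lam x =
      LinearMap.trace ℂ (spinIrrep lam).carrier ((spinIrrep lam).ρ.asAlgebraHom z) := by
  rw [asAlgebraHom_eq_sum, map_sum]
  refine Finset.sum_congr rfl fun x _ => ?_
  rw [map_smul]; rfl

/-- Where ε acts as -1, the two halves of u_γ add up to the action of the class sum. -/
theorem sum_coeff_u_mul_zeta (γ lam : Nat.Partition d) :
    ∑ x, (u γ).coeff x * zeta lam x =
      ∑ x ∈ (Set.toFinite (conjClass γ)).toFinset, zeta lam x := by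
  rw [sum_coeff_mul_zeta, u, map_smul, map_sub, map_mul, Representation.asAlgebraHom_of,
    SpinSupermodule.spin_eq, neg_one_mul, sub_neg_eq_add, ← two_smul ℂ, smul_smul]
  norm_num
  rw [classSum, map_sum, map_sum]
  refine Finset.sum_congr rfl fun x _ => ?_
  rw [Representation.asAlgebraHom_of]; rfl

theorem asAlgebraHom_u {lam : Nat.Partition d} (h : IsSpinWeight lam) (γ : Nat.Partition d) :
    (spinIrrep lam).ρ.asAlgebraHom (u γ) = centralChar γ lam • 1 := by
  have hu := isSpinClassFunction_coeff_u γ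
  have hV := (spinIrrep lam).isSuperIrreducible h.1
  have he : ∀ v, (spinIrrep lam).ρ.asAlgebraHom (u γ) v =
      ∑ x, (u γ).coeff x • (spinIrrep lam).ρ x v := by
    intro v; rw [asAlgebraHom_eq_sum, LinearMap.sum_apply]; rfl
  obtain ⟨r, hr⟩ := hV.exists_eq_smul (f := (spinIrrep lam).ρ.asAlgebraHom (u γ))
    (fun x v => by
      rw [he, he]
      exact spinClassFunction_smul_equivariant hu _ x v)
    (fun v => by
      rw [he, he, map_sum]
      refine Finset.sum_congr rfl fun x _ => ?_
      rw [map_smul, hV.parity]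
      by_cases hx : x.degree = 0
      · rw [hx, zmodSign, if_pos rfl, one_smul]
      · rw [hu.even x hx, zero_smul, zero_smul])
  have ht := sum_coeff_mul_zeta (u γ) lam
  rw [sum_coeff_u_mul_zeta, hr, map_smul, LinearMap.trace_one, smul_eq_mul] at ht
  rw [hr, centralChar, ht, mul_div_cancel_right₀ _ (finrank_spinIrrep_ne_zero h)]

theorem sum_coeff_u_mul_u_mul_zeta {lam : Nat.Partition d} (h : IsSpinWeight lam)
    (α β : Nat.Partition d) :
    ∑ x, (u α * u β).coeff x * zeta lam x =
      centralChar α lam * centralChar β lam * Module.finrank ℂ (spinIrrep lam).carrier := by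
  rw [sum_coeff_mul_zeta, map_mul, asAlgebraHom_u h, asAlgebraHom_u h, smul_mul_smul_comm, one_mul,
    map_smul, LinearMap.trace_one, smul_eq_mul]

/-- The pairing of combinations of the `u γ` with the irreducible spin characters. -/
noncomputable def uPairing (d : ℕ) [Fintype (SergeevGroup d)] :
    ((Nat.Partition.odds d) → ℂ) →ₗ[ℂ] ({lam : Nat.Partition d // IsSpinWeight lam} → ℂ) where
  toFun a lam := ∑ γ, a γ * ∑ x, (u γ.1).coeff x * zeta lam.1 x
  map_add' a b := by
    ext lam
    simp only [Pi.add_apply, add_mul, Finset.sum_add_distrib]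
  map_smul' c a := by
    ext lam
    simp only [Pi.smul_apply, smul_eq_mul, RingHom.id_apply, mul_assoc, ← Finset.mul_sum]

theorem uPairing_restrict (a : Nat.Partition d → ℂ)
    (lam : {lam : Nat.Partition d // IsSpinWeight lam}) :
    uPairing d (fun γ => a γ) lam =
      ∑ x, (∑ γ ∈ Nat.Partition.odds d, a γ • u γ).coeff x * zeta lam.1 x := by
  change ∑ γ : Nat.Partition.odds d, a γ * ∑ x, (u γ.1).coeff x * zeta lam.1 x = _
  rw [Finset.sum_coe_sort (Nat.Partition.odds d)
    (fun γ => a γ * ∑ x, (u γ).coeff x * zeta lam.1 x)]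
  simp only [MonoidAlgebra.coeff_sum, Finsupp.finsetSum_apply, MonoidAlgebra.coeff_smul_apply,
    smul_eq_mul, Finset.sum_mul, Finset.mul_sum]
  rw [Finset.sum_comm]
  simp only [mul_assoc]

theorem exists_eq_restrict {X : Type*} (s : Finset X) (a : s → ℂ) :
    ∃ b : X → ℂ, a = fun x : s => b x := by
  classical
  exact ⟨fun x => if h : x ∈ s then a ⟨x, h⟩ else 0, funext fun x => by simp⟩

/-- A combination in the kernel is orthogonal to all irreducible spin characters, hence zero by
completeness; its coefficients are then read off at permutations. -/
theorem uPairing_injective : Function.Injective (uPairing d) := by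
  rw [← LinearMap.ker_eq_bot, LinearMap.ker_eq_bot']
  intro a ha
  obtain ⟨b, rfl⟩ := exists_eq_restrict _ a
  have h0 := (isSpinClassFunction_coeff_sum_u (Nat.Partition.odds d) b).eq_zero_of_zeta
    fun lam hlam => by
      rw [← uPairing_restrict b ⟨lam, hlam⟩, ha]; rfl
  funext γ
  obtain ⟨σ, hσ⟩ := γ.1.exists_perm_partition
  have h1 := coeff_sum_u_perm b γ.2 hσ
  rw [h0] at h1
  exact (div_eq_zero_iff.mp h1.symm).resolve_right two_ne_zero

/-- A squeeze: injectivity of `uPairing` bounds the number of spin weights from below by |OP(d)|,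
strictness bounds it from above by |SP(d)|, and Euler's theorem equates the bounds. No V^λ has to be
constructed. -/
theorem card_isSpinWeight :
    Nat.card {lam : Nat.Partition d // IsSpinWeight lam} = (Nat.Partition.odds d).card := by
  classical
  refine le_antisymm ?_ ?_
  · rw [Nat.Partition.card_odds_eq_card_distincts, Nat.card_eq_fintype_card, Fintype.card_subtype]
    exact Finset.card_le_card fun μ hμ => (Finset.mem_filter.mp hμ).2.mem_distincts
  · have h := LinearMap.finrank_le_finrank_of_injective (uPairing_injective (d := d))
    rw [Module.finrank_fintype_fun_eq_card, Module.finrank_fintype_fun_eq_card,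
      Fintype.card_coe, ← Nat.card_eq_fintype_card] at h
    exact h

theorem isSpinWeight_of_mem_distincts {lam : Nat.Partition d}
    (h : lam ∈ Nat.Partition.distincts d) : IsSpinWeight lam := by
  classical
  have h1 : Finset.univ.filter (fun lam : Nat.Partition d => IsSpinWeight lam) =
      Nat.Partition.distincts d := by
    refine Finset.eq_of_subset_of_card_le
      (fun μ hμ => (Finset.mem_filter.mp hμ).2.mem_distincts) ?_
    rw [← Nat.Partition.card_odds_eq_card_distincts, ← card_isSpinWeight,
      Nat.card_eq_fintype_card, Fintype.card_subtype]
  rw [← h1] at h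
  exact (Finset.mem_filter.mp h).2

/-- The count makes `uPairing` surjective, so some combination of the u_γ pairs with all characters
as the product does, and completeness makes the two equal. The remaining conjugacy classes need not
be examined. -/
theorem exists_u_mul_u_eq_sum (α β : Nat.Partition d) :
    ∃ b : Nat.Partition d → ℂ, u α * u β = ∑ γ ∈ Nat.Partition.odds d, b γ • u γ := by
  classical
  have hsurj : Function.Surjective (uPairing d) := by
    refine (LinearMap.injective_iff_surjective_of_finrank_eq_finrank ?_).mp uPairing_injective
    rw [Module.finrank_fintype_fun_eq_card, Module.finrank_fintype_fun_eq_card,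
      Fintype.card_coe, ← Nat.card_eq_fintype_card, card_isSpinWeight]
  obtain ⟨a, ha⟩ := hsurj fun lam => ∑ x, (u α * u β).coeff x * zeta lam.1 x
  obtain ⟨b, rfl⟩ := exists_eq_restrict _ a
  refine ⟨b, MonoidAlgebra.coeff_injective (DFunLike.coe_injective ?_)⟩
  have hm := (isSpinClassFunction_coeff_u α).coeff_mul (isSpinClassFunction_coeff_u β)
  have hs := isSpinClassFunction_coeff_sum_u (Nat.Partition.odds d) b
  refine sub_eq_zero.mp (IsSpinClassFunction.eq_zero_of_zeta ⟨fun g x => ?_, fun x hx => ?_,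
    fun x => ?_⟩ fun lam hlam => ?_)
  · rw [Pi.sub_apply, hm.conj, hs.conj]; rfl
  · rw [Pi.sub_apply, hm.even x hx, hs.even x hx, sub_zero]
  · rw [Pi.sub_apply, hm.spin, hs.spin, Pi.sub_apply]; ring
  · have h := congrFun ha ⟨lam, hlam⟩
    rw [uPairing_restrict] at h
    simp only [Pi.sub_apply, sub_mul, Finset.sum_sub_distrib]
    rw [h, sub_self]

theorem coeff_u_mul_u_perm (α β : Nat.Partition d) {γ : Nat.Partition d}
    (hγ : γ ∈ Nat.Partition.odds d) {σ : Equiv.Perm (Fin d)} (hσ : σ.partition.parts = γ.parts) :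
    (u α * u β).coeff (perm σ) = γ.theta * ∑ lam ∈ Nat.Partition.distincts d,
      (spinNorm lam)⁻¹ * cNumber lam ^ 2 *
        (centralChar α lam * centralChar β lam * centralChar γ lam) := by
  have hm := (isSpinClassFunction_coeff_u α).coeff_mul (isSpinClassFunction_coeff_u β)
  -- Expanding the inverted function at the inverse permutation makes the coefficients of the
  -- expansion traces of u_α u_β itself.
  have h := hm.comp_inv.eq_sum_zeta (fun lam => isSpinWeight_of_mem_distincts) (perm σ)⁻¹
  simp only [inv_inv] at h
  rw [h, Finset.mul_sum]
  refine Finset.sum_congr rfl fun lam hlam => ?_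
  have hw := isSpinWeight_of_mem_distincts hlam
  have hdim := finrank_spinIrrep_ne_zero hw
  have hc : (Nat.card (conjClass γ) : ℂ) * γ.theta = Nat.card (SergeevGroup d) := by
    exact_mod_cast card_conjClass_mul_theta hγ
  have hG : (Nat.card (SergeevGroup d) : ℂ) ≠ 0 := Nat.cast_ne_zero.mpr Nat.card_pos.ne'
  have hz := sum_conjClass_zeta lam (perm_inv_mem_conjClass hσ)
  rw [← hc] at hG
  rw [sum_coeff_u_mul_u_mul_zeta hw, cNumber, centralChar.eq_def γ, hz, ← hc]
  have h1 := left_ne_zero_of_mul hG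
  have h2 := right_ne_zero_of_mul hG
  field_simp

end StructureConstants

/-- The factor 2 in front compensates for the coefficient 1/2 of u_γ at a permutation; divided by
the norm 1 or 2 it becomes the weight 2 or 1. -/
theorem sum_distincts_eq {d : ℕ} (F : Nat.Partition d → ℂ) :
    2 * ∑ lam ∈ Nat.Partition.distincts d, (spinNorm lam)⁻¹ * F lam =
      ∑ lam ∈ strictEven d, 2 * F lam + ∑ lam ∈ strictOdd d, F lam := by
  rw [strictEven, strictOdd, Finset.mul_sum]
  rw [← Finset.sum_filter_add_sum_filter_not (Nat.Partition.distincts d)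
    fun lam => Even lam.parts.card]
  simp only [Nat.not_even_iff_odd]
  congr 1
  · refine Finset.sum_congr rfl fun lam h => ?_
    rw [spinNorm, if_pos (Finset.mem_filter.mp h).2, inv_one, one_mul]
  · refine Finset.sum_congr rfl fun lam h => ?_
    rw [spinNorm, if_neg (Nat.not_even_iff_odd.mpr (Finset.mem_filter.mp h).2)]
    ring

theorem lemma1p2 (d : ℕ) (α β : Nat.Partition d)
    (hα : α ∈ Nat.Partition.odds d) (hβ : β ∈ Nat.Partition.odds d)
    (a : Nat.Partition d → ℂ) :
    SergeevGroup.u α * SergeevGroup.u β =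
        ∑ γ ∈ Nat.Partition.odds d, a γ • SergeevGroup.u γ ↔
      ∀ γ ∈ Nat.Partition.odds d,
        a γ = (γ.theta : ℂ) *
          (∑ lam ∈ strictEven d,
              2 * cNumber lam ^ 2 * (centralChar α lam * centralChar β lam * centralChar γ lam) +
            ∑ lam ∈ strictOdd d,
              cNumber lam ^ 2 * (centralChar α lam * centralChar β lam * centralChar γ lam)) := by
  have := Fintype.ofFinite (SergeevGroup d)
  have key : ∀ b : Nat.Partition d → ℂ, u α * u β = ∑ γ ∈ Nat.Partition.odds d, b γ • u γ →
      ∀ γ ∈ Nat.Partition.odds d, b γ = (γ.theta : ℂ) *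
          (∑ lam ∈ strictEven d,
              2 * cNumber lam ^ 2 * (centralChar α lam * centralChar β lam * centralChar γ lam) +
            ∑ lam ∈ strictOdd d,
              cNumber lam ^ 2 * (centralChar α lam * centralChar β lam * centralChar γ lam)) := by
    intro b hb γ hγ
    obtain ⟨σ, hσ⟩ := γ.exists_perm_partition
    have h1 := coeff_sum_u_perm b hγ hσ
    rw [← hb, coeff_u_mul_u_perm α β hγ hσ] at h1
    simp only [mul_assoc] at h1 ⊢
    rw [← sum_distincts_eq, mul_left_comm, h1]
    ring
  refine ⟨key a, fun h => ?_⟩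
  obtain ⟨b, hb⟩ := exists_u_mul_u_eq_sum α β
  rw [hb]
  refine Finset.sum_congr rfl fun γ hγ => ?_
  rw [key b hb γ hγ, h γ hγ]
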